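/- Let $X\subset\mathbb{R}^2$ be a finite set, let $r>0$, and let $\mathcal R(X)$ be the Vietoris--Rips complex of $X$ at scale $r$: its simplices are the nonempty subsets of $X$ of Euclidean diameter at most $r$. Suppose that $\mathcal R(X)$ is a two-dimensional, pure and closed simplicial complex, i.e. it has a $2$-simplex and no simplex of higher dimension, every maximal simplex is a $2$-simplex, and every $1$-simplex is contained in at least two $2$-simplices. Let $\mathcal O_2$ be the boundary complex of the octahedron, and let $b_2(\mathcal R(X))$ be the second Betti number (the dimension of $H_2$ with rational coefficients). Let $p:|\mathcal R(X)|\to\mathbb R^2$ be the projection of the geometric realization that sends every vertex to the corresponding point of $X$ and is affine on every simplex, let $\mathcal S(X)=p(|\mathcal R(X)|)$ be the shadow, and let $S\subseteq\mathcal S(X)$ be the set of points $y$ for which $p^{-1}(y)$ consists of exactly two points. Then: 1. $\mathcal R(X)$ has an induced subcomplex isomorphic to $\mathcal O_2$, and $b_2(\mathcal R(X))\neq 0$. 2. $b_2(\mathcal R(X))$ equals the number of connected components of $S$. It also equals the number of cycles $v_0v_1\cdots v_5$ of length $6$ in the $1$-skeleton of $\mathcal R(X)$ (counted as edge sets) that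 satisfy the following: the cycle is drawn in the plane as a simple closed hexagon, the six diagonals $v_iv_{i+2}$ (indices modulo $6$) are edges of $\mathcal R(X)$, and at least two of these diagonals intersect in their interiors. 3. $\mathcal R(X)$ has exactly $b_2(\mathcal R(X))$ induced subcomplexes isomorphic to $\mathcal O_2$. -/

import Mathlib

noncomputable section

/-! ### Abstract simplicial complexes -/

namespace AbstractSimplicialComplex

variable {V W : Type*}

/-- The dimension of `K` is `n`: there is a face with `n + 1` vertices and none with more. -/
def HasDim (K : AbstractSimplicialComplex V) (n : ℕ) : Prop :=
  (∃ s ∈ K.faces, s.card = n + 1) ∧ ∀ s ∈ K.faces, s.card ≤ n + 1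

/-- `K` is an `n`-dimensional pure complex: every maximal face has dimension `n`. -/
def IsPure (K : AbstractSimplicialComplex V) (n : ℕ) : Prop :=
  K.HasDim n ∧ ∀ s, Maximal (fun t => t ∈ K.faces) s → s.card = n + 1

/-- Every `(n - 1)`-simplex (a face with `n` vertices) lies in at least two `n`-simplices. -/
def IsClosedOfDim (K : AbstractSimplicialComplex V) (n : ℕ) : Prop :=
  ∀ s ∈ K.faces, s.card = n →
    ∃ t ∈ K.faces, ∃ u ∈ K.faces, t ≠ u ∧ t.card = n + 1 ∧ u.card = n + 1 ∧ s ⊆ t ∧ s ⊆ u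

/-- The induced subcomplex of `K` on the vertex set `U`. -/
def induced (K : AbstractSimplicialComplex V) (U : Finset V) :
    AbstractSimplicialComplex {v // v ∈ U} where
  faces := {s | s.map (Function.Embedding.subtype _) ∈ K.faces}
  isRelLowerSet_faces := by
    intro s hs
    have h := K.isRelLowerSet_faces hs
    refine ⟨by simpa using h.1, fun t hts ht => ?_⟩
    exact h.2 (Finset.map_subset_map.2 hts) (by simpa using ht)
  singleton_mem v := by
    change Finset.map _ _ ∈ K.faces
    rw [Finset.map_singleton]
    exact K.singleton_mem _

/-- Two complexes are isomorphic: some bijection of the vertices matches the faces. -/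
def Isomorphic (K : AbstractSimplicialComplex V) (L : AbstractSimplicialComplex W) : Prop :=
  ∃ e : V ≃ W, ∀ s : Finset V, s ∈ K.faces ↔ s.map e.toEmbedding ∈ L.faces

/-- The boundary complex of the `(n + 1)`-dimensional cross-polytope: the vertices `(i, true)` and
`(i, false)` are antipodal, and the faces are the nonempty sets without antipodal pairs.
For `n = 2` this is the octahedron. -/
def crossPolytope (n : ℕ) : AbstractSimplicialComplex (Fin (n + 1) × Bool) where
  faces := {s | s.Nonempty ∧ ∀ i, ¬ ((i, true) ∈ s ∧ (i, false) ∈ s)}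
  isRelLowerSet_faces := by
    intro s hs
    exact ⟨hs.1, fun t hts ht => ⟨ht, fun i hi => hs.2 i ⟨hts hi.1, hts hi.2⟩⟩⟩
  singleton_mem v := by
    refine ⟨Finset.singleton_nonempty _, fun i hi => ?_⟩
    rw [Finset.mem_singleton, Finset.mem_singleton] at hi
    have := hi.1.trans hi.2.symm
    simp at this

/-- The vertex sets of the copies of the octahedron that are induced subcomplexes of `K`. -/
def inducedOctahedra (K : AbstractSimplicialComplex V) : Set (Finset V) :=
  {U | (K.induced U).Isomorphic (crossPolytope 2)}

/-! ### Simplicial homology with rational coefficients, finite vertex set -/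

/-- Oriented `n`-chains of `K`: a chain assigns to each ordering `x` of the vertices of an
`n`-simplex a coefficient `c x`, which is multiplied by the sign of `σ` when the ordering is
permuted by `σ`, and `c x = 0` if `x` does not list the vertices of an `n`-simplex. The chain
denotes the sum over the `n`-simplices of `c x • [x 0, …, x n]`, `x` being any ordering. -/
def chains (K : AbstractSimplicialComplex V) (n : ℕ) : Submodule ℚ ((Fin (n + 1) → V) → ℚ) where
  carrier := {c | (∀ (σ : Equiv.Perm (Fin (n + 1))) x,
      c (x ∘ σ) = (((Equiv.Perm.sign σ : ℤˣ) : ℤ) : ℚ) * c x) ∧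
    ∀ x, c x ≠ 0 → ∃ hx : Function.Injective x, Finset.univ.map ⟨x, hx⟩ ∈ K.faces}
  add_mem' := by
    rintro a b ⟨ha, ha'⟩ ⟨hb, hb'⟩
    refine ⟨fun σ x => by simp only [Pi.add_apply, ha σ x, hb σ x, mul_add], fun x hx => ?_⟩
    by_cases h : a x = 0
    · exact hb' x (by simpa [h] using hx)
    · exact ha' x h
  zero_mem' := ⟨fun σ x => by simp, fun x hx => absurd rfl hx⟩
  smul_mem' := by
    rintro q a ⟨ha, ha'⟩
    refine ⟨fun σ x => ?_, fun x hx => ha' x fun h => hx (by simp [h])⟩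
    simp only [Pi.smul_apply, smul_eq_mul, ha σ x]
    ring

/-- The boundary operator: the coefficient of `[y 0, …, y n]` in the boundary of `c` is the sum of
the coefficients of `[v, y 0, …, y n]` over the vertices `v`. On oriented chains this is
`∂ [x 0, …, x (n+1)] = ∑ i, (-1) ^ i [x 0, …, x (i-1), x (i+1), …, x (n+1)]`. -/
def boundaryMap (V : Type*) [Fintype V] (n : ℕ) :
    ((Fin (n + 2) → V) → ℚ) →ₗ[ℚ] ((Fin (n + 1) → V) → ℚ) where
  toFun c y := ∑ v : V, c (Fin.cons v y)
  map_add' a b := by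
    funext y
    simp [Finset.sum_add_distrib]
  map_smul' q a := by
    funext y
    simp [Finset.mul_sum]

/-- The `n`-cycles of `K`. -/
def cycles [Fintype V] (K : AbstractSimplicialComplex V) :
    (n : ℕ) → Submodule ℚ ((Fin (n + 1) → V) → ℚ)
  | 0 => K.chains 0
  | n + 1 => K.chains (n + 1) ⊓ LinearMap.ker (boundaryMap V n)

/-- The `n`-boundaries of `K`. -/
def boundaries [Fintype V] (K : AbstractSimplicialComplex V) (n : ℕ) :
    Submodule ℚ ((Fin (n + 1) → V) → ℚ) :=
  (K.chains (n + 1)).map (boundaryMap V n)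

theorem boundaryMap_mem_chains [Fintype V] (K : AbstractSimplicialComplex V) (n : ℕ)
    {c : (Fin (n + 2) → V) → ℚ} (hc : c ∈ K.chains (n + 1)) :
    boundaryMap V n c ∈ K.chains n := by
  obtain ⟨h1, h2⟩ := hc
  refine ⟨fun σ y => ?_, fun y hy => ?_⟩
  · change ∑ v : V, c (Fin.cons v (y ∘ σ)) = _ * ∑ v : V, c (Fin.cons v y)
    rw [Finset.mul_sum]
    refine Finset.sum_congr rfl fun v _ => ?_
    have := h1 (Equiv.Perm.decomposeFin.symm (0, σ)) (Fin.cons v y)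
    rw [Equiv.Perm.decomposeFin.symm_sign] at this
    simp only [if_true, one_mul] at this
    rw [← this]
    congr 1
    funext i
    refine Fin.cases ?_ (fun j => ?_) i <;> simp
  · obtain ⟨v, -, hv⟩ := Finset.exists_ne_zero_of_sum_ne_zero (show ∑ v : V, c (Fin.cons v y) ≠ 0 from hy)
    obtain ⟨hx, hf⟩ := h2 _ hv
    have hy' : Function.Injective y := (Fin.cons_injective_iff.1 hx).2
    refine ⟨hy', (K.isRelLowerSet_faces hf).2 ?_ ⟨y 0, by simp⟩⟩
    intro w hw
    simp only [Finset.mem_map, Finset.mem_univ, true_and, Function.Embedding.coeFn_mk] at hw ⊢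
    obtain ⟨j, rfl⟩ := hw
    exact ⟨j.succ, by simp⟩

theorem boundaryMap_boundaryMap [Fintype V] (K : AbstractSimplicialComplex V) (n : ℕ)
    {c : (Fin (n + 3) → V) → ℚ} (hc : c ∈ K.chains (n + 2)) :
    boundaryMap V n (boundaryMap V (n + 1) c) = 0 := by
  funext y
  change ∑ v : V, ∑ w : V, c (Fin.cons w (Fin.cons v y)) = 0
  have key : ∀ v w : V, c (Fin.cons w (Fin.cons v y)) = - c (Fin.cons v (Fin.cons w y)) := by
    intro v w
    have := hc.1 (Equiv.swap 0 1) (Fin.cons v (Fin.cons w y))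
    rw [Equiv.Perm.sign_swap (by simp)] at this
    have e : (Fin.cons v (Fin.cons w y) : Fin (n + 3) → V) ∘ (Equiv.swap 0 1) =
        Fin.cons w (Fin.cons v y) := by
      funext i
      refine Fin.cases ?_ (fun j => Fin.cases ?_ (fun k => ?_) j) i
      · rw [Function.comp_apply, Equiv.swap_apply_left]
        rfl
      · rw [Function.comp_apply, show (Fin.succ (0 : Fin (n + 2))) = 1 from rfl,
          Equiv.swap_apply_right]
        rfl
      · rw [Function.comp_apply, Equiv.swap_apply_of_ne_of_ne (Fin.succ_ne_zero _)]
        · simp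
        · exact fun h => Fin.succ_ne_zero k (Fin.succ_injective _ h)
    rw [e] at this
    simpa using this
  have h2 : ∑ v : V, ∑ w : V, c (Fin.cons w (Fin.cons v y)) =
      - ∑ v : V, ∑ w : V, c (Fin.cons w (Fin.cons v y)) := by
    conv_lhs => rw [Finset.sum_comm]
    rw [← Finset.sum_neg_distrib]
    refine Finset.sum_congr rfl fun v _ => ?_
    rw [← Finset.sum_neg_distrib]
    exact Finset.sum_congr rfl fun w _ => key w v
  linarith

theorem boundaries_le_cycles [Fintype V] (K : AbstractSimplicialComplex V) (n : ℕ) :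
    K.boundaries n ≤ K.cycles n := by
  rintro _ ⟨c, hc, rfl⟩
  cases n with
  | zero => exact K.boundaryMap_mem_chains 0 hc
  | succ n => exact ⟨K.boundaryMap_mem_chains _ hc, K.boundaryMap_boundaryMap n hc⟩

/-- The `n`-th Betti number of `K`: the dimension of `n`-cycles modulo `n`-boundaries. -/
def betti [Fintype V] (K : AbstractSimplicialComplex V) (n : ℕ) : ℕ :=
  Module.finrank ℚ (K.cycles n ⧸ (K.boundaries n).submoduleOf (K.cycles n))

/-- The geometric realization of `K`, in barycentric coordinates. -/
def realization [Fintype V] (K : AbstractSimplicialComplex V) : Set (V → ℝ) :=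
  {w | w ∈ stdSimplex ℝ V ∧ ∃ s ∈ K.faces, ∀ v, w v ≠ 0 → v ∈ s}

end AbstractSimplicialComplex

/-! ### Planar Vietoris-Rips complexes -/

/-- The Euclidean plane. -/
abbrev Plane : Type := EuclideanSpace ℝ (Fin 2)

/-- The planar-Rips complex of `X` at scale `r`: the simplices are the nonempty subsets of `X` of
diameter at most `r`. -/
def planarRips (X : Finset Plane) (r : ℝ) (hr : 0 < r) :
    AbstractSimplicialComplex {x // x ∈ X} where
  faces := {s | s.Nonempty ∧ Metric.diam (s : Set {x // x ∈ X}) ≤ r}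
  isRelLowerSet_faces := by
    intro s hs
    refine ⟨hs.1, fun t hts ht => ⟨ht, ?_⟩⟩
    exact (Metric.diam_mono (Finset.coe_subset.2 hts) s.finite_toSet.isBounded).trans hs.2
  singleton_mem v := by
    refine ⟨Finset.singleton_nonempty _, ?_⟩
    rw [Finset.coe_singleton, Metric.diam_singleton]
    exact hr.le

/-- The projection map to the plane: it sends each vertex to itself and is linear on simplices. -/
def ripsProjection (X : Finset Plane) (w : {x // x ∈ X} → ℝ) : Plane :=
  ∑ x, w x • (x : Plane)

/-- The shadow of the planar-Rips complex. -/
def shadow (X : Finset Plane) (r : ℝ) (hr : 0 < r) : Set Plane :=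
  ripsProjection X '' (planarRips X r hr).realization

/-- The points of the shadow with exactly two preimages in the realization of the complex. -/
def doublyCovered (X : Finset Plane) (r : ℝ) (hr : 0 < r) : Set Plane :=
  {y ∈ shadow X r hr | {w ∈ (planarRips X r hr).realization | ripsProjection X w = y}.encard = 2}

/-- The 6-cycles of the planar-Rips complex (each given as its set of six edges, for a cyclic
listing `v 0, …, v 5` of its vertices) that are drawn in the plane as simple hexagons, whose
diagonals joining vertices at distance two along the cycle are edges of the complex, at least two
of these diagonals crossing at interior points. -/
def crossedHexagons (X : Finset Plane) (r : ℝ) (hr : 0 < r) : Set (Set (Sym2 {x // x ∈ X})) :=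
  {E | ∃ v : Fin 6 → {x // x ∈ X}, Function.Injective v ∧
    E = Set.range (fun i => s(v i, v (i + 1))) ∧
    (∀ i, ({v i, v (i + 1)} : Finset {x // x ∈ X}) ∈ (planarRips X r hr).faces) ∧
    (∀ i j, i ≠ j → segment ℝ (v i : Plane) (v (i + 1)) ∩ segment ℝ (v j : Plane) (v (j + 1)) ⊆
      {(v i : Plane), (v (i + 1) : Plane)} ∩ {(v j : Plane), (v (j + 1) : Plane)}) ∧
    (∀ i, ({v i, v (i + 2)} : Finset {x // x ∈ X}) ∈ (planarRips X r hr).faces) ∧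
    ∃ i j, i ≠ j ∧ (openSegment ℝ (v i : Plane) (v (i + 2)) ∩
      openSegment ℝ (v j : Plane) (v (j + 2))).Nonempty}

end

/-!
Let `X` be a finite set of points of the plane whose Rips complex is two-dimensional, pure and
closed. Only the following is used about it: no four points are pairwise adjacent, and each edge
lies in at least two triangles (`IsClosedRips`). The first property implies that no vertex lies in a
triangle of other vertices, so that edges and triangles are nondegenerate and overlapping simplices
have crossing edges (`IsClosedRips.exists_crosses`).

The heart of the proof is the study of two crossing edges. By the triangle inequality, at least one
of each pair of opposite sides of the quadrilateral of their endpoints is an edge. Hence two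
vertex-disjoint overlapping triangles either contain four pairwise adjacent vertices or form a
hexagram, a six-pointed star, whose vertices span an octahedron
(`IsClosedRips.exists_isHexagram_of_triangles`). Closedness provides disjoint triangles on any two
crossing edges, so all crossings come from hexagrams (`IsClosedRips.exists_isHexagram`).

The vertices of a hexagram are in convex position. The sides of its hexagon are not crossed by any
edge (`IsClosedRips.not_crosses_side`), each of its diagonals lies in only two triangles
(`IsClosedRips.eq_of_adj_diagonal`), and hexagrams with a common diagonal have the same vertices
(`IsClosedRips.range_eq`). Everything is then counted by vertex sets of hexagrams.

* Octahedra: an extreme side of a family of triangles in which each side lies in two triangles has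
  both triangles on the same side (`exists_same_side`), hence there is a hexagram. Applied to the
  vertices of an induced octahedron, this shows that they form a hexagram.
* The second Betti number: the octahedra have no triangles in common, and a cycle that vanishes on
  one triangle of each octahedron is zero, again by `exists_same_side` applied to its support
  (`IsClosedRips.cycle_eq_zero_of_forall`, `finrank_cycles_two`). There are no boundaries.
* Components: the points with two preimages form the disjoint union of the open hexagons, each of
  which is decomposed in two ways into triangles of the octahedron
  (`IsClosedRips.exists_preimages`, `IsClosedRips.card_connectedComponents`).
* Hexagons: the crossed hexagons are the boundaries of the hexagons of hexagrams, that is, they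
  consist of the uncrossed edges of the octahedra (`crossedHexagons_eq_image`).
-/

/-! ### Orientation and proper crossings in the plane -/

/-- Twice the signed area of the triangle `a b c`. -/
def orient (a b c : Plane) : ℝ := (b 0 - a 0) * (c 1 - a 1) - (b 1 - a 1) * (c 0 - a 0)

theorem orient_rotate (a b c : Plane) : orient b c a = orient a b c := by
  unfold orient; ring

theorem orient_swap_left (a b c : Plane) : orient b a c = -orient a b c := by
  unfold orient; ring

theorem orient_swap_right (a b c : Plane) : orient a c b = -orient a b c := by
  unfold orient; ring

theorem orient_left_self (a b : Plane) : orient a b a = 0 := by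
  unfold orient; ring

theorem orient_right_self (a b : Plane) : orient a b b = 0 := by
  unfold orient; ring

theorem orient_self (a b : Plane) : orient a a b = 0 := by
  unfold orient; ring

/-- The signed area of a quadrilateral can be computed along either diagonal. -/
theorem orient_add_orient (a b c d : Plane) :
    orient a b c + orient a c d = orient a b d + orient b c d := by
  unfold orient; ring

theorem orient_smul_add_smul (a b c d : Plane) {s t : ℝ} (h : s + t = 1) :
    orient a b (s • c + t • d) = s * orient a b c + t * orient a b d := by
  obtain rfl : s = 1 - t := by linarith
  simp only [orient, PiLp.add_apply, PiLp.smul_apply, smul_eq_mul]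
  ring

theorem orient_sum {ι : Type*} [Fintype ι] (p : ι → Plane) (w : ι → ℝ) (hw : ∑ i, w i = 1)
    (a b : Plane) : orient a b (∑ i, w i • p i) = ∑ i, w i * orient a b (p i) := by
  have hc : ∀ k, (∑ i, w i • p i) k = ∑ i, w i * p i k := by
    intro k
    simp
  have key : ∀ x : Plane, orient a b x =
      (b 0 - a 0) * x 1 - (b 1 - a 1) * x 0 + ((b 1 - a 1) * a 0 - (b 0 - a 0) * a 1) := by
    intro x
    unfold orient
    ring
  simp only [key, hc, mul_add, mul_sub, Finset.sum_add_distrib, Finset.sum_sub_distrib,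
    ← Finset.sum_mul, hw, one_mul, Finset.mul_sum]
  congr 2 <;> exact Finset.sum_congr rfl fun i _ => by ring

/-- A point of the line `ab`, in affine coordinates. -/
theorem exists_eq_of_orient_eq_zero {a b c : Plane} (hab : a ≠ b) (h : orient a b c = 0) :
    ∃ t : ℝ, c = (1 - t) • a + t • b := by
  have h' : (b 0 - a 0) * (c 1 - a 1) - (b 1 - a 1) * (c 0 - a 0) = 0 := h
  by_cases h0 : b 0 - a 0 = 0
  · have h1 : b 1 - a 1 ≠ 0 := by
      intro h1
      apply hab
      ext i
      fin_cases i
      · simp only [Fin.zero_eta]; linarith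
      · simp only [Fin.mk_one]; linarith
    have h2 : c 0 - a 0 = 0 := by
      rw [h0, zero_mul, zero_sub, neg_eq_zero] at h'
      exact (mul_eq_zero.1 h').resolve_left h1
    refine ⟨(c 1 - a 1) / (b 1 - a 1), ?_⟩
    ext i
    fin_cases i
    · simp only [Fin.zero_eta, PiLp.add_apply, PiLp.smul_apply, smul_eq_mul]
      have : b 0 = a 0 := by linarith
      rw [this]; linarith
    · simp only [Fin.mk_one, PiLp.add_apply, PiLp.smul_apply, smul_eq_mul]
      field_simp
      ring
  · refine ⟨(c 0 - a 0) / (b 0 - a 0), ?_⟩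
    ext i
    fin_cases i
    · simp only [Fin.zero_eta, PiLp.add_apply, PiLp.smul_apply, smul_eq_mul]
      field_simp
      ring
    · simp only [Fin.mk_one, PiLp.add_apply, PiLp.smul_apply, smul_eq_mul]
      field_simp
      linear_combination h'

/-- The barycentric coordinates of a point with respect to a nondegenerate triangle are quotients
of signed areas. -/
theorem barycentric (a b c x : Plane) (h : orient a b c ≠ 0) :
    (orient b c x / orient a b c) • a + (orient c a x / orient a b c) • b +
      (orient a b x / orient a b c) • c = x := by
  ext i
  fin_cases i <;>
  · simp only [Fin.zero_eta, Fin.mk_one, PiLp.add_apply, PiLp.smul_apply, smul_eq_mul]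
    field_simp
    unfold orient
    ring

theorem barycentric_sum (a b c x : Plane) (h : orient a b c ≠ 0) :
    orient b c x / orient a b c + orient c a x / orient a b c + orient a b x / orient a b c = 1 := by
  field_simp
  unfold orient
  ring

theorem mem_convexHull_triple {a b c x : Plane} {s t u : ℝ} (hs : 0 ≤ s) (ht : 0 ≤ t) (hu : 0 ≤ u)
    (h : s + t + u = 1) (hx : s • a + t • b + u • c = x) : x ∈ convexHull ℝ {a, b, c} := by
  rw [← hx]
  have := (convex_convexHull ℝ ({a, b, c} : Set Plane)).sum_mem (t := Finset.univ)
    (w := ![s, t, u]) (z := ![a, b, c])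
    (by intro i _; fin_cases i <;> assumption)
    (by simp [Fin.sum_univ_three, h])
    (by intro i _; fin_cases i <;> exact subset_convexHull ℝ _ (by simp))
  simpa [Fin.sum_univ_three] using this

theorem mem_convexHull_of_orient_nonneg {a b c x : Plane} (h : 0 < orient a b c)
    (h1 : 0 ≤ orient a b x) (h2 : 0 ≤ orient b c x) (h3 : 0 ≤ orient c a x) :
    x ∈ convexHull ℝ {a, b, c} :=
  mem_convexHull_triple (div_nonneg h2 h.le) (div_nonneg h3 h.le) (div_nonneg h1 h.le)
    (barycentric_sum a b c x h.ne') (barycentric a b c x h.ne')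

/-- The segments `ab` and `cd` cross properly: each of the two lines strictly separates the
endpoints of the other segment. -/
def Crosses (a b c d : Plane) : Prop :=
  orient a b c * orient a b d < 0 ∧ orient c d a * orient c d b < 0

theorem Crosses.symm {a b c d : Plane} (h : Crosses a b c d) : Crosses c d a b := ⟨h.2, h.1⟩

theorem Crosses.swap_left {a b c d : Plane} (h : Crosses a b c d) : Crosses b a c d := by
  refine ⟨?_, ?_⟩
  · rw [orient_swap_left a b, orient_swap_left a b, neg_mul_neg]; exact h.1
  · rw [mul_comm]; exact h.2

theorem Crosses.swap_right {a b c d : Plane} (h : Crosses a b c d) : Crosses a b d c :=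
  h.symm.swap_left.symm

theorem Crosses.ne {a b c d : Plane} (h : Crosses a b c d) :
    a ≠ c ∧ a ≠ d ∧ b ≠ c ∧ b ≠ d := by
  refine ⟨?_, ?_, ?_, ?_⟩ <;> rintro rfl <;> have := h.1 <;>
    simp [orient_left_self, orient_right_self] at this

/-- No segment crosses all three sides of a triangle. -/
theorem Crosses.not_three {a b c d e : Plane} (h1 : Crosses d e a b) (h2 : Crosses d e a c)
    (h3 : Crosses d e b c) : False := by
  have h1 := h1.1
  have h2 := h2.1
  have h3 := h3.1
  rcases mul_neg_iff.1 h1 with ⟨x, y⟩ | ⟨x, y⟩ <;> rcases mul_neg_iff.1 h2 with ⟨z, t⟩ | ⟨z, t⟩ <;>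
    rcases mul_neg_iff.1 h3 with ⟨u, v⟩ | ⟨u, v⟩ <;> linarith

theorem Crosses.openSegment_inter_nonempty {a b c d : Plane} (h : Crosses a b c d) :
    (openSegment ℝ a b ∩ openSegment ℝ c d).Nonempty := by
  -- the two directions are not parallel: their cross product is a difference of signed areas
  have e : orient c d b - orient c d a = -(orient a b d - orient a b c) := by unfold orient; ring
  have key : ∀ x y : ℝ, x * y < 0 → y - x ≠ 0 ∧ 0 < y / (y - x) ∧ 0 < -x / (y - x) := by
    intro x y hxy
    rcases mul_neg_iff.1 hxy with ⟨h1, h2⟩ | ⟨h1, h2⟩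
    · exact ⟨by linarith, div_pos_of_neg_of_neg h2 (by linarith),
        div_pos_of_neg_of_neg (by linarith) (by linarith)⟩
    · exact ⟨by linarith, div_pos h2 (by linarith), div_pos (by linarith) (by linarith)⟩
  obtain ⟨n1, p1, q1⟩ := key _ _ h.1
  obtain ⟨n2, p2, q2⟩ := key _ _ h.2
  refine ⟨(orient c d b / (orient c d b - orient c d a)) • a +
    (-orient c d a / (orient c d b - orient c d a)) • b,
    ⟨_, _, p2, q2, by field_simp; ring, rfl⟩,
    ⟨_, _, p1, q1, by field_simp; ring, ?_⟩⟩
  rw [e]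
  have n1' : -(orient a b d - orient a b c) ≠ 0 := neg_ne_zero.2 n1
  ext i
  fin_cases i <;>
  · simp only [Fin.zero_eta, Fin.mk_one, PiLp.add_apply, PiLp.smul_apply, smul_eq_mul]
    rw [div_neg, div_neg]
    field_simp
    unfold orient
    ring

/-- Segments with a common interior point cross properly or are collinear. -/
theorem orient_of_openSegment_inter {a b c d z : Plane} (h1 : z ∈ openSegment ℝ a b)
    (h2 : z ∈ openSegment ℝ c d) :
    orient a b c * orient a b d < 0 ∨ orient a b c = 0 ∧ orient a b d = 0 := by
  obtain ⟨s, t, -, -, hst, rfl⟩ := h1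
  obtain ⟨s', t', hs, ht, hst', h⟩ := h2
  have e : s' * orient a b c + t' * orient a b d = 0 := by
    rw [← orient_smul_add_smul _ _ _ _ hst', h, orient_smul_add_smul _ _ _ _ hst,
      orient_left_self, orient_right_self]
    ring
  rcases lt_trichotomy (orient a b c) 0 with h | h | h
  · left
    have : 0 < orient a b d := by
      by_contra! h'
      nlinarith
    exact mul_neg_of_neg_of_pos h this
  · right
    rw [h, mul_zero, zero_add] at e
    exact ⟨h, (mul_eq_zero.1 e).resolve_left ht.ne'⟩
  · left
    have : orient a b d < 0 := by
      by_contra! h'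
      nlinarith
    exact mul_neg_of_pos_of_neg h this

theorem Crosses.dist_le {a b c d : Plane} {r : ℝ} (h : Crosses a b c d) (hab : dist a b ≤ r)
    (hcd : dist c d ≤ r) : dist a c ≤ r ∨ dist b d ≤ r := by
  obtain ⟨z, h1, h2⟩ := h.openSegment_inter_nonempty
  have e1 := dist_add_dist_of_mem_segment (openSegment_subset_segment _ _ _ h1)
  have e2 := dist_add_dist_of_mem_segment (openSegment_subset_segment _ _ _ h2)
  by_contra! hcon
  have t1 := dist_triangle a z c
  have t2 := dist_triangle b z d
  rw [dist_comm c z] at e2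
  rw [dist_comm b z] at t2
  linarith [hcon.1, hcon.2]

/-- A segment that enters a triangle through the side `ab` and has no endpoint in the triangle
leaves it through one of the other sides. -/
theorem Crosses.exit {a b c d e : Plane} (h : Crosses a b d e)
    (hd : d ∉ convexHull ℝ {a, b, c}) (he : e ∉ convexHull ℝ {a, b, c})
    (hc : c ∉ openSegment ℝ d e) : Crosses d e a c ∨ Crosses d e b c := by
  obtain ⟨o, ho, s, t, hs, ht, hst, hse⟩ := h.openSegment_inter_nonempty
  have hde : d ≠ e := by
    rintro rfl
    have := h.2
    simp [orient_self] at this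
  have hoT : o ∈ convexHull ℝ {a, b, c} :=
    segment_subset_convexHull (by simp) (by simp) (openSegment_subset_segment _ _ _ ho)
  -- a point of the line `de` in the triangle lies strictly between `d` and `e`
  have key : ∀ z ∈ convexHull ℝ {a, b, c}, ∀ u : ℝ, z = (1 - u) • d + u • e → 0 < u ∧ u < 1 := by
    intro z hz u hu
    constructor
    · by_contra! hu0
      apply hd
      refine (convex_convexHull ℝ _).segment_subset hoT hz ⟨-u / (t - u), t / (t - u), ?_, ?_, ?_, ?_⟩
      · exact div_nonneg (by linarith) (by linarith)
      · exact div_nonneg (by linarith) (by linarith)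
      · have : t - u ≠ 0 := by linarith
        field_simp
        ring
      · have : t - u ≠ 0 := by linarith
        obtain rfl : s = 1 - t := by linarith
        rw [hu, ← hse]
        ext i
        simp only [PiLp.add_apply, PiLp.smul_apply, smul_eq_mul]
        field_simp
        ring
    · by_contra! hu1
      apply he
      refine (convex_convexHull ℝ _).segment_subset hoT hz
        ⟨(u - 1) / (u - t), (1 - t) / (u - t), ?_, ?_, ?_, ?_⟩
      · exact div_nonneg (by linarith) (by linarith)
      · exact div_nonneg (by linarith) (by linarith)
      · have : u - t ≠ 0 := by linarith
        field_simp
        ring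
      · have : u - t ≠ 0 := by linarith
        obtain rfl : s = 1 - t := by linarith
        rw [hu, ← hse]
        ext i
        simp only [PiLp.add_apply, PiLp.smul_apply, smul_eq_mul]
        field_simp
        ring
  have main : ∀ x ∈ ({a, b} : Set Plane), orient d e x * orient d e c < 0 → Crosses d e x c := by
    intro x hx hneg
    refine ⟨hneg, ?_⟩
    -- the point where the line `de` meets the segment `xc`
    set A := orient d e x
    set C := orient d e c
    have hAC : C - A ≠ 0 := by
      intro h0
      have : C = A := by linarith
      rw [this] at hneg
      nlinarith [mul_self_nonneg A]
    have hpos : 0 < C / (C - A) ∧ 0 < -A / (C - A) := by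
      rcases mul_neg_iff.1 hneg with ⟨h1, h2⟩ | ⟨h1, h2⟩
      · exact ⟨div_pos_of_neg_of_neg h2 (by linarith),
          div_pos_of_neg_of_neg (by linarith) (by linarith)⟩
      · exact ⟨div_pos h2 (by linarith), div_pos (by linarith) (by linarith)⟩
    have hsum : C / (C - A) + -A / (C - A) = 1 := by field_simp; ring
    have hz0 : orient d e ((C / (C - A)) • x + (-A / (C - A)) • c) = 0 := by
      rw [orient_smul_add_smul _ _ _ _ hsum]
      change C / (C - A) * A + -A / (C - A) * C = 0
      field_simp
      ring
    obtain ⟨u, hu⟩ := exists_eq_of_orient_eq_zero hde hz0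
    have hzo : (C / (C - A)) • x + (-A / (C - A)) • c ∈ openSegment ℝ x c :=
      ⟨_, _, hpos.1, hpos.2, hsum, rfl⟩
    have hxT : x ∈ ({a, b, c} : Set Plane) := by
      rcases hx with rfl | rfl <;> simp
    obtain ⟨hu0, hu1⟩ := key _ (segment_subset_convexHull hxT (by simp)
      (openSegment_subset_segment _ _ _ hzo)) u hu
    have hz2 : (C / (C - A)) • x + (-A / (C - A)) • c ∈ openSegment ℝ d e :=
      ⟨1 - u, u, by linarith, hu0, by ring, hu.symm⟩
    rcases orient_of_openSegment_inter hzo hz2 with h' | ⟨h', h''⟩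
    · exact h'
    · exfalso
      -- if both `d` and `e` were on the line `xc`, then `x` would be on the line `de`
      have hxc : x ≠ c := by
        rintro rfl
        exact absurd hneg (not_lt.2 (mul_self_nonneg _))
      obtain ⟨g, rfl⟩ := exists_eq_of_orient_eq_zero hxc h'
      obtain ⟨g', rfl⟩ := exists_eq_of_orient_eq_zero hxc h''
      have : A = 0 := by
        simp only [A, orient, PiLp.add_apply, PiLp.smul_apply, smul_eq_mul]
        ring
      rw [this, zero_mul] at hneg
      exact lt_irrefl _ hneg
  have hc0 : orient d e c ≠ 0 := by
    intro h0
    obtain ⟨u, hu⟩ := exists_eq_of_orient_eq_zero hde h0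
    obtain ⟨h1, h2⟩ := key c (subset_convexHull ℝ _ (by simp)) u hu
    exact hc ⟨1 - u, u, by linarith, h1, by ring, hu.symm⟩
  rcases mul_neg_iff.1 h.2 with ⟨x, y⟩ | ⟨x, y⟩ <;> rcases lt_or_gt_of_ne hc0 with z | z
  · exact Or.inl (main a (by simp) (mul_neg_of_pos_of_neg x z))
  · exact Or.inr (main b (by simp) (mul_neg_of_neg_of_pos y z))
  · exact Or.inr (main b (by simp) (mul_neg_of_pos_of_neg y z))
  · exact Or.inl (main a (by simp) (mul_neg_of_neg_of_pos x z))

/-- Two triangles on the same side of a common side `ab`, neither apex lying in the other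
triangle, have crossing sides. -/
theorem crosses_of_same_side {a b c d : Plane} (hc : 0 < orient a b c) (hd : 0 < orient a b d)
    (hcT : c ∉ convexHull ℝ {a, b, d}) (hdT : d ∉ convexHull ℝ {a, b, c}) :
    Crosses a c b d ∨ Crosses a d b c := by
  have h1 : orient b c d < 0 ∨ orient c a d < 0 := by
    by_contra! h
    exact hdT (mem_convexHull_of_orient_nonneg hc hd.le h.1 h.2)
  have h2 : orient b d c < 0 ∨ orient d a c < 0 := by
    by_contra! h
    exact hcT (mem_convexHull_of_orient_nonneg hd hc.le h.1 h.2)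
  have e1 : orient c a d = -orient a c d := orient_swap_left _ _ _
  have e2 : orient b d c = -orient b c d := orient_swap_right _ _ _
  have e3 : orient d a c = orient a c d := (orient_rotate d a c).symm
  have e4 : orient a c b = -orient a b c := orient_swap_right _ _ _
  have e5 : orient b d a = orient a b d := orient_rotate _ _ _
  have e6 : orient a d b = -orient a b d := orient_swap_right _ _ _
  have e7 : orient a d c = -orient a c d := orient_swap_right _ _ _
  have e8 : orient b c a = orient a b c := orient_rotate _ _ _
  rcases lt_trichotomy (orient b c d) 0 with h | h | h
  · right
    have h' : orient a c d < 0 := by rcases h2 with h2 | h2 <;> linarith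
    refine ⟨?_, ?_⟩
    · rw [e6, e7]; nlinarith
    · rw [e8]; nlinarith
  · exfalso
    rcases h1 with h1 | h1 <;> rcases h2 with h2 | h2 <;> linarith
  · left
    have h' : 0 < orient a c d := by rcases h1 with h1 | h1 <;> linarith
    refine ⟨?_, ?_⟩
    · rw [e4]; nlinarith
    · rw [e5, e2]; nlinarith

/-- A segment from an interior point of the triangle `abc` to a point outside, which avoids the
vertices, meets the relative interior of a side. -/
theorem exists_mem_side {a b c y e : Plane} (h : orient a b c ≠ 0) {s t u : ℝ}
    (hs : 0 < s) (ht : 0 < t) (hu : 0 < u) (hstu : s + t + u = 1)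
    (hy : s • a + t • b + u • c = y) (he : e ∉ convexHull ℝ {a, b, c})
    (ha : a ∉ openSegment ℝ y e) (hb : b ∉ openSegment ℝ y e) (hc : c ∉ openSegment ℝ y e) :
    ∃ z ∈ openSegment ℝ y e,
      z ∈ openSegment ℝ a b ∨ z ∈ openSegment ℝ b c ∨ z ∈ openSegment ℝ a c := by
  set A := orient b c e / orient a b c
  set B := orient c a e / orient a b c
  set C := orient a b e / orient a b c
  have hsum : A + B + C = 1 := barycentric_sum a b c e h
  have hee : A • a + B • b + C • c = e := barycentric a b c e h
  -- the least barycentric coordinate changes its sign along the segment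
  let f : ℝ → ℝ := fun τ => min ((1 - τ) * s + τ * A)
    (min ((1 - τ) * t + τ * B) ((1 - τ) * u + τ * C))
  have hf : ContinuousOn f (Set.Icc 0 1) := by fun_prop
  have hf1 : f 1 < 0 := by
    by_contra! h0
    simp only [f, sub_self, zero_mul, one_mul, zero_add, le_min_iff] at h0
    exact he (mem_convexHull_triple h0.1 h0.2.1 h0.2.2 hsum hee)
  have hf0 : 0 < f 0 := by simp [f, hs, ht, hu]
  obtain ⟨τ, ⟨h0, h1⟩, hτ⟩ := intermediate_value_Icc' zero_le_one hf ⟨hf1.le, hf0.le⟩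
  have h0' : 0 < τ := lt_of_le_of_ne h0 (by rintro rfl; exact hf0.ne' hτ)
  have h1' : τ < 1 := lt_of_le_of_ne h1 (by rintro rfl; exact hf1.ne hτ)
  set α := (1 - τ) * s + τ * A with hα
  set β := (1 - τ) * t + τ * B with hβ
  set γ := (1 - τ) * u + τ * C with hγ
  have hfτ : f τ = min α (min β γ) := rfl
  rw [hfτ] at hτ
  have hα0 : 0 ≤ α := hτ ▸ min_le_left _ _
  have hβ0 : 0 ≤ β := hτ ▸ (min_le_right _ _).trans (min_le_left _ _)
  have hγ0 : 0 ≤ γ := hτ ▸ (min_le_right _ _).trans (min_le_right _ _)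
  have hz : α • a + β • b + γ • c ∈ openSegment ℝ y e := by
    refine ⟨1 - τ, τ, by linarith, h0', by ring, ?_⟩
    rw [← hy, ← hee, hα, hβ, hγ]
    module
  have hs1 : α + β + γ = 1 := by
    rw [hα, hβ, hγ]
    linear_combination (1 - τ) * hstu + τ * hsum
  refine ⟨_, hz, ?_⟩
  have side : ∀ {Q R : ℝ} {x x' : Plane}, 0 ≤ Q → 0 ≤ R → Q + R = 1 →
      x ∉ openSegment ℝ y e → x' ∉ openSegment ℝ y e → Q • x + R • x' ∈ openSegment ℝ y e →
      Q • x + R • x' ∈ openSegment ℝ x x' := by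
    intro Q R x x' hQ hR hQR hx hx' hm
    refine ⟨Q, R, lt_of_le_of_ne hQ ?_, lt_of_le_of_ne hR ?_, hQR, rfl⟩
    · rintro rfl
      obtain rfl : R = 1 := by linarith
      exact hx' (by simpa using hm)
    · rintro rfl
      obtain rfl : Q = 1 := by linarith
      exact hx (by simpa using hm)
  have hzero : α = 0 ∨ β = 0 ∨ γ = 0 := by
    rcases min_choice α (min β γ) with hm | hm
    · left; rw [← hm]; exact hτ
    · rcases min_choice β γ with hm' | hm'
      · right; left; rw [← hm', ← hm]; exact hτ
      · right; right; rw [← hm', ← hm]; exact hτ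
  rcases hzero with h0 | h0 | h0
  · rw [h0, zero_smul, zero_add] at hz ⊢
    exact Or.inr (Or.inl (side hβ0 hγ0 (by linarith) hb hc hz))
  · rw [h0, zero_smul, add_zero] at hz ⊢
    exact Or.inr (Or.inr (side hα0 hγ0 (by linarith) ha hc hz))
  · rw [h0, zero_smul, add_zero] at hz ⊢
    exact Or.inl (side hα0 hβ0 (by linarith) ha hb hz)

/-! ### Closed planar Rips graphs without complete subgraphs on four vertices -/

/-- Adjacency at scale `r` of the points of the family `p`. -/
def RipsAdj {ι : Type*} (p : ι → Plane) (r : ℝ) (a b : ι) : Prop :=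
  a ≠ b ∧ dist (p a) (p b) ≤ r

/-- The hypotheses on the Rips complex of a family of points of the plane, in terms of its
`1`-skeleton: the points are distinct, no four of them are pairwise adjacent, and each edge lies in
at least two triangles. -/
structure IsClosedRips {ι : Type*} (p : ι → Plane) (r : ℝ) : Prop where
  injective : Function.Injective p
  not_four : ∀ {a b c d}, RipsAdj p r a b → RipsAdj p r a c → RipsAdj p r a d → RipsAdj p r b c →
    RipsAdj p r b d → RipsAdj p r c d → False
  two_triangles : ∀ {a b}, RipsAdj p r a b → ∃ c d, c ≠ d ∧ RipsAdj p r a c ∧ RipsAdj p r b c ∧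
    RipsAdj p r a d ∧ RipsAdj p r b d

section Rips

variable {ι : Type*} {p : ι → Plane} {r : ℝ}

theorem RipsAdj.symm {a b : ι} (h : RipsAdj p r a b) : RipsAdj p r b a :=
  ⟨h.1.symm, by rw [dist_comm]; exact h.2⟩

/-- Of the four sides of a quadrilateral with crossing diagonals `ab` and `cd`, at least one of
each pair of opposite sides is an edge. -/
theorem RipsAdj.sides {a b c d : ι} (hab : RipsAdj p r a b) (hcd : RipsAdj p r c d)
    (h : Crosses (p a) (p b) (p c) (p d)) :
    (RipsAdj p r a c ∨ RipsAdj p r b d) ∧ (RipsAdj p r a d ∨ RipsAdj p r b c) := by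
  obtain ⟨h1, h2, h3, h4⟩ := h.ne
  have e1 := h.dist_le hab.2 hcd.2
  have e2 := h.swap_right.dist_le hab.2 hcd.symm.2
  exact ⟨e1.imp (fun h => ⟨fun h' => h1 (by rw [h']), h⟩) (fun h => ⟨fun h' => h4 (by rw [h']), h⟩),
    e2.imp (fun h => ⟨fun h' => h2 (by rw [h']), h⟩) (fun h => ⟨fun h' => h3 (by rw [h']), h⟩)⟩

/-- A point in a triangle with sides at most `r` is within `r` of the three vertices. -/
theorem IsClosedRips.not_mem_triangle (h : IsClosedRips p r) {a b c x : ι} (hab : RipsAdj p r a b)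
    (hac : RipsAdj p r a c) (hbc : RipsAdj p r b c) (ha : x ≠ a) (hb : x ≠ b) (hc : x ≠ c) :
    p x ∉ convexHull ℝ {p a, p b, p c} := by
  intro hx
  have hr : 0 ≤ r := dist_nonneg.trans hab.2
  have key : ∀ q, dist (p a) q ≤ r → dist (p b) q ≤ r → dist (p c) q ≤ r → dist (p x) q ≤ r := by
    intro q h1 h2 h3
    refine convexHull_min (t := Metric.closedBall q r) ?_ (convex_closedBall q r) hx
    rintro y (rfl | rfl | rfl) <;> assumption
  have e1 := key (p a) (by simpa using hr) hab.symm.2 hac.symm.2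
  have e2 := key (p b) hab.2 (by simpa using hr) hbc.symm.2
  have e3 := key (p c) hac.2 hbc.2 (by simpa using hr)
  exact h.not_four hab hac (RipsAdj.symm ⟨ha, e1⟩) hbc (RipsAdj.symm ⟨hb, e2⟩)
    (RipsAdj.symm ⟨hc, e3⟩)

theorem IsClosedRips.not_mem_segment (h : IsClosedRips p r) {a b x : ι} (hab : RipsAdj p r a b)
    (ha : x ≠ a) (hb : x ≠ b) : p x ∉ segment ℝ (p a) (p b) := by
  obtain ⟨c, d, hcd, hac, hbc, had, hbd⟩ := h.two_triangles hab
  intro hx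
  have key : ∀ y, RipsAdj p r a y → RipsAdj p r b y → x ≠ y → False := fun y h1 h2 h3 =>
    h.not_mem_triangle hab h1 h2 ha hb h3 (segment_subset_convexHull (by simp) (by simp) hx)
  by_cases hxc : x = c
  · exact key d had hbd (by rw [hxc]; exact hcd)
  · exact key c hac hbc hxc

/-- No vertex lies in the relative interior of an edge. -/
theorem IsClosedRips.not_mem_openSegment (h : IsClosedRips p r) {a b : ι} (hab : RipsAdj p r a b)
    (x : ι) : p x ∉ openSegment ℝ (p a) (p b) := by
  intro hx
  have hne : p a ≠ p b := fun h' => hab.1 (h.injective h')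
  by_cases ha : x = a
  · subst ha
    exact hne (left_mem_openSegment_iff.1 hx)
  by_cases hb : x = b
  · subst hb
    exact hne (right_mem_openSegment_iff.1 hx)
  exact h.not_mem_segment hab ha hb (openSegment_subset_segment _ _ _ hx)

/-- On a parametrized line, the order of the parameters determines which point lies between. -/
theorem mem_segment_of_param {a b : Plane} {u v w : ℝ} (h1 : u ≤ v) (h2 : v ≤ w) :
    (1 - v) • a + v • b ∈ segment ℝ ((1 - u) • a + u • b) ((1 - w) • a + w • b) := by
  rcases (h1.trans h2).eq_or_lt with e | e
  · obtain rfl : u = v := le_antisymm h1 (by linarith)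
    exact left_mem_segment _ _ _
  · refine ⟨(w - v) / (w - u), (v - u) / (w - u), div_nonneg (by linarith) (by linarith),
      div_nonneg (by linarith) (by linarith), ?_, ?_⟩
    · have : w - u ≠ 0 := by linarith
      field_simp
      ring
    · have : w - u ≠ 0 := by linarith
      ext i
      simp only [PiLp.add_apply, PiLp.smul_apply, smul_eq_mul]
      field_simp
      ring

theorem IsClosedRips.orient_ne_zero (h : IsClosedRips p r) {a b c : ι} (hab : RipsAdj p r a b)
    (hac : RipsAdj p r a c) (hbc : RipsAdj p r b c) : orient (p a) (p b) (p c) ≠ 0 := by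
  intro h0
  obtain ⟨t, ht⟩ := exists_eq_of_orient_eq_zero (fun h' => hab.1 (h.injective h')) h0
  have e0 : p a = (1 - (0 : ℝ)) • p a + (0 : ℝ) • p b := by simp
  have e1 : p b = (1 - (1 : ℝ)) • p a + (1 : ℝ) • p b := by simp
  rcases le_total t 0 with h1 | h1
  · apply h.not_mem_segment hbc.symm hac.1 hab.1
    rw [ht]
    have := mem_segment_of_param (a := p a) (b := p b) h1 zero_le_one
    rwa [← e0, ← e1] at this
  rcases le_total t 1 with h2 | h2
  · apply h.not_mem_segment hab hac.1.symm hbc.1.symm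
    rw [ht]
    have := mem_segment_of_param (a := p a) (b := p b) h1 h2
    rwa [← e0, ← e1] at this
  · apply h.not_mem_segment hac hab.1.symm hbc.1
    rw [ht]
    have := mem_segment_of_param (a := p a) (b := p b) zero_le_one h2
    rwa [← e0, ← e1] at this

/-- Distinct edges with a common interior point cross properly. -/
theorem IsClosedRips.crosses (h : IsClosedRips p r) {a b c d : ι} (hab : RipsAdj p r a b)
    (hcd : RipsAdj p r c d) (hne : s(a, b) ≠ s(c, d))
    (hx : (openSegment ℝ (p a) (p b) ∩ openSegment ℝ (p c) (p d)).Nonempty) :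
    Crosses (p a) (p b) (p c) (p d) := by
  obtain ⟨z, hz1, hz2⟩ := hx
  have collinear : ∀ {a b c d : ι}, RipsAdj p r a b → RipsAdj p r c d → s(a, b) ≠ s(c, d) →
      z ∈ openSegment ℝ (p a) (p b) → z ∈ openSegment ℝ (p c) (p d) →
      ¬(orient (p a) (p b) (p c) = 0 ∧ orient (p a) (p b) (p d) = 0) := by
    rintro a b c d hab hcd hne ⟨s, τ, hs, hτ, hst, rfl⟩ ⟨s', t', hs', ht', hst', hz⟩ ⟨h1, h2⟩
    obtain rfl : s = 1 - τ := by linarith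
    obtain rfl : s' = 1 - t' := by linarith
    have hab' : p a ≠ p b := fun h' => hab.1 (h.injective h')
    have e0 : p a = (1 - (0 : ℝ)) • p a + (0 : ℝ) • p b := by simp
    have e1 : p b = (1 - (1 : ℝ)) • p a + (1 : ℝ) • p b := by simp
    obtain ⟨γ, hγ⟩ := exists_eq_of_orient_eq_zero hab' h1
    obtain ⟨δ, hδ⟩ := exists_eq_of_orient_eq_zero hab' h2
    -- the parameter of the common point along `ab`
    have hpar : τ = (1 - t') * γ + t' * δ := by
      have : (τ - ((1 - t') * γ + t' * δ)) • (p b - p a) = 0 := by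
        have h3 : (1 - τ) • p a + τ • p b - ((1 - t') • p c + t' • p d) = 0 := by rw [hz, sub_self]
        rw [hγ, hδ] at h3
        rw [← h3]
        module
      rcases smul_eq_zero.1 this with h4 | h4
      · linarith
      · exact absurd (sub_eq_zero.1 h4).symm hab'
    have hout : ∀ (x : ι) (g : ℝ), p x = (1 - g) • p a + g • p b → g ≤ 0 ∨ 1 ≤ g := by
      intro x g hg
      by_contra! hcon
      exact h.not_mem_openSegment hab x ⟨1 - g, g, by linarith, hcon.1, by ring, hg.symm⟩
    have hboth : ∀ {x y : ι} {gx gy : ℝ}, RipsAdj p r x y → s(a, b) ≠ s(x, y) →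
        p x = (1 - gx) • p a + gx • p b → p y = (1 - gy) • p a + gy • p b → gx ≤ 0 → 1 ≤ gy →
        False := by
      intro x y gx gy hxy hne' hgx hgy h5 h6
      have m1 := mem_segment_of_param (a := p a) (b := p b) h5 (zero_le_one.trans h6)
      have m2 := mem_segment_of_param (a := p a) (b := p b) (h5.trans zero_le_one) h6
      rw [← e0, ← hgx, ← hgy] at m1
      rw [← e1, ← hgx, ← hgy] at m2
      have n1 : a = x ∨ a = y := by
        by_contra! hcon
        exact h.not_mem_segment hxy hcon.1 hcon.2 m1
      have n2 : b = x ∨ b = y := by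
        by_contra! hcon
        exact h.not_mem_segment hxy hcon.1 hcon.2 m2
      apply hne'
      have := hab.1
      rcases n1 with rfl | rfl <;> rcases n2 with rfl | rfl
      · exact absurd rfl this
      · rfl
      · exact Sym2.eq_swap
      · exact absurd rfl this
    rcases hout c γ hγ with h3 | h3 <;> rcases hout d δ hδ with h4 | h4
    · nlinarith
    · exact hboth hcd hne hγ hδ h3 h4
    · exact hboth hcd.symm (by rw [Sym2.eq_swap (a := d)]; exact hne) hδ hγ h4 h3
    · nlinarith
  exact ⟨(orient_of_openSegment_inter hz1 hz2).resolve_right (collinear hab hcd hne hz1 hz2),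
    (orient_of_openSegment_inter hz2 hz1).resolve_right (collinear hcd hab hne.symm hz2 hz1)⟩

/-- An edge that crosses a side of a triangle and has no vertex in common with it crosses a second
side. -/
theorem IsClosedRips.exit (h : IsClosedRips p r) {a b c d e : ι} (hab : RipsAdj p r a b)
    (hac : RipsAdj p r a c) (hbc : RipsAdj p r b c) (hde : RipsAdj p r d e) (hdc : d ≠ c)
    (hec : e ≠ c) (hx : Crosses (p a) (p b) (p d) (p e)) :
    Crosses (p d) (p e) (p a) (p c) ∨ Crosses (p d) (p e) (p b) (p c) := by
  obtain ⟨h1, h2, h3, h4⟩ := hx.ne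
  exact hx.exit (h.not_mem_triangle hab hac hbc (fun e => h1 (by rw [e])) (fun e => h3 (by rw [e]))
    hdc) (h.not_mem_triangle hab hac hbc (fun e => h2 (by rw [e])) (fun e => h4 (by rw [e])) hec)
    (h.not_mem_openSegment hde c)

/-! ### Hexagrams -/

/-- The vertices `v 0, …, v 5` form a hexagram, in this cyclic order: each diagonal `v i v (i + 2)`
crosses the next one, and the edges between these vertices are those of an octahedron with
antipodal pairs `v i, v (i + 3)`. -/
structure IsHexagram (p : ι → Plane) (r : ℝ) (v : Fin 6 → ι) : Prop where
  injective : Function.Injective v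
  adj_one : ∀ i, RipsAdj p r (v i) (v (i + 1))
  adj_two : ∀ i, RipsAdj p r (v i) (v (i + 2))
  not_adj : ∀ i, ¬RipsAdj p r (v i) (v (i + 3))
  crosses : ∀ i, Crosses (p (v i)) (p (v (i + 2))) (p (v (i + 1))) (p (v (i + 3)))

theorem IsHexagram.rotate {v : Fin 6 → ι} (hv : IsHexagram p r v) (k : Fin 6) :
    IsHexagram p r (fun i => v (i + k)) where
  injective := fun i j hij => by simpa using hv.injective hij
  adj_one i := by have := hv.adj_one (i + k); rwa [show i + k + 1 = i + 1 + k by abel] at this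
  adj_two i := by have := hv.adj_two (i + k); rwa [show i + k + 2 = i + 2 + k by abel] at this
  not_adj i := by have := hv.not_adj (i + k); rwa [show i + k + 3 = i + 3 + k by abel] at this
  crosses i := by
    have := hv.crosses (i + k)
    rwa [show i + k + 1 = i + 1 + k by abel, show i + k + 2 = i + 2 + k by abel,
      show i + k + 3 = i + 3 + k by abel] at this

theorem IsHexagram.reflect {v : Fin 6 → ι} (hv : IsHexagram p r v) (k : Fin 6) :
    IsHexagram p r (fun i => v (k - i)) where
  injective := fun i j hij => by simpa using hv.injective hij
  adj_one i := by
    have := hv.adj_one (k - (i + 1))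
    rw [show k - (i + 1) + 1 = k - i by abel] at this
    exact this.symm
  adj_two i := by
    have := hv.adj_two (k - (i + 2))
    rw [show k - (i + 2) + 2 = k - i by abel] at this
    exact this.symm
  not_adj i := by
    have := hv.not_adj (k - (i + 3))
    rw [show k - (i + 3) + 3 = k - i by abel] at this
    exact fun h => this h.symm
  crosses i := by
    have := hv.crosses (k - (i + 3))
    rw [(by decide : ∀ k i : Fin 6, k - (i + 3) + 1 = k - (i + 2)),
      (by decide : ∀ k i : Fin 6, k - (i + 3) + 2 = k - (i + 1)),
      show k - (i + 3) + 3 = k - i by abel] at this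
    exact this.symm.swap_left.swap_right

/-- The crossings of a hexagram force its antipodal vertices to be far apart: the sides of the
crossing quadrilaterals would otherwise complete four pairwise adjacent vertices. -/
theorem IsClosedRips.not_adj_antipodal (h : IsClosedRips p r) {v : Fin 6 → ι}
    (h2 : ∀ i, RipsAdj p r (v i) (v (i + 2)))
    (hx : ∀ i, Crosses (p (v i)) (p (v (i + 2))) (p (v (i + 1))) (p (v (i + 3)))) :
    ¬RipsAdj p r (v 0) (v 3) := by
  intro h03
  have h02 : RipsAdj p r (v 0) (v 2) := h2 0
  have h13 : RipsAdj p r (v 1) (v 3) := h2 1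
  have h24 : RipsAdj p r (v 2) (v 4) := h2 2
  have h35 : RipsAdj p r (v 3) (v 5) := h2 3
  have h40 : RipsAdj p r (v 4) (v 0) := h2 4
  have h51 : RipsAdj p r (v 5) (v 1) := h2 5
  have s0 := h02.sides h13 (hx 0)
  have s1 := h13.sides h24 (hx 1)
  have s2 := h24.sides h35 (hx 2)
  have s3 := h35.sides h40 (hx 3)
  have s5 := h51.sides h02 (hx 5)
  by_cases h34 : RipsAdj p r (v 3) (v 4)
  · have h23 : ¬RipsAdj p r (v 2) (v 3) := fun h' => h.not_four h02 h40.symm h03 h24 h' h34.symm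
    have h14 := s1.2.resolve_right (fun h' => h23 h'.symm)
    have h45 := s2.1.resolve_left h23
    exact h.not_four h13 h51.symm h14 h35 h34 h45.symm
  · have h25 := s2.2.resolve_right (fun h' => h34 h'.symm)
    have h50 := s3.1.resolve_left h34
    have h01 : ¬RipsAdj p r (v 0) (v 1) := fun h' => h.not_four h' h03 h50.symm h13 h51.symm h35
    have h12 := s1.1.resolve_right h34
    have h23 := s0.1.resolve_left h01
    exact h.not_four h13 h51.symm h12 h35 h23.symm h25.symm

/-- The geometric part of the definition of a hexagram implies the combinatorial part. -/
theorem IsClosedRips.isHexagram (h : IsClosedRips p r) {v : Fin 6 → ι}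
    (hinj : Function.Injective v) (h2 : ∀ i, RipsAdj p r (v i) (v (i + 2)))
    (hx : ∀ i, Crosses (p (v i)) (p (v (i + 2))) (p (v (i + 1))) (p (v (i + 3)))) :
    IsHexagram p r v := by
  have hn : ∀ i, ¬RipsAdj p r (v i) (v (i + 3)) := by
    intro k
    have := h.not_adj_antipodal (v := fun i => v (i + k))
      (fun i => by have := h2 (i + k); rwa [show i + k + 2 = i + 2 + k by abel] at this)
      (fun i => by
        have := hx (i + k)
        rwa [show i + k + 1 = i + 1 + k by abel, show i + k + 2 = i + 2 + k by abel,
          show i + k + 3 = i + 3 + k by abel] at this)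
    rwa [zero_add, add_comm 3 k] at this
  refine ⟨hinj, fun i => ?_, h2, hn, hx⟩
  have := ((h2 (i - 1)).sides (by
    have := h2 (i - 1 + 1)
    rwa [(by decide : ∀ i : Fin 6, i - 1 + 1 + 2 = i - 1 + 3)] at this) (hx (i - 1))).2.resolve_left
      (hn _)
  rw [show i - 1 + 1 = i by abel, (by decide : ∀ i : Fin 6, i - 1 + 2 = i + 1)] at this
  exact this.symm

/-- Two vertex-disjoint triangles cannot cross in just four points, with `ab` and `ac` both
crossing `de` and `df`. -/
theorem IsClosedRips.not_four_crossings (h : IsClosedRips p r) {a b c d e f : ι}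
    (hab : RipsAdj p r a b) (hac : RipsAdj p r a c) (hbc : RipsAdj p r b c)
    (hde : RipsAdj p r d e) (hdf : RipsAdj p r d f) (hef : RipsAdj p r e f)
    (h1 : Crosses (p a) (p b) (p d) (p e)) (h2 : Crosses (p a) (p b) (p d) (p f))
    (h3 : Crosses (p a) (p c) (p d) (p e)) (h4 : Crosses (p a) (p c) (p d) (p f)) : False := by
  have s1 := hab.sides hde h1
  have s2 := hab.sides hdf h2
  have s3 := hac.sides hde h3
  have s4 := hac.sides hdf h4
  by_cases had : RipsAdj p r a d
  · by_cases hae : RipsAdj p r a e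
    · have haf : ¬RipsAdj p r a f := fun h' => h.not_four had hae h' hde hdf hef
      exact h.not_four hab hac had hbc (s2.2.resolve_left haf) (s4.2.resolve_left haf)
    · exact h.not_four hab hac had hbc (s1.2.resolve_left hae) (s3.2.resolve_left hae)
  · exact h.not_four hbc (s1.1.resolve_left had) (s2.1.resolve_left had) (s3.1.resolve_left had)
      (s4.1.resolve_left had) hef

/-- If the edge `de` cuts off the vertex `a` of a vertex-disjoint triangle `abc`, then `abc` and any
triangle `def` form a hexagram. -/
theorem IsClosedRips.isHexagram_of_cut (h : IsClosedRips p r) {a b c d e f : ι}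
    (hab : RipsAdj p r a b) (hac : RipsAdj p r a c) (hbc : RipsAdj p r b c)
    (hde : RipsAdj p r d e) (hdf : RipsAdj p r d f) (hef : RipsAdj p r e f)
    (haf : a ≠ f) (hbf : b ≠ f) (hcf : c ≠ f)
    (h1 : Crosses (p a) (p b) (p d) (p e)) (h2 : Crosses (p a) (p c) (p d) (p e)) :
    IsHexagram p r ![a, d, b, f, c, e] ∨ IsHexagram p r ![a, e, b, f, c, d] := by
  have nab := hab.1
  have nac := hac.1
  have nbc := hbc.1
  have nde := hde.1
  have ndf := hdf.1
  have nef := hef.1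
  have h' : ∀ {x y : ι}, p x ≠ p y → x ≠ y := fun hxy e => hxy (by rw [e])
  have had := h' h1.ne.1
  have hae := h' h1.ne.2.1
  have hbd := h' h1.ne.2.2.1
  have hbe := h' h1.ne.2.2.2
  have hcd := h' h2.ne.2.2.1
  have hce := h' h2.ne.2.2.2
  -- each of `df`, `ef` crosses only one of `ab`, `ac`, hence it crosses `bc`
  have third : ∀ {x : ι}, RipsAdj p r x f → x ≠ c → x ≠ b → Crosses (p a) (p b) (p x) (p f) →
      ¬Crosses (p a) (p c) (p x) (p f) → Crosses (p x) (p f) (p b) (p c) :=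
    fun hx hxc hxb hc1 hc2 => (h.exit hab hac hbc hx hxc hcf.symm hc1).resolve_left
      fun hh => hc2 hh.symm
  have third' : ∀ {x : ι}, RipsAdj p r x f → x ≠ c → x ≠ b → Crosses (p a) (p c) (p x) (p f) →
      ¬Crosses (p a) (p b) (p x) (p f) → Crosses (p x) (p f) (p c) (p b) :=
    fun hx hxc hxb hc1 hc2 => (h.exit hac hab hbc.symm hx hxb hbf.symm hc1).resolve_left
      fun hh => hc2 hh.symm
  have n1 : ∀ {x y}, Crosses (p x) (p y) (p d) (p f) → Crosses (p x) (p y) (p e) (p f) →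
      Crosses (p x) (p y) (p d) (p e) → False := fun c1 c2 c3 => Crosses.not_three c3 c1 c2
  rcases h.exit hde hdf hef hab haf hbf h1.symm with x | x <;>
    rcases h.exit hde hdf hef hac haf hcf h2.symm with y | y
  · exact (h.not_four_crossings hab hac hbc hde hdf hef h1 x h2 y).elim
  · left
    have z1 := third hdf hcd.symm hbd.symm x (fun hh => n1 hh y h2)
    have z2 := third' hef hce.symm hbe.symm y (fun hh => n1 x hh h1)
    refine h.isHexagram ?_ ?_ ?_
    · intro i j; fin_cases i <;> fin_cases j <;> simp [*, Ne.symm, eq_comm]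
    · intro i
      fin_cases i
      exacts [hab, hdf, hbc, hef.symm, hac.symm, hde.symm]
    · intro i
      fin_cases i
      exacts [x, z1, z2.symm.swap_left.swap_right, y.symm.swap_left.swap_right,
        h2.swap_left.swap_right, h1.symm.swap_left]
  · right
    have z1 := third hef hce.symm hbe.symm x (fun hh => n1 y hh h2)
    have z2 := third' hdf hcd.symm hbd.symm y (fun hh => n1 hh x h1)
    refine h.isHexagram ?_ ?_ ?_
    · intro i j; fin_cases i <;> fin_cases j <;> simp [*, Ne.symm, eq_comm]
    · intro i
      fin_cases i
      exacts [hab, hef, hbc, hdf.symm, hac.symm, hde]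
    · intro i
      fin_cases i
      exacts [x, z1, z2.symm.swap_left.swap_right, y.symm.swap_left.swap_right,
        h2.swap_left, h1.symm]
  · exact (h.not_four_crossings hab hac hbc hde.symm hef hdf h1.swap_right x h2.swap_right y).elim

/-- Vertex-disjoint triangles with crossing sides `ab` and `de` form a hexagram. -/
theorem IsClosedRips.exists_isHexagram_of_triangles (h : IsClosedRips p r) {a b c d e f : ι}
    (hab : RipsAdj p r a b) (hac : RipsAdj p r a c) (hbc : RipsAdj p r b c)
    (hde : RipsAdj p r d e) (hdf : RipsAdj p r d f) (hef : RipsAdj p r e f)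
    (haf : a ≠ f) (hbf : b ≠ f) (hcf : c ≠ f) (hcd : c ≠ d) (hce : c ≠ e)
    (hx : Crosses (p a) (p b) (p d) (p e)) :
    ∃ x x' y y', (x = a ∧ x' = b ∨ x = b ∧ x' = a) ∧ (y = d ∧ y' = e ∨ y = e ∧ y' = d) ∧
      IsHexagram p r ![x, y, x', y', c, f] := by
  have aux : ∀ {a₁ a₂ a₃ a₄ a₅ a₆ : ι}, IsHexagram p r ![a₁, a₂, a₃, a₄, a₅, a₆] →
      IsHexagram p r ![a₃, a₂, a₁, a₆, a₅, a₄] := by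
    intro a₁ a₂ a₃ a₄ a₅ a₆ hh
    convert hh.reflect 2 using 1
    ext i
    fin_cases i <;> rfl
  rcases h.exit hab hac hbc hde hcd.symm hce.symm hx with h1 | h1
  · rcases h.isHexagram_of_cut hab hac hbc hde hdf hef haf hbf hcf hx h1.symm with h2 | h2
    · exact ⟨b, a, d, e, by simp, by simp, aux h2⟩
    · exact ⟨b, a, e, d, by simp, by simp, aux h2⟩
  · rcases h.isHexagram_of_cut hab.symm hbc hac hde hdf hef hbf haf hcf hx.swap_left h1.symm
      with h2 | h2
    · exact ⟨a, b, d, e, by simp, by simp, aux h2⟩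
    · exact ⟨a, b, e, d, by simp, by simp, aux h2⟩

/-- The case of `IsClosedRips.exists_isHexagram` in which `a` is adjacent to the other three
endpoints. -/
theorem IsClosedRips.exists_isHexagram_aux (h : IsClosedRips p r) {a b c d : ι}
    (hab : RipsAdj p r a b) (hcd : RipsAdj p r c d) (hx : Crosses (p a) (p b) (p c) (p d))
    (hac : RipsAdj p r a c) (had : RipsAdj p r a d) :
    ∃ v, IsHexagram p r v ∧ (v 0 = a ∧ v 2 = b ∨ v 0 = b ∧ v 2 = a) ∧
      (v 1 = c ∧ v 3 = d ∨ v 1 = d ∧ v 3 = c) := by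
  -- a triangle on `cd` without the vertices `a` and `b`
  obtain ⟨y, hya, hcy, hdy⟩ : ∃ y, y ≠ a ∧ RipsAdj p r c y ∧ RipsAdj p r d y := by
    obtain ⟨y, z, hyz, h1, h2, h3, h4⟩ := h.two_triangles hcd
    by_cases hy : y = a
    · exact ⟨z, by rw [← hy]; exact hyz.symm, h3, h4⟩
    · exact ⟨y, hy, h1, h2⟩
  have hyb : y ≠ b := by
    rintro rfl
    exact h.not_four hab hac had hcy.symm hdy.symm hcd
  -- a triangle on `ab` without the vertices `c`, `d` and `y`
  obtain ⟨x, hxc, hxd, hax, hbx⟩ : ∃ x, x ≠ c ∧ x ≠ d ∧ RipsAdj p r a x ∧ RipsAdj p r b x := by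
    obtain ⟨x, z, hxz, h1, h2, h3, h4⟩ := h.two_triangles hab
    by_cases hb : RipsAdj p r b c
    · have hbd : ¬RipsAdj p r b d := fun hbd => h.not_four hab hac had hb hbd hcd
      by_cases hxc : x = c
      · exact ⟨z, by rw [← hxc]; exact hxz.symm, fun e => hbd (e ▸ h4), h3, h4⟩
      · exact ⟨x, hxc, fun e => hbd (e ▸ h2), h1, h2⟩
    · by_cases hxd : x = d
      · exact ⟨z, fun e => hb (e ▸ h4), by rw [← hxd]; exact hxz.symm, h3, h4⟩
      · exact ⟨x, fun e => hb (e ▸ h2), hxd, h1, h2⟩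
  have hxy : x ≠ y := by
    rintro rfl
    exact h.not_four hac had hax hcd hcy hdy
  obtain ⟨x₁, x₂, y₁, y₂, h1, h2, h3⟩ := h.exists_isHexagram_of_triangles hab hax hbx hcd hcy hdy
    hya.symm hyb.symm hxy hxc hxd hx
  exact ⟨_, h3, h1, h2⟩

/-- Any two crossing edges are diagonals of a hexagram. -/
theorem IsClosedRips.exists_isHexagram (h : IsClosedRips p r) {a b c d : ι}
    (hab : RipsAdj p r a b) (hcd : RipsAdj p r c d) (hx : Crosses (p a) (p b) (p c) (p d)) :
    ∃ v, IsHexagram p r v ∧ (v 0 = a ∧ v 2 = b ∨ v 0 = b ∧ v 2 = a) ∧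
      (v 1 = c ∧ v 3 = d ∨ v 1 = d ∧ v 3 = c) := by
  have hr : ∀ {v : Fin 6 → ι}, IsHexagram p r v → IsHexagram p r (fun i => v (3 - i)) :=
    fun hv => hv.reflect 3
  obtain ⟨h1 | h1, h2 | h2⟩ := hab.sides hcd hx
  · exact h.exists_isHexagram_aux hab hcd hx h1 h2
  · obtain ⟨v, hv, e1, e2⟩ := h.exists_isHexagram_aux hcd hab hx.symm h1.symm h2.symm
    exact ⟨_, hr hv, e2.symm.imp And.symm And.symm, e1.symm.imp And.symm And.symm⟩
  · obtain ⟨v, hv, e1, e2⟩ := h.exists_isHexagram_aux hcd.symm hab hx.symm.swap_left h2.symm h1.symm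
    exact ⟨_, hr hv, e2.symm.imp And.symm And.symm, e1.imp And.symm And.symm⟩
  · obtain ⟨v, hv, e1, e2⟩ := h.exists_isHexagram_aux hab.symm hcd hx.swap_left h2 h1
    exact ⟨v, hv, e1.symm, e2⟩

/-! ### Convexity of hexagrams -/

/-! The products of signed areas in the next lemmas are positive: all triples of vertices, taken in
their cyclic order, have the same orientation. -/

theorem IsHexagram.orient_mul_one {v : Fin 6 → ι} (hv : IsHexagram p r v) (i : Fin 6) :
    0 < orient (p (v i)) (p (v (i + 1))) (p (v (i + 2))) *
      orient (p (v i)) (p (v (i + 2))) (p (v (i + 3))) := by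
  have := (hv.crosses i).1
  rw [orient_swap_right] at this
  linarith

theorem IsHexagram.orient_mul_two {v : Fin 6 → ι} (hv : IsHexagram p r v) (i : Fin 6) :
    0 < orient (p (v i)) (p (v (i + 1))) (p (v (i + 3))) *
      orient (p (v (i + 1))) (p (v (i + 2))) (p (v (i + 3))) := by
  have := (hv.crosses i).2
  rw [orient_rotate, orient_swap_right (p (v (i + 1)))] at this
  linarith

theorem IsHexagram.orient_mul_succ {v : Fin 6 → ι} (hv : IsHexagram p r v) (i : Fin 6) :
    0 < orient (p (v i)) (p (v (i + 1))) (p (v (i + 2))) *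
      orient (p (v (i + 1))) (p (v (i + 2))) (p (v (i + 3))) := by
  have h1 := hv.orient_mul_one i
  have h2 := hv.orient_mul_two i
  have h3 := orient_add_orient (p (v i)) (p (v (i + 1))) (p (v (i + 2))) (p (v (i + 3)))
  rcases pos_and_pos_or_neg_and_neg_of_mul_pos h1 with ⟨a, b⟩ | ⟨a, b⟩ <;>
    rcases pos_and_pos_or_neg_and_neg_of_mul_pos h2 with ⟨c, d⟩ | ⟨c, d⟩
  · exact mul_pos a d
  · linarith
  · linarith
  · exact mul_pos_of_neg_of_neg a d

theorem IsHexagram.orient_mul_three {v : Fin 6 → ι} (hv : IsHexagram p r v) (i : Fin 6) :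
    0 < orient (p (v i)) (p (v (i + 1))) (p (v (i + 2))) *
      orient (p (v i)) (p (v (i + 2))) (p (v (i + 4))) := by
  obtain ⟨z, ⟨s, t, hs, ht, hst, hz⟩, ⟨s', t', hs', ht', hst', hz'⟩⟩ :=
    (hv.crosses (i + 2)).openSegment_inter_nonempty
  have h1 := hv.orient_mul_one i
  have h2 := hv.orient_mul_succ (i + 5)
  have h3 := hv.orient_mul_two (i + 5)
  simp only [add_assoc, (by decide : (5 : Fin 6) + 1 = 0), (by decide : (5 : Fin 6) + 2 = 1),
    (by decide : (5 : Fin 6) + 3 = 2), (by decide : (2 : Fin 6) + 2 = 4),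
    (by decide : (2 : Fin 6) + 1 = 3), (by decide : (2 : Fin 6) + 3 = 5), add_zero]
    at h2 h3 hz hz' ⊢
  have e1 := orient_smul_add_smul (p (v i)) (p (v (i + 2))) (p (v (i + 2))) (p (v (i + 4))) hst
  have e2 := orient_smul_add_smul (p (v i)) (p (v (i + 2))) (p (v (i + 3))) (p (v (i + 5))) hst'
  have e3 : orient (p (v i)) (p (v (i + 2))) (p (v (i + 5))) =
      orient (p (v (i + 5))) (p (v i)) (p (v (i + 2))) := orient_rotate _ _ _
  rw [hz, orient_right_self, mul_zero, zero_add] at e1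
  rw [hz', e1, e3] at e2
  rcases pos_and_pos_or_neg_and_neg_of_mul_pos h1 with ⟨a, b⟩ | ⟨a, b⟩
  · have c := (pos_iff_pos_of_mul_pos h3).2 a
    have : 0 < t * orient (p (v i)) (p (v (i + 2))) (p (v (i + 4))) := by
      rw [e2]; positivity
    exact mul_pos a ((pos_iff_pos_of_mul_pos this).1 ht)
  · have c := (neg_iff_neg_of_mul_pos h3).2 a
    have : t * orient (p (v i)) (p (v (i + 2))) (p (v (i + 4))) < 0 := by
      rw [e2]; nlinarith [mul_pos hs' (neg_pos.2 b), mul_pos ht' (neg_pos.2 c)]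
    exact mul_pos_of_neg_of_neg a (by
      by_contra! hcon
      exact absurd this (not_lt.2 (mul_nonneg ht.le hcon)))

/-- In a positively oriented hexagram, all vertices lie to the left of the sides of the hexagon,
and each even or odd triangle is positively oriented. -/
theorem IsHexagram.orient_pos {v : Fin 6 → ι} (hv : IsHexagram p r v)
    (h0 : 0 < orient (p (v 0)) (p (v 1)) (p (v 2))) (i : Fin 6) :
    0 < orient (p (v i)) (p (v (i + 1))) (p (v (i + 2))) ∧
    0 < orient (p (v i)) (p (v (i + 1))) (p (v (i + 3))) ∧
    0 < orient (p (v i)) (p (v (i + 1))) (p (v (i + 4))) ∧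
    0 < orient (p (v i)) (p (v (i + 1))) (p (v (i + 5))) ∧
    0 < orient (p (v i)) (p (v (i + 2))) (p (v (i + 4))) := by
  have step : ∀ i, 0 < orient (p (v i)) (p (v (i + 1))) (p (v (i + 2))) →
      0 < orient (p (v (i + 1))) (p (v (i + 1 + 1))) (p (v (i + 1 + 2))) := by
    intro i hi
    rw [add_assoc, add_assoc, (by decide : (1 : Fin 6) + 1 = 2), (by decide : (1 : Fin 6) + 2 = 3)]
    exact (pos_iff_pos_of_mul_pos (hv.orient_mul_succ i)).1 hi
  have hD : ∀ i, 0 < orient (p (v i)) (p (v (i + 1))) (p (v (i + 2))) := by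
    have d1 := step 0 h0
    have d2 := step 1 d1
    have d3 := step 2 d2
    have d4 := step 3 d3
    have d5 := step 4 d4
    intro i
    fin_cases i
    exacts [h0, d1, d2, d3, d4, d5]
  refine ⟨hD i, ?_, ?_, ?_, (pos_iff_pos_of_mul_pos (hv.orient_mul_three i)).1 (hD i)⟩
  · have := hD (i + 1)
    rw [add_assoc, add_assoc, (by decide : (1 : Fin 6) + 1 = 2), (by decide : (1 : Fin 6) + 2 = 3)]
      at this
    exact (pos_iff_pos_of_mul_pos (hv.orient_mul_two i)).2 this
  · have := (pos_iff_pos_of_mul_pos (hv.orient_mul_one (i + 4))).1 (hD (i + 4))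
    rw [add_assoc, add_assoc, (by decide : (4 : Fin 6) + 2 = 0), (by decide : (4 : Fin 6) + 3 = 1),
      add_zero] at this
    rwa [orient_rotate (p (v (i + 4)))]
  · have := hD (i + 5)
    rw [add_assoc, add_assoc, (by decide : (5 : Fin 6) + 1 = 0), (by decide : (5 : Fin 6) + 2 = 1),
      add_zero] at this
    rwa [orient_rotate (p (v (i + 5)))]

theorem IsHexagram.orient_ne_zero {v : Fin 6 → ι} (hv : IsHexagram p r v) :
    orient (p (v 0)) (p (v 1)) (p (v 2)) ≠ 0 := by
  intro h0
  have := hv.orient_mul_one 0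
  rw [zero_add, zero_add, h0, zero_mul] at this
  exact lt_irrefl _ this

theorem IsHexagram.orient_reflect (v : Fin 6 → ι) :
    orient (p (v (2 - 0))) (p (v (2 - 1))) (p (v (2 - 2))) =
      -orient (p (v 0)) (p (v 1)) (p (v 2)) := by
  change orient (p (v 2)) (p (v 1)) (p (v 0)) = _
  rw [← orient_swap_right, ← orient_rotate, ← orient_rotate]

/-! ### Edges at a hexagram -/

/-- A common neighbour of `v 0` and `v 2` other than `v 1` can take the place of `v 4`. -/
theorem IsClosedRips.replace (h : IsClosedRips p r) {v : Fin 6 → ι} (hv : IsHexagram p r v) {z : ι}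
    (h0 : RipsAdj p r (v 0) z) (h2 : RipsAdj p r (v 2) z) (hz : z ≠ v 1) :
    IsHexagram p r ![v 0, v 1, v 2, v 3, z, v 5] := by
  have hz3 : z ≠ v 3 := by rintro rfl; exact hv.not_adj 0 h0
  have hz5 : z ≠ v 5 := by rintro rfl; exact hv.not_adj 2 h2
  have ne : ∀ i j : Fin 6, i ≠ j → v i ≠ v j := fun i j hij e => hij (hv.injective e)
  obtain ⟨x, x', y, y', hx, hy, hh⟩ := h.exists_isHexagram_of_triangles (hv.adj_two 0) h0 h2
    (hv.adj_two 1) (hv.adj_two 5).symm (hv.adj_two 3) (ne 0 5 (by decide)) (ne 2 5 (by decide))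
    hz5 hz hz3 (hv.crosses 0)
  have hn : ¬RipsAdj p r x y' := hh.not_adj 0
  -- the only antipodal pair among `v 0, …, v 3` is `v 0, v 3`, which fixes the order
  rcases hx with ⟨rfl, rfl⟩ | ⟨rfl, rfl⟩ <;> rcases hy with ⟨rfl, rfl⟩ | ⟨rfl, rfl⟩
  · exact hh
  · exact absurd (hv.adj_one 0) hn
  · exact absurd (hv.adj_one 2) hn
  · exact absurd (hv.adj_one 1).symm hn

/-- If the side `v 0 v 1` were crossed, it would be a diagonal of a second hexagram `u`. The
triangles `v 0 v 1 v 2` and `v 0 v 1 v 5` on the same side of it can replace one another in `u`,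
and the vertices of `u` can replace `v 3` and `v 4`, which yields incompatible positions. -/
theorem IsClosedRips.not_crosses_side_zero (h : IsClosedRips p r) {v : Fin 6 → ι}
    (hv : IsHexagram p r v) {e f : ι} (hef : RipsAdj p r e f) :
    ¬Crosses (p (v 0)) (p (v 1)) (p e) (p f) := by
  intro hx
  -- a hexagram with the diagonal `v 0 v 1`
  obtain ⟨u, hu, hu0, hu2⟩ : ∃ u, IsHexagram p r u ∧ u 0 = v 0 ∧ u 2 = v 1 := by
    obtain ⟨u, hu, ⟨h1, h2⟩ | ⟨h1, h2⟩, -⟩ := h.exists_isHexagram (hv.adj_one 0) hef hx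
    · exact ⟨u, hu, h1, h2⟩
    · exact ⟨_, hu.reflect 2, h2, h1⟩
  have same : 0 < orient (p (v 0)) (p (v 1)) (p (v 2)) * orient (p (v 0)) (p (v 1)) (p (v 5)) := by
    have : 0 < orient (p (v 5)) (p (v 0)) (p (v 1)) * orient (p (v 0)) (p (v 1)) (p (v 2)) :=
      hv.orient_mul_succ 5
    rwa [mul_comm, ← orient_rotate (p (v 5))] at this
  have opp : ∀ z, IsHexagram p r ![u 0, u 1, u 2, u 3, z, u 5] →
      orient (p (v 0)) (p (v 1)) (p (u 1)) * orient (p (v 0)) (p (v 1)) (p z) < 0 := by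
    intro z hz
    have : 0 < orient (p (u 0)) (p (u 1)) (p (u 2)) * orient (p (u 0)) (p (u 2)) (p z) :=
      hz.orient_mul_three 0
    rw [← hu0, ← hu2, orient_swap_right]
    linarith
  have a2 : RipsAdj p r (u 0) (v 2) := hu0 ▸ hv.adj_two 0
  have b2 : RipsAdj p r (u 2) (v 2) := hu2 ▸ hv.adj_one 1
  have a5 : RipsAdj p r (u 0) (v 5) := hu0 ▸ (hv.adj_one 5).symm
  have b5 : RipsAdj p r (u 2) (v 5) := hu2 ▸ (hv.adj_two 5).symm
  have ne25 : v 2 ≠ v 5 := fun e => absurd (hv.injective e) (by decide)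
  by_cases h2 : v 2 = u 1
  · have := opp _ (h.replace hu a5 b5 (by rw [← h2]; exact ne25.symm))
    rw [← h2] at this
    linarith
  by_cases h5 : v 5 = u 1
  · have := opp _ (h.replace hu a2 b2 h2)
    rw [← h5] at this
    linarith
  have r2 := h.replace hu a2 b2 h2
  have r5 := h.replace hu a5 b5 h5
  have u5v2 : RipsAdj p r (v 2) (u 5) := r2.adj_one 4
  have u3v2 : RipsAdj p r (u 3) (v 2) := r2.adj_one 3
  have u3v5 : RipsAdj p r (u 3) (v 5) := r5.adj_one 3
  have u0u5 : RipsAdj p r (v 0) (u 5) := hu0 ▸ (hu.adj_one 5).symm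
  have u3u2 : RipsAdj p r (v 1) (u 3) := hu2 ▸ hu.adj_one 2
  -- replacing `v 4` by `u 5` and `v 3` by `u 3` gives a hexagram with the side `u 3 u 5`
  have w1 := h.replace hv u0u5 u5v2 (by
    rw [← hu2]; exact fun e => absurd (hu.injective e) (by decide))
  have w2 := h.replace (w1.rotate 5) (z := u 3) u3v5.symm u3u2 (by
    change u 3 ≠ v 0
    rw [← hu0]; exact fun e => absurd (hu.injective e) (by decide))
  have w3 : IsHexagram p r ![v 5, v 0, v 1, v 2, u 3, u 5] := w2
  have c1 : 0 < orient (p (v 0)) (p (v 1)) (p (v 2)) * orient (p (v 0)) (p (v 2)) (p (u 3)) :=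
    w3.orient_mul_one 1
  have c2 : 0 < orient (p (v 0)) (p (v 1)) (p (v 2)) * orient (p (v 0)) (p (v 2)) (p (u 5)) :=
    w3.orient_mul_three 1
  have c3 : Crosses (p (u 3)) (p (u 5)) (p (v 2)) (p (u 0)) := r2.crosses 3
  -- but `u 3 u 5` crosses the diagonal `v 0 v 2`
  have c4 := c3.2
  rw [hu0, orient_swap_left (p (v 0)) _ (p (u 3)), orient_swap_left (p (v 0)) _ (p (u 5)),
    neg_mul_neg] at c4
  nlinarith [mul_pos c1 c2, sq_nonneg (orient (p (v 0)) (p (v 1)) (p (v 2)))]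

/-- The sides of the hexagon of a hexagram are not crossed by any edge. -/
theorem IsClosedRips.not_crosses_side (h : IsClosedRips p r) {v : Fin 6 → ι}
    (hv : IsHexagram p r v) (i : Fin 6) {e f : ι} (hef : RipsAdj p r e f) :
    ¬Crosses (p (v i)) (p (v (i + 1))) (p e) (p f) := by
  have := h.not_crosses_side_zero (hv.rotate i) hef
  rwa [zero_add, add_comm 1 i] at this

/-- Two triangles on the same side of a common side `ab` belong to a hexagram with the side `ab` of
its hexagon. -/
theorem IsClosedRips.exists_isHexagram_of_same_side (h : IsClosedRips p r) {a b c d : ι}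
    (hab : RipsAdj p r a b) (hac : RipsAdj p r a c) (hbc : RipsAdj p r b c)
    (had : RipsAdj p r a d) (hbd : RipsAdj p r b d) (hcd : c ≠ d)
    (hs : 0 < orient (p a) (p b) (p c) * orient (p a) (p b) (p d)) :
    ∃ v, IsHexagram p r v ∧ v 1 = a ∧ v 2 = b ∧ (v 0 = c ∧ v 3 = d ∨ v 0 = d ∧ v 3 = c) := by
  have hn : ¬RipsAdj p r c d := fun hcd => h.not_four hab hac had hbc hbd hcd
  have main : ∀ {c d : ι}, RipsAdj p r a c → RipsAdj p r b d → ¬RipsAdj p r c d →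
      RipsAdj p r a d → RipsAdj p r b c →
      Crosses (p a) (p c) (p b) (p d) → ∃ v, IsHexagram p r v ∧ v 1 = a ∧ v 2 = b ∧
        (v 0 = c ∧ v 3 = d ∨ v 0 = d ∧ v 3 = c) := by
    intro c d hac hbd hn had hbc hx
    obtain ⟨v, hv, ⟨h1, h2⟩ | ⟨h1, h2⟩, ⟨h3, h4⟩ | ⟨h3, h4⟩⟩ := h.exists_isHexagram hac hbd hx
    · exact absurd (h2 ▸ h4 ▸ hv.adj_one 2) hn
    · exact absurd (h2 ▸ h3 ▸ (hv.adj_one 1).symm) hn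
    · exact ⟨_, hv.reflect 3, h2, h3, Or.inr ⟨h4, h1⟩⟩
    · exact absurd (h1 ▸ h3 ▸ hv.adj_one 0) hn
  have hT1 := h.not_mem_triangle hab had hbd hac.1.symm hbc.1.symm hcd
  have hT2 := h.not_mem_triangle hab hac hbc had.1.symm hbd.1.symm hcd.symm
  have hx : Crosses (p a) (p c) (p b) (p d) ∨ Crosses (p a) (p d) (p b) (p c) := by
    rcases pos_and_pos_or_neg_and_neg_of_mul_pos hs with ⟨h1, h2⟩ | ⟨h1, h2⟩
    · exact crosses_of_same_side h1 h2 hT1 hT2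
    · rw [Set.insert_comm] at hT1 hT2
      have := crosses_of_same_side (a := p b) (b := p a) (by rw [orient_swap_left]; linarith)
        (by rw [orient_swap_left]; linarith) hT1 hT2
      exact this.symm.imp Crosses.symm Crosses.symm
  rcases hx with hx | hx
  · exact main hac hbd hn had hbc hx
  · obtain ⟨v, hv, h1, h2, h3⟩ := main had hbc (fun e => hn e.symm) hac hbd hx
    exact ⟨v, hv, h1, h2, h3.symm⟩

/-- A diagonal of a hexagram lies in only two triangles, both with vertices in the hexagram. -/
theorem IsClosedRips.eq_of_adj_diagonal (h : IsClosedRips p r) {v : Fin 6 → ι}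
    (hv : IsHexagram p r v) {i : Fin 6} {z : ι} (h0 : RipsAdj p r (v i) z)
    (h2 : RipsAdj p r (v (i + 2)) z) : z = v (i + 1) ∨ z = v (i + 4) := by
  by_contra! hcon
  obtain ⟨h1, h4⟩ := hcon
  have hv' := hv.rotate i
  have hr := h.replace hv' (z := z) (by simpa using h0) (by simpa [add_comm] using h2)
    (by simpa [add_comm] using h1)
  have e1 := hv'.orient_mul_three 0
  have e2 : 0 < orient (p (v (0 + i))) (p (v (1 + i))) (p (v (2 + i))) *
    orient (p (v (0 + i))) (p (v (2 + i))) (p z) := hr.orient_mul_three 0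
  simp only [zero_add] at e1 e2
  rw [add_comm 1 i, add_comm 2 i] at e1 e2
  rw [add_comm 4 i] at e1
  have hs : 0 < orient (p (v i)) (p (v (i + 2))) (p z) *
      orient (p (v i)) (p (v (i + 2))) (p (v (i + 4))) := by
    rcases pos_and_pos_or_neg_and_neg_of_mul_pos e1 with ⟨a, b⟩ | ⟨a, b⟩ <;>
      rcases pos_and_pos_or_neg_and_neg_of_mul_pos e2 with ⟨c, d⟩ | ⟨c, d⟩
    · exact mul_pos d b
    · linarith
    · linarith
    · exact mul_pos_of_neg_of_neg d b
  have ai4 : RipsAdj p r (v i) (v (i + 4)) := by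
    have := (hv.adj_two (i + 4)).symm
    rwa [add_assoc, (by decide : (4 : Fin 6) + 2 = 0), add_zero] at this
  have a24 : RipsAdj p r (v (i + 2)) (v (i + 4)) := by
    have := hv.adj_two (i + 2)
    rwa [add_assoc, (by decide : (2 : Fin 6) + 2 = 4)] at this
  obtain ⟨w, hw, h3, h4, -⟩ := h.exists_isHexagram_of_same_side (hv.adj_two i) h0 h2 ai4 a24 h4 hs
  have := h.not_crosses_side hw 1 (e := v (i + 1)) (f := v (i + 3)) (by
    have := hv.adj_two (i + 1)
    rwa [add_assoc, (by decide : (1 : Fin 6) + 2 = 3)] at this)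
  rw [h3, show (1 : Fin 6) + 1 = 2 from rfl, h4] at this
  exact this (hv.crosses i)

/-- The pair `a`, `b` is an edge that is crossed by another edge. -/
def IsCrossedEdge (p : ι → Plane) (r : ℝ) (a b : ι) : Prop :=
  RipsAdj p r a b ∧ ∃ c d, RipsAdj p r c d ∧ Crosses (p a) (p b) (p c) (p d)

theorem IsCrossedEdge.symm {a b : ι} (hab : IsCrossedEdge p r a b) : IsCrossedEdge p r b a := by
  obtain ⟨h1, c, d, h2, h3⟩ := hab
  exact ⟨h1.symm, c, d, h2, h3.swap_left⟩

theorem IsHexagram.isCrossedEdge {v : Fin 6 → ι} (hv : IsHexagram p r v) (i : Fin 6) :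
    IsCrossedEdge p r (v i) (v (i + 2)) := by
  refine ⟨hv.adj_two i, v (i + 1), v (i + 3), ?_, hv.crosses i⟩
  have := hv.adj_two (i + 1)
  rwa [add_assoc, (by decide : (1 : Fin 6) + 2 = 3)] at this

/-- The crossed edges between vertices of a hexagram are its diagonals. -/
theorem IsClosedRips.eq_add_two_or (h : IsClosedRips p r) {v : Fin 6 → ι} (hv : IsHexagram p r v)
    {i j : Fin 6} (hij : IsCrossedEdge p r (v i) (v j)) : j = i + 2 ∨ i = j + 2 := by
  obtain ⟨h1, c, d, h2, h3⟩ := hij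
  have cases6 : ∀ i j : Fin 6, i = j ∨ j = i + 1 ∨ i = j + 1 ∨ j = i + 3 ∨ j = i + 2 ∨ i = j + 2 := by
    decide
  rcases cases6 i j with e | e | e | e | e
  · exact absurd (by rw [e]) h1.1
  · subst e
    exact absurd h3 (h.not_crosses_side hv i h2)
  · subst e
    exact absurd h3.swap_left (h.not_crosses_side hv j h2)
  · subst e
    exact absurd h1 (hv.not_adj i)
  · exact e

theorem IsClosedRips.mem_range_of_isCrossedEdge (h : IsClosedRips p r) {v : Fin 6 → ι}
    (hv : IsHexagram p r v) {a b z : ι} (ha : a ∈ Set.range v) (hb : b ∈ Set.range v)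
    (hab : IsCrossedEdge p r a b) (haz : RipsAdj p r a z) (hbz : RipsAdj p r b z) :
    z ∈ Set.range v := by
  obtain ⟨i, rfl⟩ := ha
  obtain ⟨j, rfl⟩ := hb
  rcases h.eq_add_two_or hv hab with rfl | rfl
  · rcases h.eq_of_adj_diagonal hv haz hbz with rfl | rfl <;> exact ⟨_, rfl⟩
  · rcases h.eq_of_adj_diagonal hv hbz haz with rfl | rfl <;> exact ⟨_, rfl⟩

/-- Starting from the diagonal `v 0 v 2`, the other vertices are common neighbours of endpoints of
diagonals. -/
theorem IsClosedRips.range_subset (h : IsClosedRips p r) {v w : Fin 6 → ι}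
    (hv : IsHexagram p r v) (hw : IsHexagram p r w) (h0 : v 0 ∈ Set.range w)
    (h2 : v 2 ∈ Set.range w) : Set.range v ⊆ Set.range w := by
  have a01 : RipsAdj p r (v 0) (v 1) := hv.adj_one 0
  have a12 : RipsAdj p r (v 1) (v 2) := hv.adj_one 1
  have a23 : RipsAdj p r (v 2) (v 3) := hv.adj_one 2
  have a34 : RipsAdj p r (v 3) (v 4) := hv.adj_one 3
  have a45 : RipsAdj p r (v 4) (v 5) := hv.adj_one 4
  have a50 : RipsAdj p r (v 5) (v 0) := hv.adj_one 5
  have a24 : RipsAdj p r (v 2) (v 4) := hv.adj_two 2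
  have a40 : RipsAdj p r (v 4) (v 0) := hv.adj_two 4
  have h1 := h.mem_range_of_isCrossedEdge hw h0 h2 (hv.isCrossedEdge 0) a01 a12.symm
  have h4 := h.mem_range_of_isCrossedEdge hw h0 h2 (hv.isCrossedEdge 0) a40.symm a24
  have h3 := h.mem_range_of_isCrossedEdge hw h2 h4 (hv.isCrossedEdge 2) a23 a34.symm
  have h5 := h.mem_range_of_isCrossedEdge hw h4 h0 (hv.isCrossedEdge 4) a45 a50.symm
  rintro _ ⟨i, rfl⟩
  fin_cases i <;> assumption

/-- Hexagrams with a common diagonal have the same vertices. -/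
theorem IsClosedRips.range_eq (h : IsClosedRips p r) {v w : Fin 6 → ι}
    (hv : IsHexagram p r v) (hw : IsHexagram p r w) {a b : ι} (hab : IsCrossedEdge p r a b)
    (hav : a ∈ Set.range v) (hbv : b ∈ Set.range v) (haw : a ∈ Set.range w)
    (hbw : b ∈ Set.range w) : Set.range v = Set.range w := by
  have main : ∀ {v w : Fin 6 → ι}, IsHexagram p r v → IsHexagram p r w → a ∈ Set.range v →
      b ∈ Set.range v → a ∈ Set.range w → b ∈ Set.range w → Set.range v ⊆ Set.range w := by
    rintro v w hv hw ⟨i, hi⟩ ⟨j, hj⟩ haw hbw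
    have : ∀ k, v k ∈ Set.range w → v (k + 2) ∈ Set.range w → Set.range v ⊆ Set.range w := by
      intro k h0 h2
      have := h.range_subset (hv.rotate k) hw (by simpa using h0) (by simpa [add_comm] using h2)
      rintro _ ⟨i, rfl⟩
      exact this ⟨i - k, by simp⟩
    rw [← hi, ← hj] at hab
    rcases h.eq_add_two_or hv hab with rfl | rfl
    · exact this i (hi ▸ haw) (hj ▸ hbw)
    · exact this j (hj ▸ hbw) (hi ▸ haw)
  exact (main hv hw hav hbv haw hbw).antisymm (main hw hv haw hbw hav hbv)

/-! ### Existence of a fold -/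

/-- In a nonempty finite family `T` of triangles each of whose sides lies in two triangles of `T`,
some two triangles lie on the same side of a common side: such a side is obtained by joining a
vertex `a` farthest from the origin to a neighbour of extreme direction as seen from `a`. -/
theorem exists_same_side [Finite ι] (hp : Function.Injective p) (T : ι → ι → ι → Prop)
    (h1 : ∀ {a b c}, T a b c → T b a c) (h2 : ∀ {a b c}, T a b c → T a c b)
    (h0 : ∀ {a b c}, T a b c → orient (p a) (p b) (p c) ≠ 0)
    (hne : ∃ a b c, T a b c) (htwo : ∀ {a b c}, T a b c → ∃ d, d ≠ c ∧ T a b d) :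
    ∃ a b c d, c ≠ d ∧ T a b c ∧ T a b d ∧
      0 < orient (p a) (p b) (p c) * orient (p a) (p b) (p d) := by
  obtain ⟨a, ⟨b₀, c₀, hT₀⟩, hmax⟩ := Set.exists_max_image {a | ∃ b c, T a b c}
    (fun a => p a 0 ^ 2 + p a 1 ^ 2) (Set.toFinite _) hne
  -- all other vertices of `T` are in the open half-plane bounded by the normal line at `a`
  have hpos : ∀ x, (∃ b c, T x b c) → x ≠ a →
      0 < p a 0 * (p a 0 - p x 0) + p a 1 * (p a 1 - p x 1) := by
    intro x hx hxa
    have hm : p x 0 ^ 2 + p x 1 ^ 2 ≤ p a 0 ^ 2 + p a 1 ^ 2 := hmax x hx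
    have hd : 0 < (p a 0 - p x 0) ^ 2 + (p a 1 - p x 1) ^ 2 := by
      by_contra! hcon
      have e0 : p a 0 - p x 0 = 0 := by
        nlinarith [sq_nonneg (p a 0 - p x 0), sq_nonneg (p a 1 - p x 1)]
      have e1 : p a 1 - p x 1 = 0 := by
        nlinarith [sq_nonneg (p a 0 - p x 0), sq_nonneg (p a 1 - p x 1)]
      apply hxa
      apply hp
      ext i
      fin_cases i
      · simp only [Fin.zero_eta]; linarith
      · simp only [Fin.mk_one]; linarith
    nlinarith
  have ne : ∀ {a b c}, T a b c → b ≠ a := by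
    rintro a b c hT rfl
    exact h0 hT (orient_self _ _)
  obtain ⟨b, ⟨c, hT⟩, hmin⟩ := Set.exists_min_image {b | ∃ c, T a b c}
    (fun x => (p a 0 * (p x 1 - p a 1) - p a 1 * (p x 0 - p a 0)) /
      (p a 0 * (p a 0 - p x 0) + p a 1 * (p a 1 - p x 1))) (Set.toFinite _) ⟨b₀, c₀, hT₀⟩
  have neg : ∀ {x}, T a b x → orient (p a) (p b) (p x) < 0 := by
    intro x hx
    have hb := hpos b ⟨a, x, h1 hx⟩ (ne hx)
    have hx' := hpos x ⟨a, b, h1 (h2 hx)⟩ (ne (h2 hx))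
    have hm := hmin x ⟨b, h2 hx⟩
    simp only at hm
    rw [div_le_div_iff₀ hb hx'] at hm
    have e : (p a 0 ^ 2 + p a 1 ^ 2) * orient (p a) (p b) (p x) =
        (p a 0 * (p b 1 - p a 1) - p a 1 * (p b 0 - p a 0)) *
          (p a 0 * (p a 0 - p x 0) + p a 1 * (p a 1 - p x 1)) -
        (p a 0 * (p x 1 - p a 1) - p a 1 * (p x 0 - p a 0)) *
          (p a 0 * (p a 0 - p b 0) + p a 1 * (p a 1 - p b 1)) := by
      unfold orient
      ring
    refine lt_of_le_of_ne ?_ (h0 hx)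
    by_contra! hcon
    have hn : 0 < p a 0 ^ 2 + p a 1 ^ 2 := by
      by_contra! hn
      have e0 : p a 0 = 0 := by nlinarith [sq_nonneg (p a 0), sq_nonneg (p a 1)]
      have e1 : p a 1 = 0 := by nlinarith [sq_nonneg (p a 0), sq_nonneg (p a 1)]
      rw [e0, e1] at hb
      simp at hb
    have := mul_pos hn hcon
    linarith
  obtain ⟨d, hd, hTd⟩ := htwo hT
  exact ⟨a, b, c, d, hd.symm, hT, hTd, mul_pos_of_neg_of_neg (neg hT) (neg hTd)⟩

theorem IsClosedRips.exists_isHexagram_of_adj [Finite ι] (h : IsClosedRips p r) {a b : ι}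
    (hab : RipsAdj p r a b) : ∃ v, IsHexagram p r v := by
  obtain ⟨a, b, c, d, hcd, h1, h2, h3⟩ := exists_same_side h.injective
    (fun a b c => RipsAdj p r a b ∧ RipsAdj p r a c ∧ RipsAdj p r b c)
    (fun h => ⟨h.1.symm, h.2.2, h.2.1⟩) (fun h => ⟨h.2.1, h.1, h.2.2.symm⟩)
    (fun hT => h.orient_ne_zero hT.1 hT.2.1 hT.2.2)
    (by
      obtain ⟨c, -, -, h1, h2, -⟩ := h.two_triangles hab
      exact ⟨a, b, c, hab, h1, h2⟩)
    (by
      rintro a b c ⟨hab, -⟩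
      obtain ⟨d, e, hde, h1, h2, h3, h4⟩ := h.two_triangles hab
      by_cases hd : d = c
      · exact ⟨e, by rw [← hd]; exact hde.symm, hab, h3, h4⟩
      · exact ⟨d, hd, hab, h1, h2⟩)
  obtain ⟨v, hv, -⟩ := h.exists_isHexagram_of_same_side h1.1 h1.2.1 h1.2.2 h2.2.1 h2.2.2 hcd h3
  exact ⟨v, hv⟩

/-! ### Overlapping simplices -/

theorem IsClosedRips.crosses_of_edge_triangle (h : IsClosedRips p r) {a b c d e : ι} {y : Plane}
    (hde : RipsAdj p r d e) (hy : y ∈ openSegment ℝ (p d) (p e))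
    (hab : RipsAdj p r a b) (hac : RipsAdj p r a c) (hbc : RipsAdj p r b c)
    {s t u : ℝ} (hs : 0 < s) (ht : 0 < t) (hu : 0 < u) (hstu : s + t + u = 1)
    (hy' : s • p a + t • p b + u • p c = y)
    (hda : d ≠ a) (hdb : d ≠ b) (hdc : d ≠ c) (hea : e ≠ a) (heb : e ≠ b) (hec : e ≠ c) :
    Crosses (p d) (p e) (p a) (p b) ∨ Crosses (p d) (p e) (p b) (p c) ∨
      Crosses (p d) (p e) (p a) (p c) := by
  have hsub : openSegment ℝ y (p e) ⊆ openSegment ℝ (p d) (p e) := by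
    rintro _ ⟨α, β, hα, hβ, hαβ, rfl⟩
    obtain ⟨γ, δ, hγ, hδ, hγδ, rfl⟩ := hy
    refine ⟨α * γ, α * δ + β, by positivity, by positivity, ?_, by module⟩
    linear_combination α * hγδ + hαβ
  obtain ⟨z, hz, hz'⟩ := exists_mem_side (h.orient_ne_zero hab hac hbc) hs ht hu hstu hy'
    (h.not_mem_triangle hab hac hbc hea heb hec) (fun hh => h.not_mem_openSegment hde a (hsub hh))
    (fun hh => h.not_mem_openSegment hde b (hsub hh))
    (fun hh => h.not_mem_openSegment hde c (hsub hh))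
  have ne : ∀ {x x' : ι}, d ≠ x → d ≠ x' → s(d, e) ≠ s(x, x') := by
    intro x x' h1 h2 h3
    rcases Sym2.eq_iff.1 h3 with ⟨h4, -⟩ | ⟨h4, -⟩
    exacts [h1 h4, h2 h4]
  exact hz'.imp (fun hh => h.crosses hde hab (ne hda hdb) ⟨z, hsub hz, hh⟩) (Or.imp
    (fun hh => h.crosses hde hbc (ne hdb hdc) ⟨z, hsub hz, hh⟩)
    (fun hh => h.crosses hde hac (ne hda hdc) ⟨z, hsub hz, hh⟩))

/-- A weight with pairwise adjacent support: the barycentric coordinates of a point of the Rips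
complex, when no four vertices are pairwise adjacent. -/
structure IsRipsWeight [Fintype ι] (p : ι → Plane) (r : ℝ) (w : ι → ℝ) : Prop where
  nonneg : ∀ i, 0 ≤ w i
  sum_eq_one : ∑ i, w i = 1
  adj : ∀ {a b}, a ≠ b → w a ≠ 0 → w b ≠ 0 → RipsAdj p r a b

theorem IsRipsWeight.cases [Fintype ι] (h : IsClosedRips p r) {w : ι → ℝ}
    (hw : IsRipsWeight p r w) :
    (∃ a, w a ≠ 0 ∧ ∑ i, w i • p i = p a) ∨
    (∃ a b, w a ≠ 0 ∧ w b ≠ 0 ∧ RipsAdj p r a b ∧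
      ∑ i, w i • p i ∈ openSegment ℝ (p a) (p b)) ∨
    (∃ a b c, w a ≠ 0 ∧ w b ≠ 0 ∧ w c ≠ 0 ∧ RipsAdj p r a b ∧ RipsAdj p r a c ∧ RipsAdj p r b c ∧
      w a + w b + w c = 1 ∧ w a • p a + w b • p b + w c • p c = ∑ i, w i • p i) := by
  classical
  set s := Finset.univ.filter fun i => w i ≠ 0 with hs
  have mem : ∀ {i}, i ∈ s → w i ≠ 0 := fun hi => (Finset.mem_filter.1 hi).2
  have hsum : ∑ i ∈ s, w i = 1 := by
    rw [← hw.sum_eq_one, hs, Finset.sum_filter_ne_zero]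
  have hsum' : ∑ i ∈ s, w i • p i = ∑ i, w i • p i := by
    refine Finset.sum_subset (Finset.subset_univ _) fun i _ hi => ?_
    have : w i = 0 := by simpa [hs] using hi
    rw [this, zero_smul]
  have hpos : ∀ {i}, w i ≠ 0 → 0 < w i := fun hi => lt_of_le_of_ne (hw.nonneg _) hi.symm
  have hcard : s.card ≤ 3 := by
    by_contra! hcon
    obtain ⟨t, hts, ht⟩ := Finset.exists_subset_card_eq (Nat.succ_le_of_lt hcon)
    obtain ⟨a, u, hau, rfl, hu⟩ := Finset.card_eq_succ.1 ht
    obtain ⟨b, c, d, hbc, hbd, hcd, rfl⟩ := Finset.card_eq_three.1 hu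
    simp only [Finset.mem_insert, Finset.mem_singleton, not_or] at hau
    have ma := mem (hts (Finset.mem_insert_self _ _))
    have mb := mem (hts (x := b) (by simp))
    have mc := mem (hts (x := c) (by simp))
    have md := mem (hts (x := d) (by simp))
    exact h.not_four (hw.adj hau.1 ma mb) (hw.adj hau.2.1 ma mc) (hw.adj hau.2.2 ma md)
      (hw.adj hbc mb mc) (hw.adj hbd mb md) (hw.adj hcd mc md)
  interval_cases hc : s.card
  · rw [Finset.card_eq_zero.1 hc] at hsum
    simp at hsum
  · obtain ⟨a, ha⟩ := Finset.card_eq_one.1 hc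
    rw [ha, Finset.sum_singleton] at hsum hsum'
    left
    exact ⟨a, mem (by simp [ha]), by rw [← hsum', hsum, one_smul]⟩
  · obtain ⟨a, b, hab, he⟩ := Finset.card_eq_two.1 hc
    rw [he, Finset.sum_pair hab] at hsum hsum'
    have ma : w a ≠ 0 := mem (by simp [he])
    have mb : w b ≠ 0 := mem (by simp [he])
    right; left
    exact ⟨a, b, ma, mb, hw.adj hab ma mb, w a, w b, hpos ma, hpos mb, hsum, hsum'⟩
  · obtain ⟨a, b, c, hab, hac, hbc, he⟩ := Finset.card_eq_three.1 hc
    rw [he, Finset.sum_insert (by simp [hab, hac]), Finset.sum_pair hbc, ← add_assoc] at hsum hsum'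
    have ma : w a ≠ 0 := mem (by simp [he])
    have mb : w b ≠ 0 := mem (by simp [he])
    have mc : w c ≠ 0 := mem (by simp [he])
    right; right
    exact ⟨a, b, c, ma, mb, mc, hw.adj hab ma mb, hw.adj hac ma mc, hw.adj hbc mb mc, hsum, hsum'⟩

theorem IsClosedRips.exists_crosses_of_disjoint [Fintype ι] (h : IsClosedRips p r) {w w' : ι → ℝ}
    (hw : IsRipsWeight p r w) (hw' : IsRipsWeight p r w')
    (he : ∑ i, w i • p i = ∑ i, w' i • p i) (hd : ∀ i, w i = 0 ∨ w' i = 0) :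
    ∃ a b c d, w a ≠ 0 ∧ w b ≠ 0 ∧ w' c ≠ 0 ∧ w' d ≠ 0 ∧ RipsAdj p r a b ∧ RipsAdj p r c d ∧
      Crosses (p a) (p b) (p c) (p d) := by
  have ne : ∀ {a b}, w a ≠ 0 → w' b ≠ 0 → a ≠ b := by
    rintro a b ha hb rfl
    exact (hd a).elim ha hb
  have hpos : ∀ {i}, w i ≠ 0 → 0 < w i := fun hi => lt_of_le_of_ne (hw.nonneg _) hi.symm
  have hpos' : ∀ {i}, w' i ≠ 0 → 0 < w' i := fun hi => lt_of_le_of_ne (hw'.nonneg _) hi.symm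
  rcases hw.cases h with ⟨a, ha, hy⟩ | ⟨a, b, ha, hb, hab, hy⟩ |
      ⟨a, b, c, ha, hb, hc, hab, hac, hbc, hs, hy⟩ <;>
    rcases hw'.cases h with ⟨a', ha', hy'⟩ | ⟨a', b', ha', hb', hab', hy'⟩ |
      ⟨a', b', c', ha', hb', hc', hab', hac', hbc', hs', hy'⟩
  · exact absurd (h.injective (hy.symm.trans (he.trans hy'))) (ne ha ha')
  · rw [← he, hy] at hy'
    exact absurd hy' (h.not_mem_openSegment hab' a)
  · refine absurd (mem_convexHull_triple (hpos' ha').le (hpos' hb').le (hpos' hc').le hs' hy')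
      ?_
    rw [← he, hy]
    exact h.not_mem_triangle hab' hac' hbc' (ne ha ha') (ne ha hb') (ne ha hc')
  · rw [he, hy'] at hy
    exact absurd hy (h.not_mem_openSegment hab a')
  · rw [← he] at hy'
    refine ⟨a, b, a', b', ha, hb, ha', hb', hab, hab', h.crosses hab hab' (fun e => ?_) ⟨_, hy, hy'⟩⟩
    rcases Sym2.eq_iff.1 e with ⟨e, -⟩ | ⟨e, -⟩
    exacts [ne ha ha' e, ne ha hb' e]
  · rw [← he] at hy'
    rcases h.crosses_of_edge_triangle hab hy hab' hac' hbc' (hpos' ha') (hpos' hb') (hpos' hc') hs'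
      hy' (ne ha ha') (ne ha hb') (ne ha hc') (ne hb ha') (ne hb hb') (ne hb hc') with hx | hx | hx
    exacts [⟨_, _, _, _, ha, hb, ha', hb', hab, hab', hx⟩,
      ⟨_, _, _, _, ha, hb, hb', hc', hab, hbc', hx⟩, ⟨_, _, _, _, ha, hb, ha', hc', hab, hac', hx⟩]
  · refine absurd (mem_convexHull_triple (hpos ha).le (hpos hb).le (hpos hc).le hs hy)
      ?_
    rw [he, hy']
    exact h.not_mem_triangle hab hac hbc (ne ha ha').symm (ne hb ha').symm (ne hc ha').symm
  · rw [he] at hy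
    rcases h.crosses_of_edge_triangle hab' hy' hab hac hbc (hpos ha) (hpos hb) (hpos hc) hs
      hy (ne ha ha').symm (ne hb ha').symm (ne hc ha').symm (ne ha hb').symm (ne hb hb').symm
      (ne hc hb').symm with hx | hx | hx
    exacts [⟨_, _, _, _, ha, hb, ha', hb', hab, hab', hx.symm⟩,
      ⟨_, _, _, _, hb, hc, ha', hb', hbc, hab', hx.symm⟩,
      ⟨_, _, _, _, ha, hc, ha', hb', hac, hab', hx.symm⟩]
  · -- leave the first triangle along a segment towards a vertex of the second one
    rw [he] at hy
    set y := ∑ i, w' i • p i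
    have inner : ∀ z ∈ openSegment ℝ y (p a'), ∃ s t u : ℝ, 0 < s ∧ 0 < t ∧ 0 < u ∧ s + t + u = 1 ∧
        s • p a' + t • p b' + u • p c' = z := by
      rintro _ ⟨α, β, hα, hβ, hαβ, rfl⟩
      refine ⟨α * w' a' + β, α * w' b', α * w' c', ?_, mul_pos hα (hpos' hb'),
        mul_pos hα (hpos' hc'), ?_, ?_⟩
      · have := mul_pos hα (hpos' ha')
        linarith
      · linear_combination α * hs' + hαβ
      · rw [← hy']
        module
    have hout : ∀ {x}, w x ≠ 0 → p x ∉ openSegment ℝ y (p a') := by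
      intro x hx hmem
      obtain ⟨s, t, u, h1, h2, h3, h4, h5⟩ := inner _ hmem
      exact h.not_mem_triangle hab' hac' hbc' (ne hx ha') (ne hx hb') (ne hx hc')
        (mem_convexHull_triple h1.le h2.le h3.le h4 h5)
    obtain ⟨z, hz, hz'⟩ := exists_mem_side (h.orient_ne_zero hab hac hbc) (hpos ha) (hpos hb)
      (hpos hc) hs hy (h.not_mem_triangle hab hac hbc (ne ha ha').symm (ne hb ha').symm
        (ne hc ha').symm) (hout ha) (hout hb) (hout hc)
    obtain ⟨s, t, u, h1, h2, h3, h4, h5⟩ := inner _ hz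
    have main : ∀ {x x'}, w x ≠ 0 → w x' ≠ 0 → RipsAdj p r x x' → z ∈ openSegment ℝ (p x) (p x') →
        ∃ a b c d, w a ≠ 0 ∧ w b ≠ 0 ∧ w' c ≠ 0 ∧ w' d ≠ 0 ∧ RipsAdj p r a b ∧ RipsAdj p r c d ∧
          Crosses (p a) (p b) (p c) (p d) := by
      intro x x' hx hx' hadj hzx
      rcases h.crosses_of_edge_triangle hadj hzx hab' hac' hbc' h1 h2 h3 h4 h5 (ne hx ha')
        (ne hx hb') (ne hx hc') (ne hx' ha') (ne hx' hb') (ne hx' hc') with hh | hh | hh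
      exacts [⟨_, _, _, _, hx, hx', ha', hb', hadj, hab', hh⟩,
        ⟨_, _, _, _, hx, hx', hb', hc', hadj, hbc', hh⟩,
        ⟨_, _, _, _, hx, hx', ha', hc', hadj, hac', hh⟩]
    rcases hz' with hz' | hz' | hz'
    exacts [main ha hb hab hz', main hb hc hbc hz', main ha hc hac hz']

/-- Distinct points of the Rips complex with the same image in the plane lie in simplices with
crossing edges. Cancelling the common part of the weights reduces this to disjoint simplices. -/
theorem IsClosedRips.exists_crosses [Fintype ι] (h : IsClosedRips p r) {w w' : ι → ℝ}
    (hw : IsRipsWeight p r w) (hw' : IsRipsWeight p r w')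
    (he : ∑ i, w i • p i = ∑ i, w' i • p i) (hne : w ≠ w') :
    ∃ a b c d, w a ≠ 0 ∧ w b ≠ 0 ∧ w' c ≠ 0 ∧ w' d ≠ 0 ∧ RipsAdj p r a b ∧ RipsAdj p r c d ∧
      Crosses (p a) (p b) (p c) (p d) := by
  set σ := ∑ i, (w i - min (w i) (w' i)) with hσ
  have hσ' : ∑ i, (w' i - min (w i) (w' i)) = σ := by
    rw [hσ, Finset.sum_sub_distrib, Finset.sum_sub_distrib, hw.sum_eq_one, hw'.sum_eq_one]
  have nn : ∀ i, 0 ≤ w i - min (w i) (w' i) := fun i => sub_nonneg.2 (min_le_left _ _)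
  have nn' : ∀ i, 0 ≤ w' i - min (w i) (w' i) := fun i => sub_nonneg.2 (min_le_right _ _)
  have hσ0 : 0 < σ := by
    refine lt_of_le_of_ne (Finset.sum_nonneg fun i _ => nn i) fun h0 => hne ?_
    funext i
    have e1 := (Finset.sum_eq_zero_iff_of_nonneg fun i _ => nn i).1 h0.symm i (Finset.mem_univ i)
    have e2 := (Finset.sum_eq_zero_iff_of_nonneg fun i _ => nn' i).1 (hσ'.trans h0.symm) i
      (Finset.mem_univ i)
    linarith
  have supp : ∀ {i}, (w i - min (w i) (w' i)) / σ ≠ 0 → w i ≠ 0 := by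
    intro i hi h0
    apply hi
    rw [h0, min_eq_left (hw'.nonneg i)]
    simp
  have supp' : ∀ {i}, (w' i - min (w i) (w' i)) / σ ≠ 0 → w' i ≠ 0 := by
    intro i hi h0
    apply hi
    rw [h0, min_eq_right (hw.nonneg i)]
    simp
  have g : IsRipsWeight p r fun i => (w i - min (w i) (w' i)) / σ :=
    ⟨fun i => div_nonneg (nn i) hσ0.le, by rw [← Finset.sum_div, div_self hσ0.ne'],
      fun hab ha hb => hw.adj hab (supp ha) (supp hb)⟩
  have g' : IsRipsWeight p r fun i => (w' i - min (w i) (w' i)) / σ :=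
    ⟨fun i => div_nonneg (nn' i) hσ0.le, by rw [← Finset.sum_div, hσ', div_self hσ0.ne'],
      fun hab ha hb => hw'.adj hab (supp' ha) (supp' hb)⟩
  obtain ⟨a, b, c, d, h1, h2, h3, h4, h5⟩ := h.exists_crosses_of_disjoint g g' (by
    simp only [sub_div, sub_smul, Finset.sum_sub_distrib]
    simp only [div_eq_inv_mul, mul_smul, ← Finset.smul_sum, he]) (fun i => by
    rcases le_total (w i) (w' i) with hh | hh
    · left; simp [min_eq_left hh]
    · right; simp [min_eq_right hh])
  exact ⟨a, b, c, d, supp h1, supp h2, supp' h3, supp' h4, h5⟩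

/-! ### The interiors of the hexagons -/

/-- The open hexagon with vertices `v 0, …, v 5`, in counterclockwise order. -/
def hexagonInterior (p : ι → Plane) (v : Fin 6 → ι) : Set Plane :=
  {y | ∀ i, 0 < orient (p (v i)) (p (v (i + 1))) y}

theorem isOpen_hexagonInterior (p : ι → Plane) (v : Fin 6 → ι) : IsOpen (hexagonInterior p v) := by
  simp only [hexagonInterior, Set.ofPred_forall]
  refine isOpen_iInter_of_finite fun i => isOpen_lt continuous_const ?_
  unfold orient
  fun_prop

theorem convex_hexagonInterior (p : ι → Plane) (v : Fin 6 → ι) :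
    Convex ℝ (hexagonInterior p v) := by
  intro x hx y hy s t hs ht hst i
  rw [orient_smul_add_smul _ _ _ _ hst]
  rcases hs.eq_or_lt with rfl | hs
  · obtain rfl : t = 1 := by linarith
    simpa using hy i
  · have := mul_pos hs (hx i)
    have := mul_nonneg ht (hy i).le
    linarith

theorem hexagonInterior_rotate (p : ι → Plane) (v : Fin 6 → ι) (k : Fin 6) :
    hexagonInterior p (fun i => v (i + k)) = hexagonInterior p v := by
  ext y
  constructor
  · intro h i
    have := h (i - k)
    beta_reduce at this
    rwa [sub_add_cancel, show i - k + 1 + k = i + 1 by abel] at this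
  · intro h i
    have := h (i + k)
    rw [show i + k + 1 = i + 1 + k by abel] at this
    exact this

theorem IsHexagram.orient_pos_of_ne {v : Fin 6 → ι} (hv : IsHexagram p r v)
    (h0 : 0 < orient (p (v 0)) (p (v 1)) (p (v 2))) {i j : Fin 6} (h1 : j ≠ i) (h2 : j ≠ i + 1) :
    0 < orient (p (v i)) (p (v (i + 1))) (p (v j)) := by
  obtain ⟨a, b, c, d, -⟩ := hv.orient_pos h0 i
  have : ∀ i j : Fin 6, j ≠ i → j ≠ i + 1 → j = i + 2 ∨ j = i + 3 ∨ j = i + 4 ∨ j = i + 5 := by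
    decide
  rcases this i j h1 h2 with rfl | rfl | rfl | rfl <;> assumption

theorem IsHexagram.orient_nonneg {v : Fin 6 → ι} (hv : IsHexagram p r v)
    (h0 : 0 < orient (p (v 0)) (p (v 1)) (p (v 2))) (i j : Fin 6) :
    0 ≤ orient (p (v i)) (p (v (i + 1))) (p (v j)) := by
  by_cases h1 : j = i
  · rw [h1, orient_left_self]
  by_cases h2 : j = i + 1
  · rw [h2, orient_right_self]
  exact (hv.orient_pos_of_ne h0 h1 h2).le

theorem IsHexagram.rotate_orient_pos {v : Fin 6 → ι} (hv : IsHexagram p r v)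
    (h0 : 0 < orient (p (v 0)) (p (v 1)) (p (v 2))) (k : Fin 6) :
    0 < orient (p (v (0 + k))) (p (v (1 + k))) (p (v (2 + k))) := by
  have := (hv.orient_pos h0 k).1
  rwa [zero_add, add_comm 1, add_comm 2]

theorem IsHexagram.sum_mem_hexagonInterior [Fintype ι] {v : Fin 6 → ι} (hv : IsHexagram p r v)
    (h0 : 0 < orient (p (v 0)) (p (v 1)) (p (v 2))) {w : ι → ℝ} (hw : IsRipsWeight p r w)
    (hs : ∀ x, w x ≠ 0 → x ∈ Set.range v) {i : Fin 6} (h1 : w (v i) ≠ 0) (h2 : w (v (i + 2)) ≠ 0) :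
    ∑ x, w x • p x ∈ hexagonInterior p v := by
  intro j
  rw [orient_sum p w hw.sum_eq_one]
  have key : ∀ i j : Fin 6, i ≠ j ∧ i ≠ j + 1 ∨ i + 2 ≠ j ∧ i + 2 ≠ j + 1 := by decide
  obtain ⟨k, hk, hk1, hk2⟩ : ∃ k, w (v k) ≠ 0 ∧ k ≠ j ∧ k ≠ j + 1 := by
    rcases key i j with hh | hh
    exacts [⟨i, h1, hh⟩, ⟨i + 2, h2, hh⟩]
  refine Finset.sum_pos' (fun x _ => ?_) ⟨v k, Finset.mem_univ _, ?_⟩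
  · by_cases hx : w x = 0
    · rw [hx, zero_mul]
    · obtain ⟨l, rfl⟩ := hs x hx
      exact mul_nonneg (hw.nonneg _) (hv.orient_nonneg h0 j l)
  · exact mul_pos (lt_of_le_of_ne (hw.nonneg _) hk.symm) (hv.orient_pos_of_ne h0 hk1 hk2)

/-- The barycentric coordinates of a point of a triangle, as a weight. -/
theorem exists_isRipsWeight [Fintype ι] {a b c : ι} (hab : RipsAdj p r a b) (hac : RipsAdj p r a c)
    (hbc : RipsAdj p r b c) (h : 0 < orient (p a) (p b) (p c)) {y : Plane}
    (h1 : 0 ≤ orient (p a) (p b) y) (h2 : 0 ≤ orient (p b) (p c) y)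
    (h3 : 0 ≤ orient (p c) (p a) y) :
    ∃ w, IsRipsWeight p r w ∧ ∑ i, w i • p i = y ∧ (∀ x, w x ≠ 0 → x = a ∨ x = b ∨ x = c) ∧
      (0 < orient (p a) (p b) y → w c ≠ 0) ∧ (0 < orient (p b) (p c) y → w a ≠ 0) ∧
      (0 < orient (p c) (p a) y → w b ≠ 0) := by
  classical
  set α := orient (p b) (p c) y / orient (p a) (p b) (p c) with hα
  set β := orient (p c) (p a) y / orient (p a) (p b) (p c) with hβ
  set γ := orient (p a) (p b) y / orient (p a) (p b) (p c) with hγ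
  have hα0 : 0 ≤ α := div_nonneg h2 h.le
  have hβ0 : 0 ≤ β := div_nonneg h3 h.le
  have hγ0 : 0 ≤ γ := div_nonneg h1 h.le
  set w : ι → ℝ := fun x => (Pi.single a α : ι → ℝ) x + (Pi.single b β : ι → ℝ) x +
    (Pi.single c γ : ι → ℝ) x with hw
  have wa : w a = α := by simp [hw, hab.1, hac.1]
  have wb : w b = β := by simp [hw, hab.1.symm, hbc.1]
  have wc : w c = γ := by simp [hw, hac.1.symm, hbc.1.symm]
  have supp : ∀ x, w x ≠ 0 → x = a ∨ x = b ∨ x = c := by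
    intro x hx
    by_contra! hcon
    exact hx (by simp [hw, hcon.1, hcon.2.1, hcon.2.2])
  refine ⟨w, ⟨fun x => ?_, ?_, ?_⟩, ?_, supp, ?_, ?_, ?_⟩
  · by_cases hx : w x = 0
    · exact hx.ge
    · rcases supp x hx with rfl | rfl | rfl
      exacts [wa ▸ hα0, wb ▸ hβ0, wc ▸ hγ0]
  · simp only [hw, Finset.sum_add_distrib, Finset.sum_pi_single', Finset.mem_univ, if_true]
    exact barycentric_sum _ _ _ _ h.ne'
  · intro x x' hne hx hx'
    rcases supp x hx with rfl | rfl | rfl <;> rcases supp x' hx' with rfl | rfl | rfl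
    exacts [absurd rfl hne, hab, hac, hab.symm, absurd rfl hne, hbc, hac.symm, hbc.symm,
      absurd rfl hne]
  · rw [← barycentric (p a) (p b) (p c) y h.ne', ← hα, ← hβ, ← hγ]
    simp only [hw, add_smul, Finset.sum_add_distrib, Pi.single_apply, ite_smul, zero_smul,
      Finset.sum_ite_eq', Finset.mem_univ, if_true]
  · intro hh; rw [wc]; exact (div_pos hh h).ne'
  · intro hh; rw [wa]; exact (div_pos hh h).ne'
  · intro hh; rw [wb]; exact (div_pos hh h).ne'

/-- Some two vertices of the even triangle `v 0 v 2 v 4` are in the support of `w`. For a point of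
the octahedron this means that the smallest simplex containing it is the even triangle, a side of it,
or a triangle sharing a side with it. -/
def HasEvenPair (v : Fin 6 → ι) (w : ι → ℝ) : Prop :=
  ∃ i : Fin 6, (i = 0 ∨ i = 2 ∨ i = 4) ∧ w (v i) ≠ 0 ∧ w (v (i + 2)) ≠ 0

/-- Some two vertices of the odd triangle `v 1 v 3 v 5` are in the support of `w`. -/
def HasOddPair (v : Fin 6 → ι) (w : ι → ℝ) : Prop :=
  ∃ i : Fin 6, (i = 1 ∨ i = 3 ∨ i = 5) ∧ w (v i) ≠ 0 ∧ w (v (i + 2)) ≠ 0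

theorem hasEvenPair_rotate {v : Fin 6 → ι} {w : ι → ℝ} :
    HasEvenPair (fun i => v (i + 1)) w ↔ HasOddPair v w := by
  constructor
  · rintro ⟨i, hi, h1, h2⟩
    refine ⟨i + 1, ?_, h1, ?_⟩
    · clear h1 h2; revert i; decide
    · rwa [show i + 1 + 2 = i + 2 + 1 by abel]
  · rintro ⟨i, hi, h1, h2⟩
    refine ⟨i - 1, ?_, by simpa using h1, ?_⟩
    · clear h1 h2; revert i; decide
    · beta_reduce
      rwa [show i - 1 + 2 + 1 = i + 2 by abel]

theorem hasOddPair_rotate {v : Fin 6 → ι} {w : ι → ℝ} :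
    HasOddPair (fun i => v (i + 1)) w ↔ HasEvenPair v w := by
  constructor
  · rintro ⟨i, hi, h1, h2⟩
    refine ⟨i + 1, ?_, h1, ?_⟩
    · clear h1 h2; revert i; decide
    · rwa [show i + 1 + 2 = i + 2 + 1 by abel]
  · rintro ⟨i, hi, h1, h2⟩
    refine ⟨i - 1, ?_, by simpa using h1, ?_⟩
    · clear h1 h2; revert i; decide
    · beta_reduce
      rwa [show i - 1 + 2 + 1 = i + 2 by abel]

theorem IsHexagram.not_hasEvenPair_and_hasOddPair [Fintype ι] {v : Fin 6 → ι}
    (hv : IsHexagram p r v) {w : ι → ℝ} (hw : IsRipsWeight p r w) (he : HasEvenPair v w)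
    (ho : HasOddPair v w) : False := by
  obtain ⟨i, hi, h1, h2⟩ := he
  obtain ⟨j, hj, h3, h4⟩ := ho
  -- an even pair and an odd pair contain antipodal vertices
  have anti : ∀ k l : Fin 6, l = k + 3 → w (v k) ≠ 0 → w (v l) ≠ 0 → False := by
    rintro k l rfl hk hl
    refine hv.not_adj k (hw.adj (fun e => ?_) hk hl)
    exact (by decide : ∀ k : Fin 6, k ≠ k + 3) k (hv.injective e)
  have key : ∀ i j : Fin 6, (i = 0 ∨ i = 2 ∨ i = 4) → (j = 1 ∨ j = 3 ∨ j = 5) →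
      j = i + 3 ∨ j + 2 = i + 3 ∨ j = i + 2 + 3 ∨ j + 2 = i + 2 + 3 := by decide
  rcases key i j hi hj with e | e | e | e
  exacts [anti _ _ e h1 h3, anti _ _ e h1 h4, anti _ _ e h2 h3, anti _ _ e h2 h4]

/-- Each point of the open hexagon lies in one of the triangles `v 0 v 2 v 4`, `v 0 v 1 v 2`,
`v 2 v 3 v 4`, `v 4 v 5 v 0`, which decompose the hexagon. -/
theorem IsHexagram.exists_hasEvenPair [Fintype ι] {v : Fin 6 → ι} (hv : IsHexagram p r v)
    (h0 : 0 < orient (p (v 0)) (p (v 1)) (p (v 2))) {y : Plane} (hy : y ∈ hexagonInterior p v) :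
    ∃ w, IsRipsWeight p r w ∧ ∑ i, w i • p i = y ∧ (∀ x, w x ≠ 0 → x ∈ Set.range v) ∧
      HasEvenPair v w := by
  -- the points beyond a side of the even triangle
  have corner : ∀ i : Fin 6, (i = 0 ∨ i = 2 ∨ i = 4) →
      orient (p (v i)) (p (v (i + 2))) y ≤ 0 → ∃ w, IsRipsWeight p r w ∧ ∑ i, w i • p i = y ∧
        (∀ x, w x ≠ 0 → x ∈ Set.range v) ∧ HasEvenPair v w := by
    intro i hi hle
    have a12 := hv.adj_one (i + 1)
    have y12 := hy (i + 1)
    rw [add_assoc, (by decide : (1 : Fin 6) + 1 = 2)] at a12 y12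
    obtain ⟨w, hw, hs, hsupp, w1, w2, -⟩ := exists_isRipsWeight (hv.adj_one i) (hv.adj_two i) a12
      (hv.orient_pos h0 i).1 (hy i).le y12.le (by rw [orient_swap_left]; linarith)
    refine ⟨w, hw, hs, fun x hx => ?_, i, hi, w2 y12, w1 (hy i)⟩
    rcases hsupp x hx with rfl | rfl | rfl <;> exact ⟨_, rfl⟩
  by_cases g0 : orient (p (v 0)) (p (v 2)) y ≤ 0
  · exact corner 0 (by simp) g0
  by_cases g2 : orient (p (v 2)) (p (v 4)) y ≤ 0
  · exact corner 2 (by simp) g2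
  by_cases g4 : orient (p (v 4)) (p (v 0)) y ≤ 0
  · exact corner 4 (by simp) g4
  rw [not_le] at g0 g2 g4
  obtain ⟨w, hw, hs, hsupp, w1, w2, w3⟩ := exists_isRipsWeight (hv.adj_two 0) (hv.adj_two 4).symm
    (hv.adj_two 2) (hv.orient_pos h0 0).2.2.2.2 g0.le g2.le g4.le
  refine ⟨w, hw, hs, fun x hx => ?_, 0, by simp, w2 g2, w3 g4⟩
  rcases hsupp x hx with rfl | rfl | rfl <;> exact ⟨_, rfl⟩

theorem IsHexagram.exists_hasOddPair [Fintype ι] {v : Fin 6 → ι} (hv : IsHexagram p r v)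
    (h0 : 0 < orient (p (v 0)) (p (v 1)) (p (v 2))) {y : Plane} (hy : y ∈ hexagonInterior p v) :
    ∃ w, IsRipsWeight p r w ∧ ∑ i, w i • p i = y ∧ (∀ x, w x ≠ 0 → x ∈ Set.range v) ∧
      HasOddPair v w := by
  obtain ⟨w, hw, hs, hsupp, hp⟩ := (hv.rotate 1).exists_hasEvenPair (hv.rotate_orient_pos h0 1)
    (by rwa [hexagonInterior_rotate])
  refine ⟨w, hw, hs, fun x hx => ?_, hasEvenPair_rotate.1 hp⟩
  obtain ⟨i, rfl⟩ := hsupp x hx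
  exact ⟨_, rfl⟩

/-- Two points of the Rips complex with the same image lie in the octahedron of a hexagram. -/
theorem IsClosedRips.exists_isHexagram_of_sum_eq [Fintype ι] (h : IsClosedRips p r) {w w' : ι → ℝ}
    (hw : IsRipsWeight p r w) (hw' : IsRipsWeight p r w')
    (he : ∑ i, w i • p i = ∑ i, w' i • p i) (hne : w ≠ w') :
    ∃ u, IsHexagram p r u ∧ (∀ x, w x ≠ 0 → x ∈ Set.range u) ∧ (∀ x, w' x ≠ 0 → x ∈ Set.range u) ∧
      w (u 0) ≠ 0 ∧ w (u 2) ≠ 0 ∧ w' (u 1) ≠ 0 ∧ w' (u 3) ≠ 0 := by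
  obtain ⟨a, b, c, d, ha, hb, hc, hd, hab, hcd, hx⟩ := h.exists_crosses hw hw' he hne
  obtain ⟨u, hu, h1, h2⟩ := h.exists_isHexagram hab hcd hx
  have n0 : w (u 0) ≠ 0 := by rcases h1 with ⟨h1, -⟩ | ⟨h1, -⟩ <;> rw [h1] <;> assumption
  have n2 : w (u 2) ≠ 0 := by rcases h1 with ⟨-, h1⟩ | ⟨-, h1⟩ <;> rw [h1] <;> assumption
  have n1 : w' (u 1) ≠ 0 := by rcases h2 with ⟨h1, -⟩ | ⟨h1, -⟩ <;> rw [h1] <;> assumption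
  have n3 : w' (u 3) ≠ 0 := by rcases h2 with ⟨-, h1⟩ | ⟨-, h1⟩ <;> rw [h1] <;> assumption
  have main : ∀ {w : ι → ℝ} {i j : Fin 6}, IsRipsWeight p r w → IsCrossedEdge p r (u i) (u j) →
      w (u i) ≠ 0 → w (u j) ≠ 0 → ∀ x, w x ≠ 0 → x ∈ Set.range u := by
    intro w i j hw hij hi hj x hx
    by_cases e1 : x = u i
    · exact ⟨i, e1.symm⟩
    by_cases e2 : x = u j
    · exact ⟨j, e2.symm⟩
    exact h.mem_range_of_isCrossedEdge hu ⟨i, rfl⟩ ⟨j, rfl⟩ hij (hw.adj (Ne.symm e1) hi hx)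
      (hw.adj (Ne.symm e2) hj hx)
  exact ⟨u, hu, main hw (hu.isCrossedEdge 0) n0 n2, main hw' (hu.isCrossedEdge 1) n1 n3, n0, n2, n1,
    n3⟩

/-- A crossed edge between vertices of a hexagram is a diagonal `v i v (i + 2)`, up to order. -/
theorem IsClosedRips.hasPair (h : IsClosedRips p r) {v : Fin 6 → ι} (hv : IsHexagram p r v)
    {w : ι → ℝ} {a b : ι} (hab : IsCrossedEdge p r a b) (ha : a ∈ Set.range v) (hb : b ∈ Set.range v)
    (wa : w a ≠ 0) (wb : w b ≠ 0) :
    ∃ i, (a = v i ∧ b = v (i + 2) ∨ b = v i ∧ a = v (i + 2)) ∧ w (v i) ≠ 0 ∧ w (v (i + 2)) ≠ 0 := by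
  obtain ⟨i, rfl⟩ := ha
  obtain ⟨j, rfl⟩ := hb
  rcases h.eq_add_two_or hv hab with rfl | rfl
  · exact ⟨i, Or.inl ⟨rfl, rfl⟩, wa, wb⟩
  · exact ⟨j, Or.inr ⟨rfl, rfl⟩, wb, wa⟩

/-- Two points of the Rips complex with the same image lie in simplices of different parity: two
even diagonals have a common vertex, so that they do not cross. -/
theorem IsClosedRips.hasOddPair [Fintype ι] (h : IsClosedRips p r) {v : Fin 6 → ι}
    (hv : IsHexagram p r v) {w w' : ι → ℝ} (hw : IsRipsWeight p r w) (hw' : IsRipsWeight p r w')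
    (he : ∑ i, w i • p i = ∑ i, w' i • p i) (hne : w ≠ w') (hp : HasEvenPair v w) :
    HasOddPair v w' := by
  obtain ⟨u, hu, hs, -, w0, w2, w1, w3⟩ := h.exists_isHexagram_of_sum_eq hw hw' he hne
  obtain ⟨i, hi, wi, wi2⟩ := id hp
  have hr : Set.range u = Set.range v := h.range_eq hu hv (hv.isCrossedEdge i) (hs _ wi) (hs _ wi2)
    ⟨_, rfl⟩ ⟨_, rfl⟩
  obtain ⟨j, hj, wj, wj2⟩ := h.hasPair hv (hu.isCrossedEdge 0) (hr ▸ ⟨0, rfl⟩) (hr ▸ ⟨0 + 2, rfl⟩)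
    w0 w2
  obtain ⟨k, hk, wk, wk2⟩ := h.hasPair hv (hu.isCrossedEdge 1) (hr ▸ ⟨1, rfl⟩) (hr ▸ ⟨1 + 2, rfl⟩)
    w1 w3
  have parity : ∀ i : Fin 6, (i = 0 ∨ i = 2 ∨ i = 4) ∨ (i = 1 ∨ i = 3 ∨ i = 5) := by decide
  rcases parity j with hj' | hj'
  swap
  · exact (hv.not_hasEvenPair_and_hasOddPair hw hp ⟨j, hj', wj, wj2⟩).elim
  rcases parity k with hk' | hk'
  swap
  · exact ⟨k, hk', wk, wk2⟩
  exfalso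
  have share : ∀ j k : Fin 6, (j = 0 ∨ j = 2 ∨ j = 4) → (k = 0 ∨ k = 2 ∨ k = 4) →
      j = k ∨ j = k + 2 ∨ j + 2 = k := by decide
  have n : ∀ i j : Fin 6, i ≠ j → u i ≠ u j := fun i j hij e => hij (hu.injective e)
  have hd : v j ≠ v k ∧ v j ≠ v (k + 2) ∧ v (j + 2) ≠ v k := by
    rcases hj with ⟨e1, e2⟩ | ⟨e1, e2⟩ <;> rcases hk with ⟨e3, e4⟩ | ⟨e3, e4⟩ <;>
    · rw [← e1, ← e2, ← e3, ← e4]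
      exact ⟨n _ _ (by decide), n _ _ (by decide), n _ _ (by decide)⟩
  rcases share j k hj' hk' with e | e | e
  · exact hd.1 (by rw [e])
  · exact hd.2.1 (by rw [e])
  · exact hd.2.2 (by rw [e])

theorem IsClosedRips.hasEvenPair [Fintype ι] (h : IsClosedRips p r) {v : Fin 6 → ι}
    (hv : IsHexagram p r v) {w w' : ι → ℝ} (hw : IsRipsWeight p r w) (hw' : IsRipsWeight p r w')
    (he : ∑ i, w i • p i = ∑ i, w' i • p i) (hne : w ≠ w') (hp : HasOddPair v w) :
    HasEvenPair v w' :=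
  hasOddPair_rotate.1 (h.hasOddPair (hv.rotate 1) hw hw' he hne (hasEvenPair_rotate.2 hp))

/-- The points of the open hexagon have two preimages in the Rips complex, one with an even pair
and one with an odd pair in its support. -/
theorem IsClosedRips.exists_preimages [Fintype ι] (h : IsClosedRips p r) {v : Fin 6 → ι}
    (hv : IsHexagram p r v) (h0 : 0 < orient (p (v 0)) (p (v 1)) (p (v 2))) {y : Plane}
    (hy : y ∈ hexagonInterior p v) :
    ∃ w w', w ≠ w' ∧ HasEvenPair v w ∧ HasOddPair v w' ∧
      (∀ x, w x ≠ 0 → x ∈ Set.range v) ∧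
      {w | IsRipsWeight p r w ∧ ∑ i, w i • p i = y} = {w, w'} := by
  obtain ⟨w, hw, hs, hr, he⟩ := hv.exists_hasEvenPair h0 hy
  obtain ⟨w', hw', hs', hr', ho⟩ := hv.exists_hasOddPair h0 hy
  refine ⟨w, w', ?_, he, ho, hr, ?_⟩
  · rintro rfl
    exact hv.not_hasEvenPair_and_hasOddPair hw he ho
  · ext x
    constructor
    · rintro ⟨hx, hxs⟩
      by_contra! hcon
      simp only [Set.mem_insert_iff, Set.mem_singleton_iff, not_or] at hcon
      exact hv.not_hasEvenPair_and_hasOddPair hx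
        (h.hasEvenPair hv hw' hx (hs'.trans hxs.symm) (Ne.symm hcon.2) ho)
        (h.hasOddPair hv hw hx (hs.trans hxs.symm) (Ne.symm hcon.1) he)
    · rintro (rfl | rfl)
      exacts [⟨hw, hs⟩, ⟨hw', hs'⟩]

theorem IsHexagram.exists_orient_pos {v : Fin 6 → ι} (hv : IsHexagram p r v) :
    ∃ u, IsHexagram p r u ∧ 0 < orient (p (u 0)) (p (u 1)) (p (u 2)) ∧
      Set.range u = Set.range v := by
  rcases lt_or_gt_of_ne hv.orient_ne_zero with h0 | h0
  · refine ⟨_, hv.reflect 2, ?_, ?_⟩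
    · have := IsHexagram.orient_reflect (p := p) v
      rw [this]
      linarith
    · exact (Equiv.subLeft (2 : Fin 6)).surjective.range_comp v
  · exact ⟨v, hv, h0, rfl⟩

/-- Hexagrams whose open hexagons meet have the same vertices. -/
theorem IsClosedRips.range_eq_of_mem_hexagonInterior [Fintype ι] (h : IsClosedRips p r)
    {u v : Fin 6 → ι} (hu : IsHexagram p r u) (hv : IsHexagram p r v)
    (hu0 : 0 < orient (p (u 0)) (p (u 1)) (p (u 2)))
    (hv0 : 0 < orient (p (v 0)) (p (v 1)) (p (v 2))) {y : Plane} (hyu : y ∈ hexagonInterior p u)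
    (hyv : y ∈ hexagonInterior p v) : Set.range u = Set.range v := by
  obtain ⟨w, w', -, ⟨i, -, hi, hi2⟩, ⟨j, -, hj, hj2⟩, -, hset⟩ := h.exists_preimages hu hu0 hyu
  obtain ⟨z, hz, hzs, hzr, -⟩ := hv.exists_hasEvenPair hv0 hyv
  have : z ∈ ({w, w'} : Set (ι → ℝ)) := hset ▸ ⟨hz, hzs⟩
  rcases this with rfl | rfl
  · exact h.range_eq hu hv (hu.isCrossedEdge i) ⟨_, rfl⟩ ⟨_, rfl⟩ (hzr _ hi) (hzr _ hi2)
  · exact h.range_eq hu hv (hu.isCrossedEdge j) ⟨_, rfl⟩ ⟨_, rfl⟩ (hzr _ hj) (hzr _ hj2)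

theorem IsClosedRips.mem_hexagonInterior_of_sum_eq [Fintype ι] (h : IsClosedRips p r)
    {u v : Fin 6 → ι} (hu : IsHexagram p r u) (hv : IsHexagram p r v)
    (hv0 : 0 < orient (p (v 0)) (p (v 1)) (p (v 2))) (huv : Set.range u = Set.range v)
    {w : ι → ℝ} (hw : IsRipsWeight p r w) (hr : ∀ x, w x ≠ 0 → x ∈ Set.range u) (h0 : w (u 0) ≠ 0)
    (h2 : w (u 2) ≠ 0) : ∑ i, w i • p i ∈ hexagonInterior p v := by
  obtain ⟨i, -, hi, hi2⟩ := h.hasPair hv (hu.isCrossedEdge 0) (huv ▸ ⟨0, rfl⟩)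
    (huv ▸ ⟨0 + 2, rfl⟩) h0 h2
  exact hv.sum_mem_hexagonInterior hv0 hw (huv ▸ hr) hi hi2

/-! ### The doubly covered points -/

/-- The vertex sets of the hexagrams. -/
def hexagramSets (p : ι → Plane) (r : ℝ) : Set (Finset ι) :=
  {U | ∃ v, IsHexagram p r v ∧ (U : Set ι) = Set.range v}

theorem exists_hexagramSets_eq_range (U : hexagramSets p r) : ∃ v, IsHexagram p r v ∧
    0 < orient (p (v 0)) (p (v 1)) (p (v 2)) ∧ ((U : Finset ι) : Set ι) = Set.range v := by
  obtain ⟨U, v, hv, hU⟩ := U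
  obtain ⟨u, hu, hu0, huv⟩ := hv.exists_orient_pos
  exact ⟨u, hu, hu0, hU.trans huv.symm⟩

theorem IsHexagram.exists_mem_hexagramSets [Finite ι] {v : Fin 6 → ι} (hv : IsHexagram p r v) :
    ∃ U ∈ hexagramSets p r, (U : Set ι) = Set.range v :=
  ⟨(Set.toFinite (Set.range v)).toFinset, ⟨v, hv, by simp⟩, by simp⟩

/-- A disjoint union of nonempty connected open sets has these sets as its components. -/
theorem card_connectedComponents_iUnion {α I : Type*} [TopologicalSpace α] {S : Set α}
    (H : I → Set α) (hopen : ∀ i, IsOpen (H i)) (hconn : ∀ i, IsPreconnected (H i))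
    (hne : ∀ i, (H i).Nonempty) (hdisj : ∀ i j x, x ∈ H i → x ∈ H j → i = j)
    (hS : S = ⋃ i, H i) : ENat.card (ConnectedComponents S) = ENat.card I := by
  have hmem : ∀ x : S, ∃ i, (x : α) ∈ H i := fun x =>
    Set.mem_iUnion.1 (hS.subset x.2)
  choose f hf using hmem
  have hpre : ∀ i, f ⁻¹' {i} = Subtype.val ⁻¹' H i := by
    intro i
    ext x
    constructor
    · rintro rfl
      exact hf x
    · exact fun hx => hdisj _ _ _ (hf x) hx
  let _ : TopologicalSpace I := ⊥
  have : DiscreteTopology I := ⟨rfl⟩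
  have hcont : Continuous f := by
    refine continuous_discrete_rng.2 fun i => ?_
    rw [hpre]
    exact (hopen i).preimage continuous_subtype_val
  have hsub : ∀ i, H i ⊆ S := fun i => hS ▸ Set.subset_iUnion H i
  have hfib : ∀ i, IsPreconnected (f ⁻¹' {i}) := by
    intro i
    rw [hpre, ← Topology.IsInducing.subtypeVal.isPreconnected_image, Subtype.image_preimage_coe,
      Set.inter_eq_right.2 (hsub i)]
    exact hconn i
  refine ENat.card_congr (Equiv.ofBijective hcont.connectedComponentsLift ⟨?_, ?_⟩)
  · intro a b
    obtain ⟨x, rfl⟩ := ConnectedComponents.surjective_coe a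
    obtain ⟨y, rfl⟩ := ConnectedComponents.surjective_coe b
    intro hxy
    simp only [Continuous.connectedComponentsLift_apply_coe] at hxy
    rw [ConnectedComponents.coe_eq_coe']
    exact (hfib (f y)).subset_connectedComponent (rfl : f y = f y) hxy
  · intro i
    obtain ⟨x, hx⟩ := hne i
    refine ⟨((⟨x, hsub i hx⟩ : S) : ConnectedComponents S), ?_⟩
    rw [Continuous.connectedComponentsLift_apply_coe]
    exact hdisj _ _ _ (hf _) hx

theorem IsHexagram.hexagonInterior_nonempty {v : Fin 6 → ι} (hv : IsHexagram p r v)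
    (h0 : 0 < orient (p (v 0)) (p (v 1)) (p (v 2))) : (hexagonInterior p v).Nonempty := by
  refine ⟨(1 / 2 : ℝ) • p (v 0) + (1 / 2 : ℝ) • p (v 2), fun j => ?_⟩
  rw [orient_smul_add_smul _ _ _ _ (by norm_num)]
  have key : ∀ j : Fin 6, (0 : Fin 6) ≠ j ∧ 0 ≠ j + 1 ∨ 2 ≠ j ∧ 2 ≠ j + 1 := by decide
  have a := hv.orient_nonneg h0 j 0
  have b := hv.orient_nonneg h0 j 2
  rcases key j with ⟨h1, h2⟩ | ⟨h1, h2⟩ <;> have c := hv.orient_pos_of_ne h0 h1 h2 <;> linarith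

/-- The points with exactly two preimages form the disjoint union of the open hexagons. -/
theorem IsClosedRips.card_connectedComponents [Fintype ι] (h : IsClosedRips p r) {S : Set Plane}
    (hS : ∀ y, y ∈ S ↔ {w | IsRipsWeight p r w ∧ ∑ i, w i • p i = y}.encard = 2) :
    ENat.card (ConnectedComponents S) = (hexagramSets p r).encard := by
  choose v hv hv0 hvU using exists_hexagramSets_eq_range (p := p) (r := r)
  refine card_connectedComponents_iUnion (fun U => hexagonInterior p (v U))
    (fun U => isOpen_hexagonInterior p _) (fun U => (convex_hexagonInterior p _).isPreconnected)
    (fun U => (hv U).hexagonInterior_nonempty (hv0 U)) (fun U U' y hy hy' => ?_) ?_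
  · have := h.range_eq_of_mem_hexagonInterior (hv U) (hv U') (hv0 U) (hv0 U') hy hy'
    rw [← hvU, ← hvU] at this
    exact Subtype.ext (Finset.coe_injective this)
  · ext y
    rw [hS, Set.mem_iUnion]
    constructor
    · intro hy
      obtain ⟨w, w', hne, he⟩ := Set.encard_eq_two.1 hy
      obtain ⟨hw, hwy⟩ : w ∈ {w | IsRipsWeight p r w ∧ ∑ i, w i • p i = y} := he ▸ by simp
      obtain ⟨hw', hwy'⟩ : w' ∈ {w | IsRipsWeight p r w ∧ ∑ i, w i • p i = y} := he ▸ by simp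
      obtain ⟨u, hu, hs, -, h0, h2, -⟩ := h.exists_isHexagram_of_sum_eq hw hw'
        (hwy.trans hwy'.symm) hne
      obtain ⟨U, hU, hUu⟩ := hu.exists_mem_hexagramSets
      refine ⟨⟨U, hU⟩, ?_⟩
      rw [← hwy]
      exact h.mem_hexagonInterior_of_sum_eq hu (hv ⟨U, hU⟩) (hv0 _) (hUu.symm.trans (hvU ⟨U, hU⟩))
        hw hs h0 h2
    · rintro ⟨U, hy⟩
      obtain ⟨w, w', hne, -, -, -, he⟩ := h.exists_preimages (hv U) (hv0 U) hy
      rw [he, Set.encard_pair hne]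

/-! ### Planar Rips complexes in terms of adjacency -/

theorem mem_planarRips_faces {X : Finset Plane} {hr : 0 < r} {s : Finset {x // x ∈ X}} :
    s ∈ (planarRips X r hr).faces ↔
      s.Nonempty ∧ ∀ a ∈ s, ∀ b ∈ s, dist (a : Plane) (b : Plane) ≤ r := by
  refine and_congr_right fun hs => ⟨fun h a ha b hb => ?_, fun h => ?_⟩
  · exact (Metric.dist_le_diam_of_mem s.finite_toSet.isBounded ha hb).trans h
  · exact Metric.diam_le_of_forall_dist_le hr.le h

theorem mem_planarRips_faces_iff {X : Finset Plane} {hr : 0 < r} {s : Finset {x // x ∈ X}} :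
    s ∈ (planarRips X r hr).faces ↔
      s.Nonempty ∧ ∀ a ∈ s, ∀ b ∈ s, a ≠ b → RipsAdj (Subtype.val : {x // x ∈ X} → Plane) r a b := by
  rw [mem_planarRips_faces]
  refine and_congr_right fun hs => ⟨fun h a ha b hb hab => ⟨hab, h a ha b hb⟩,
    fun h a ha b hb => ?_⟩
  by_cases hab : a = b
  · rw [hab, dist_self]
    exact hr.le
  · exact (h a ha b hb hab).2

theorem pair_mem_planarRips_faces {X : Finset Plane} {hr : 0 < r} {a b : {x // x ∈ X}}
    (hab : a ≠ b) : ({a, b} : Finset {x // x ∈ X}) ∈ (planarRips X r hr).faces ↔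
      RipsAdj (Subtype.val : {x // x ∈ X} → Plane) r a b := by
  rw [mem_planarRips_faces_iff]
  constructor
  · intro h
    exact h.2 a (by simp) b (by simp) hab
  · intro h
    refine ⟨by simp, fun x hx y hy hxy => ?_⟩
    simp only [Finset.mem_insert, Finset.mem_singleton] at hx hy
    rcases hx with rfl | rfl <;> rcases hy with rfl | rfl
    exacts [absurd rfl hxy, h, h.symm, absurd rfl hxy]

theorem mem_realization_planarRips {X : Finset Plane} {hr : 0 < r} {w : {x // x ∈ X} → ℝ} :
    w ∈ (planarRips X r hr).realization ↔ IsRipsWeight (Subtype.val : {x // x ∈ X} → Plane) r w := by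
  classical
  constructor
  · rintro ⟨⟨h1, h2⟩, s, hs, hsupp⟩
    exact ⟨h1, h2, fun hab ha hb => (mem_planarRips_faces_iff.1 hs).2 _ (hsupp _ ha) _ (hsupp _ hb) hab⟩
  · intro hw
    refine ⟨⟨hw.nonneg, hw.sum_eq_one⟩, Finset.univ.filter fun x => w x ≠ 0, ?_, by simp⟩
    rw [mem_planarRips_faces_iff]
    refine ⟨?_, fun a ha b hb hab => hw.adj hab (by simpa using ha) (by simpa using hb)⟩
    obtain ⟨x, hx, hx0⟩ := Finset.exists_ne_zero_of_sum_ne_zero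
      (show ∑ x, w x ≠ 0 by rw [hw.sum_eq_one]; exact one_ne_zero)
    exact ⟨x, by simpa using hx0⟩

theorem mem_doublyCovered {X : Finset Plane} {hr : 0 < r} {y : Plane} :
    y ∈ doublyCovered X r hr ↔ {w | IsRipsWeight (Subtype.val : {x // x ∈ X} → Plane) r w ∧
      ∑ i, w i • (i : Plane) = y}.encard = 2 := by
  have e : {w ∈ (planarRips X r hr).realization | ripsProjection X w = y} =
      {w | IsRipsWeight (Subtype.val : {x // x ∈ X} → Plane) r w ∧
        ∑ i, w i • (i : Plane) = y} := by
    ext w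
    exact and_congr mem_realization_planarRips Iff.rfl
  rw [← e]
  refine ⟨fun h => h.2, fun h => ⟨?_, h⟩⟩
  obtain ⟨w, w', -, he⟩ := Set.encard_eq_two.1 h
  obtain ⟨h1, h2⟩ : w ∈ {w ∈ (planarRips X r hr).realization | ripsProjection X w = y} :=
    he ▸ by simp
  exact ⟨w, h1, h2⟩

/-- Purity enters only through the dimension: there are no `3`-simplices. -/
theorem isClosedRips_of_isPure {X : Finset Plane} {hr : 0 < r} (hpure : (planarRips X r hr).IsPure 2)
    (hclosed : (planarRips X r hr).IsClosedOfDim 2) :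
    IsClosedRips (Subtype.val : {x // x ∈ X} → Plane) r where
  injective := Subtype.val_injective
  not_four := by
    intro a b c d hab hac had hbc hbd hcd
    have := hpure.1.2 {a, b, c, d} (mem_planarRips_faces.2 ⟨by simp, by
      have n := hr.le
      have s1 := hab.symm.2
      have s2 := hac.symm.2
      have s3 := had.symm.2
      have s4 := hbc.symm.2
      have s5 := hbd.symm.2
      have s6 := hcd.symm.2
      simp only [Finset.mem_insert, Finset.mem_singleton]
      rintro x (rfl | rfl | rfl | rfl) y (rfl | rfl | rfl | rfl)
      exacts [by rwa [dist_self], hab.2, hac.2, had.2, s1, by rwa [dist_self], hbc.2, hbd.2, s2, s4,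
        by rwa [dist_self], hcd.2, s3, s5, s6, by rwa [dist_self]]⟩)
    rw [Finset.card_insert_of_notMem (by simp [hab.1, hac.1, had.1]),
      Finset.card_insert_of_notMem (by simp [hbc.1, hbd.1]), Finset.card_pair hcd.1] at this
    omega
  two_triangles := by
    intro a b hab
    obtain ⟨t, ht, u, hu, htu, ht3, hu3, hst, hsu⟩ := hclosed {a, b}
      ((pair_mem_planarRips_faces hab.1).2 hab) (Finset.card_pair hab.1)
    have third : ∀ t : Finset {x // x ∈ X}, t.card = 2 + 1 → {a, b} ⊆ t →
        ∃ c, c ≠ a ∧ c ≠ b ∧ t = {a, b, c} := by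
      intro t ht3 hst
      obtain ⟨c, hct, hc⟩ := Finset.exists_mem_notMem_of_card_lt_card
        (show ({a, b} : Finset {x // x ∈ X}).card < t.card by rw [Finset.card_pair hab.1]; omega)
      simp only [Finset.mem_insert, Finset.mem_singleton, not_or] at hc
      refine ⟨c, hc.1, hc.2, (Finset.eq_of_subset_of_card_le ?_ ?_).symm⟩
      · intro x hx
        simp only [Finset.mem_insert, Finset.mem_singleton] at hx
        rcases hx with rfl | rfl | rfl
        exacts [hst (by simp), hst (by simp), hct]
      · rw [Finset.card_eq_three.2 ⟨a, b, c, hab.1, Ne.symm hc.1, Ne.symm hc.2, rfl⟩]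
        omega
    obtain ⟨c, hca, hcb, rfl⟩ := third t ht3 hst
    obtain ⟨d, hda, hdb, rfl⟩ := third u hu3 hsu
    have ht' := (mem_planarRips_faces_iff.1 ht).2
    have hu' := (mem_planarRips_faces_iff.1 hu).2
    refine ⟨c, d, fun e => htu (by rw [e]), ?_, ?_, ?_, ?_⟩
    exacts [ht' a (by simp) c (by simp) hca.symm, ht' b (by simp) c (by simp) hcb.symm,
      hu' a (by simp) d (by simp) hda.symm, hu' b (by simp) d (by simp) hdb.symm]

/-! ### Two-dimensional cycles -/

theorem IsHexagram.adj_iff {v : Fin 6 → ι} (hv : IsHexagram p r v) {k l : Fin 6} :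
    RipsAdj p r (v k) (v l) ↔ k ≠ l ∧ l ≠ k + 3 := by
  constructor
  · intro h
    refine ⟨fun e => h.1 (by rw [e]), ?_⟩
    rintro rfl
    exact hv.not_adj k h
  · rintro ⟨h1, h2⟩
    have : ∀ k l : Fin 6, k ≠ l → l ≠ k + 3 → l = k + 1 ∨ l = k + 2 ∨ k = l + 1 ∨ k = l + 2 := by
      decide
    rcases this k l h1 h2 with rfl | rfl | rfl | rfl
    exacts [hv.adj_one k, hv.adj_two k, (hv.adj_one l).symm, (hv.adj_two l).symm]

/-- The coefficients of a `2`-cycle of the Rips complex, as a function of three vertices. -/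
structure IsRipsCycle [Fintype ι] (p : ι → Plane) (r : ℝ) (f : ι → ι → ι → ℚ) : Prop where
  swap_left : ∀ a b c, f b a c = -f a b c
  swap_right : ∀ a b c, f a c b = -f a b c
  adj : ∀ {a b c}, f a b c ≠ 0 → RipsAdj p r a b ∧ RipsAdj p r a c ∧ RipsAdj p r b c
  sum_eq_zero : ∀ a b, ∑ z, f z a b = 0

theorem IsRipsCycle.rotate [Fintype ι] {f : ι → ι → ι → ℚ} (hf : IsRipsCycle p r f) (a b c : ι) :
    f c a b = f a b c := by
  rw [hf.swap_left, hf.swap_right, neg_neg]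

/-- A cycle that vanishes on the even triangle of a hexagram vanishes on the triangles that share a
side with it, since its sides lie in only two triangles. -/
theorem IsClosedRips.cycle_eq_zero [Fintype ι] (h : IsClosedRips p r) {f : ι → ι → ι → ℚ}
    (hf : IsRipsCycle p r f) {v : Fin 6 → ι} (hv : IsHexagram p r v)
    (h0 : f (v 0) (v 2) (v 4) = 0) {i : Fin 6} (hi : i = 0 ∨ i = 2 ∨ i = 4) (z : ι) :
    f z (v i) (v (i + 2)) = 0 := by
  have h4 : f (v (i + 4)) (v i) (v (i + 2)) = 0 := by
    rcases hi with rfl | rfl | rfl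
    · change f (v 4) (v 0) (v 2) = 0
      rw [hf.rotate, h0]
    · exact h0
    · change f (v 2) (v 4) (v 0) = 0
      rw [← hf.rotate, h0]
  have hother : ∀ z, z ≠ v (i + 1) → f z (v i) (v (i + 2)) = 0 := by
    intro z hz
    by_contra hne
    obtain ⟨a, b, -⟩ := hf.adj hne
    rcases h.eq_of_adj_diagonal hv a.symm b.symm with rfl | rfl
    exacts [hz rfl, hne h4]
  by_cases hz : z = v (i + 1)
  · have := hf.sum_eq_zero (v i) (v (i + 2))
    rw [Finset.sum_eq_single (v (i + 1)) (fun b _ hb => hother b hb)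
      (fun hn => absurd (Finset.mem_univ _) hn)] at this
    rw [hz, this]
  · exact hother z hz

/-- A cycle that vanishes on an even triangle of each hexagram is zero: otherwise its support
contains two triangles on the same side of a common side, hence triangles of both parities of some
hexagram. -/
theorem IsClosedRips.cycle_eq_zero_of_forall [Fintype ι] (h : IsClosedRips p r)
    {f : ι → ι → ι → ℚ} (hf : IsRipsCycle p r f)
    (h0 : ∀ w, IsHexagram p r w → ∃ v, IsHexagram p r v ∧ Set.range v = Set.range w ∧
      f (v 0) (v 2) (v 4) = 0) (a b c : ι) : f a b c = 0 := by
  by_contra hne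
  obtain ⟨a, b, c, d, hcd, hc, hd, hs⟩ := exists_same_side h.injective (fun a b c => f a b c ≠ 0)
    (fun hh => by rwa [hf.swap_left, neg_ne_zero]) (fun hh => by rwa [hf.swap_right, neg_ne_zero])
    (fun hh => h.orient_ne_zero (hf.adj hh).1 (hf.adj hh).2.1 (hf.adj hh).2.2) ⟨a, b, c, hne⟩ (by
      intro a b c hc
      by_contra! hcon
      have := hf.sum_eq_zero a b
      rw [Finset.sum_eq_single c (fun z _ hz => by rw [hf.rotate]; exact hcon z hz)
        (fun hn => absurd (Finset.mem_univ _) hn), hf.rotate] at this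
      exact hc this)
  obtain ⟨hab, hac, hbc⟩ := hf.adj hc
  obtain ⟨-, had, hbd⟩ := hf.adj hd
  obtain ⟨w, hw, h1, h2, h3⟩ := h.exists_isHexagram_of_same_side hab hac hbc had hbd hcd hs
  have n0 : f (w 1) (w 0) (w 2) ≠ 0 := by
    have : f (w 1) (w 2) (w 0) ≠ 0 := by
      rw [h1, h2]
      rcases h3 with ⟨e, -⟩ | ⟨e, -⟩ <;> rwa [e]
    rwa [hf.swap_right, neg_ne_zero] at this
  have n3 : f (w 2) (w 1) (w 3) ≠ 0 := by
    have : f (w 1) (w 2) (w 3) ≠ 0 := by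
      rw [h1, h2]
      rcases h3 with ⟨-, e⟩ | ⟨-, e⟩ <;> rwa [e]
    rwa [hf.swap_left, neg_ne_zero]
  obtain ⟨v, hv, hvw, hv0⟩ := h0 w hw
  have mem : ∀ k, w k ∈ Set.range v := fun k => hvw ▸ ⟨k, rfl⟩
  have parity : ∀ {k l : Fin 6} {x : ι}, IsCrossedEdge p r (w k) (w l) → f x (w k) (w l) ≠ 0 →
      (∃ i, (i = 1 ∨ i = 3 ∨ i = 5) ∧ w k = v i) ∧ ∃ i, (i = 1 ∨ i = 3 ∨ i = 5) ∧ w l = v i := by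
    intro k l x hkl hx
    obtain ⟨i, hi⟩ := mem k
    obtain ⟨j, hj⟩ := mem l
    rw [← hi, ← hj] at hkl hx ⊢
    have even_or_odd : ∀ i : Fin 6, (i = 0 ∨ i = 2 ∨ i = 4) ∨ (i = 1 ∨ i = 3 ∨ i = 5) := by decide
    have odd_add : ∀ i : Fin 6, (i = 1 ∨ i = 3 ∨ i = 5) → (i + 2 = 1 ∨ i + 2 = 3 ∨ i + 2 = 5) := by
      decide
    rcases h.eq_add_two_or hv hkl with rfl | rfl
    · rcases even_or_odd i with he | ho
      · exact absurd (h.cycle_eq_zero hf hv hv0 he x) hx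
      · exact ⟨⟨i, ho, rfl⟩, ⟨i + 2, odd_add i ho, rfl⟩⟩
    · rcases even_or_odd j with he | ho
      · rw [hf.swap_right, neg_ne_zero] at hx
        exact absurd (h.cycle_eq_zero hf hv hv0 he x) hx
      · exact ⟨⟨j + 2, odd_add j ho, rfl⟩, ⟨j, ho, rfl⟩⟩
  obtain ⟨-, i, hi, hwi⟩ := parity (hw.isCrossedEdge 0) n0
  obtain ⟨⟨j, hj, hwj⟩, -⟩ := parity (hw.isCrossedEdge 1) n3
  -- two odd vertices form a diagonal, while `w 1 w 2` is a side of the hexagon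
  have hij : i ≠ j := by
    rintro rfl
    exact absurd (hw.injective (hwi.trans hwj.symm)) (by decide)
  have key : ∀ i j : Fin 6, (i = 1 ∨ i = 3 ∨ i = 5) → (j = 1 ∨ j = 3 ∨ j = 5) → i ≠ j →
      j = i + 2 ∨ i = j + 2 := by decide
  have hc : IsCrossedEdge p r (w 1) (w 2) := by
    change w 2 = v i at hwi
    rw [hwi, hwj]
    rcases key i j hi hj hij with rfl | rfl
    exacts [(hv.isCrossedEdge i).symm, hv.isCrossedEdge j]
  exact absurd (h.eq_add_two_or hw hc) (by decide)

open Classical in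
/-- The function with values `1` at `v j`, `-1` at the antipodal vertex and `0` elsewhere. -/
noncomputable def antipodalDiff (v : Fin 6 → ι) (j : Fin 3) : ι → ℚ :=
  Pi.single (v (![0, 1, 2] j)) 1 - Pi.single (v (![3, 4, 5] j)) 1

/-- The fundamental cycle of the octahedron with antipodal vertices `v j`, `v (j + 3)`: the join of
three `0`-spheres, so that its coefficients are determinants. -/
noncomputable def octahedronCycle (v : Fin 6 → ι) (x : Fin 3 → ι) : ℚ :=
  (Matrix.of fun i j => antipodalDiff v j (x i)).det

theorem sum_antipodalDiff [Fintype ι] (v : Fin 6 → ι) (j : Fin 3) :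
    ∑ z, antipodalDiff v j z = 0 := by
  classical
  simp [antipodalDiff, Finset.sum_sub_distrib, Pi.single_apply]

theorem antipodalDiff_apply {v : Fin 6 → ι} (hv : Function.Injective v) (j : Fin 3) (k : Fin 6) :
    antipodalDiff v j (v k) =
      (if k = ![0, 1, 2] j then 1 else 0) - (if k = ![3, 4, 5] j then 1 else 0) := by
  classical
  simp only [antipodalDiff, Pi.sub_apply, Pi.single_apply, hv.eq_iff]

theorem antipodalDiff_antipodal {v : Fin 6 → ι} (hv : Function.Injective v) (j : Fin 3)
    (k : Fin 6) : antipodalDiff v j (v (k + 3)) = -antipodalDiff v j (v k) := by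
  rw [antipodalDiff_apply hv, antipodalDiff_apply hv]
  have h1 : ∀ (j : Fin 3) (k : Fin 6), (k + 3 = ![0, 1, 2] j ↔ k = ![3, 4, 5] j) ∧
    (k + 3 = ![3, 4, 5] j ↔ k = ![0, 1, 2] j) := by decide
  simp only [(h1 j k).1, (h1 j k).2]
  ring

theorem antipodalDiff_eq_zero {v : Fin 6 → ι} {x : ι} (hx : x ∉ Set.range v) (j : Fin 3) :
    antipodalDiff v j x = 0 := by
  classical
  have : ∀ k, x ≠ v k := fun k e => hx ⟨k, e.symm⟩
  simp [antipodalDiff, this]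

theorem octahedronCycle_perm (v : Fin 6 → ι) (σ : Equiv.Perm (Fin 3)) (x : Fin 3 → ι) :
    octahedronCycle v (x ∘ σ) = (((Equiv.Perm.sign σ : ℤˣ) : ℤ) : ℚ) * octahedronCycle v x := by
  exact Matrix.det_permute σ (Matrix.of fun i j => antipodalDiff v j (x i))

theorem mem_range_of_octahedronCycle_ne_zero {v : Fin 6 → ι} {x : Fin 3 → ι}
    (hx : octahedronCycle v x ≠ 0) (i : Fin 3) : x i ∈ Set.range v := by
  by_contra hi
  exact hx (Matrix.det_eq_zero_of_row_eq_zero i fun j => antipodalDiff_eq_zero hi j)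

theorem det_eq_zero_of_row_eq_neg (M : Matrix (Fin 3) (Fin 3) ℚ) {i i' : Fin 3} (hi : i ≠ i')
    (h : ∀ j, M i' j = -M i j) : M.det = 0 := by
  have h1 := Matrix.det_updateRow_smul M i' (-1) (M i)
  rw [Matrix.det_updateRow_eq_zero hi, mul_zero] at h1
  rwa [show (-1 : ℚ) • M i = M i' by ext j; simp [h], Matrix.updateRow_eq_self] at h1

theorem IsHexagram.adj_of_octahedronCycle_ne_zero {v : Fin 6 → ι} (hv : IsHexagram p r v)
    {x : Fin 3 → ι} (hx : octahedronCycle v x ≠ 0) {i j : Fin 3} (hij : i ≠ j) :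
    RipsAdj p r (x i) (x j) := by
  obtain ⟨k, hk⟩ := mem_range_of_octahedronCycle_ne_zero hx i
  obtain ⟨l, hl⟩ := mem_range_of_octahedronCycle_ne_zero hx j
  rw [← hk, ← hl, hv.adj_iff]
  constructor
  · rintro rfl
    refine hx (Matrix.det_zero_of_row_eq hij ?_)
    funext m
    simp [← hk, ← hl]
  · rintro rfl
    refine hx (det_eq_zero_of_row_eq_neg _ hij fun m => ?_)
    simp only [Matrix.of_apply, ← hk, ← hl]
    exact antipodalDiff_antipodal hv.injective m k

theorem sum_octahedronCycle [Fintype ι] (v : Fin 6 → ι) (y : Fin 2 → ι) :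
    ∑ z, octahedronCycle v (Fin.cons z y) = 0 := by
  have e : ∀ z, octahedronCycle v (Fin.cons z y) =
      antipodalDiff v 0 z * (antipodalDiff v 1 (y 0) * antipodalDiff v 2 (y 1) -
        antipodalDiff v 2 (y 0) * antipodalDiff v 1 (y 1)) -
      antipodalDiff v 1 z * (antipodalDiff v 0 (y 0) * antipodalDiff v 2 (y 1) -
        antipodalDiff v 2 (y 0) * antipodalDiff v 0 (y 1)) +
      antipodalDiff v 2 z * (antipodalDiff v 0 (y 0) * antipodalDiff v 1 (y 1) -
        antipodalDiff v 1 (y 0) * antipodalDiff v 0 (y 1)) := by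
    intro z
    rw [octahedronCycle, Matrix.det_fin_three]
    simp only [Matrix.of_apply]
    change antipodalDiff v 0 z * antipodalDiff v 1 (y 0) * antipodalDiff v 2 (y 1) -
      antipodalDiff v 0 z * antipodalDiff v 2 (y 0) * antipodalDiff v 1 (y 1) -
      antipodalDiff v 1 z * antipodalDiff v 0 (y 0) * antipodalDiff v 2 (y 1) +
      antipodalDiff v 1 z * antipodalDiff v 2 (y 0) * antipodalDiff v 0 (y 1) +
      antipodalDiff v 2 z * antipodalDiff v 0 (y 0) * antipodalDiff v 1 (y 1) -
      antipodalDiff v 2 z * antipodalDiff v 1 (y 0) * antipodalDiff v 0 (y 1) = _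
    ring
  simp only [e, Finset.sum_add_distrib, Finset.sum_sub_distrib, ← Finset.sum_mul,
    sum_antipodalDiff, zero_mul, sub_zero, add_zero]

theorem octahedronCycle_even {v : Fin 6 → ι} (hv : Function.Injective v) :
    octahedronCycle v ![v 0, v 2, v 4] = 1 := by
  rw [octahedronCycle, Matrix.det_fin_three]
  simp [antipodalDiff_apply hv]

/-! ### The second Betti number -/

section Betti

variable {X : Finset Plane} {hr : 0 < r}

open AbstractSimplicialComplex

theorem isRipsCycle_of_mem_cycles {c : (Fin 3 → {x // x ∈ X}) → ℚ}
    (hc : c ∈ (planarRips X r hr).cycles 2) :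
    IsRipsCycle (Subtype.val : {x // x ∈ X} → Plane) r fun a b z => c ![a, b, z] := by
  obtain ⟨⟨hperm, hsupp⟩, hb⟩ := hc
  refine ⟨fun a b z => ?_, fun a b z => ?_, fun {a b z} hne => ?_, fun a b => ?_⟩
  · have := hperm (Equiv.swap 0 1) ![a, b, z]
    rw [Equiv.Perm.sign_swap (by decide),
      show ![a, b, z] ∘ Equiv.swap 0 1 = ![b, a, z] by ext i; fin_cases i <;> rfl] at this
    simpa using this
  · have := hperm (Equiv.swap 1 2) ![a, b, z]
    rw [Equiv.Perm.sign_swap (by decide),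
      show ![a, b, z] ∘ Equiv.swap 1 2 = ![a, z, b] by ext i; fin_cases i <;> rfl] at this
    simpa using this
  · obtain ⟨hinj, hf⟩ := hsupp _ hne
    have key : ∀ i j : Fin 3, i ≠ j →
        RipsAdj (Subtype.val : {x // x ∈ X} → Plane) r (![a, b, z] i) (![a, b, z] j) :=
      fun i j hij => (mem_planarRips_faces_iff.1 hf).2 _ (by simp) _ (by simp)
        (fun e => hij (hinj e))
    exact ⟨key 0 1 (by decide), key 0 2 (by decide), key 1 2 (by decide)⟩
  · exact congrFun (LinearMap.mem_ker.1 hb) ![a, b]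

theorem octahedronCycle_mem_cycles {v : Fin 6 → {x // x ∈ X}}
    (hv : IsHexagram (Subtype.val : {x // x ∈ X} → Plane) r v) :
    octahedronCycle v ∈ (planarRips X r hr).cycles 2 := by
  refine ⟨⟨fun σ x => octahedronCycle_perm v σ x, fun x hx => ?_⟩, ?_⟩
  · have hadj := fun i j hij => hv.adj_of_octahedronCycle_ne_zero hx (i := i) (j := j) hij
    refine ⟨fun i j e => ?_, ?_⟩
    · by_contra hij
      exact (hadj i j hij).1 e
    · rw [mem_planarRips_faces_iff]
      refine ⟨by simp, ?_⟩
      simp only [Finset.mem_map, Finset.mem_univ, true_and]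
      rintro _ ⟨i, rfl⟩ _ ⟨j, rfl⟩ hij
      exact hadj i j fun e => hij (by rw [e])
  · refine LinearMap.mem_ker.2 ?_
    funext y
    exact sum_octahedronCycle v y

/-- Evaluation of cycles at one even triangle of each hexagram is an isomorphism. -/
theorem finrank_cycles_two (h : IsClosedRips (Subtype.val : {x // x ∈ X} → Plane) r) :
    Module.finrank ℚ ((planarRips X r hr).cycles 2) =
      Nat.card (hexagramSets (Subtype.val : {x // x ∈ X} → Plane) r) := by
  classical
  choose v hv hv0 hvU using
    exists_hexagramSets_eq_range (p := (Subtype.val : {x // x ∈ X} → Plane)) (r := r)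
  have : Fintype (hexagramSets (Subtype.val : {x // x ∈ X} → Plane) r) := Fintype.ofFinite _
  let Φ : (planarRips X r hr).cycles 2 →ₗ[ℚ] 
      (hexagramSets (Subtype.val : {x // x ∈ X} → Plane) r → ℚ) :=
    { toFun := fun c U => (c : (Fin 3 → {x // x ∈ X}) → ℚ) ![v U 0, v U 2, v U 4]
      map_add' := fun _ _ => rfl
      map_smul' := fun _ _ => rfl }
  have hinj : Function.Injective Φ := by
    rw [← LinearMap.ker_eq_bot, LinearMap.ker_eq_bot']
    rintro ⟨c, hc⟩ hΦ
    have hzero := h.cycle_eq_zero_of_forall (isRipsCycle_of_mem_cycles hc) (by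
      intro w hw
      obtain ⟨U, hU, hUw⟩ := hw.exists_mem_hexagramSets
      exact ⟨v ⟨U, hU⟩, hv _, (hvU ⟨U, hU⟩).symm.trans hUw, congrFun hΦ ⟨U, hU⟩⟩)
    ext x
    change c x = 0
    rw [← hzero (x 0) (x 1) (x 2)]
    congr 1
    ext i
    fin_cases i <;> rfl
  have hsurj : Function.Surjective Φ := by
    intro a
    refine ⟨∑ U, a U • ⟨octahedronCycle (v U), octahedronCycle_mem_cycles (hv U)⟩, ?_⟩
    rw [map_sum]
    funext U
    rw [Finset.sum_apply, Finset.sum_eq_single U]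
    · rw [map_smul, Pi.smul_apply]
      change a U • octahedronCycle (v U) ![v U 0, v U 2, v U 4] = a U
      rw [octahedronCycle_even (hv U).injective, smul_eq_mul, mul_one]
    · intro U' _ hne
      rw [map_smul, Pi.smul_apply]
      change a U' • octahedronCycle (v U') ![v U 0, v U 2, v U 4] = 0
      -- different hexagrams have no common diagonal
      by_contra hcon
      have hx : octahedronCycle (v U') ![v U 0, v U 2, v U 4] ≠ 0 := fun e => hcon (by
        rw [e, smul_zero])
      have hr := h.range_eq (hv U) (hv U') ((hv U).isCrossedEdge 0) ⟨_, rfl⟩ ⟨_, rfl⟩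
        (mem_range_of_octahedronCycle_ne_zero hx 0) (mem_range_of_octahedronCycle_ne_zero hx 1)
      rw [← hvU, ← hvU] at hr
      exact hne (Subtype.ext (Finset.coe_injective hr.symm))
    · exact fun hn => absurd (Finset.mem_univ _) hn
  rw [(LinearEquiv.ofBijective Φ ⟨hinj, hsurj⟩).finrank_eq, Module.finrank_fintype_fun_eq_card,
    Nat.card_eq_fintype_card]

theorem betti_two_eq_finrank (hdim : (planarRips X r hr).HasDim 2) :
    (planarRips X r hr).betti 2 = Module.finrank ℚ ((planarRips X r hr).cycles 2) := by
  have h3 : (planarRips X r hr).chains 3 = ⊥ := by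
    rw [eq_bot_iff]
    rintro c ⟨-, hc⟩
    rw [Submodule.mem_bot]
    funext x
    by_contra hx
    obtain ⟨hinj, hf⟩ := hc x hx
    have := hdim.2 _ hf
    simp at this
  have hb : ((planarRips X r hr).boundaries 2).submoduleOf ((planarRips X r hr).cycles 2) = ⊥ := by
    rw [boundaries, h3, Submodule.map_bot, Submodule.submoduleOf, Submodule.comap_bot,
      Submodule.ker_subtype]
  exact (Submodule.quotEquivOfEqBot _ hb).finrank_eq

end Betti

end Rips

/-! ### Induced octahedra and hexagrams -/

theorem IsHexagram.isomorphic_crossPolytope {X : Finset Plane} {r : ℝ} {hr : 0 < r}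
    {v : Fin 6 → {x // x ∈ X}} (hv : IsHexagram (Subtype.val : {x // x ∈ X} → Plane) r v)
    {U : Finset {x // x ∈ X}} (hU : (U : Set {x // x ∈ X}) = Set.range v) :
    ((planarRips X r hr).induced U).Isomorphic (AbstractSimplicialComplex.crossPolytope 2) := by
  have hmem : ∀ i, v i ∈ U := fun i => by
    rw [← Finset.mem_coe, hU]
    exact ⟨i, rfl⟩
  let g : Fin 3 × Bool → Fin 6 := fun k => if k.2 then ![0, 1, 2] k.1 else ![3, 4, 5] k.1
  have ginj : ∀ k l : Fin 3 × Bool, g k = g l → k = l := by decide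
  have gsurj : ∀ i : Fin 6, ∃ k, g k = i := by decide
  have ganti : ∀ i : Fin 3, g (i, false) = g (i, true) + 3 := by decide
  have ganti' : ∀ k l : Fin 3 × Bool, g l = g k + 3 → k.1 = l.1 ∧ k.2 = !l.2 := by decide
  let e : Fin 3 × Bool ≃ {x // x ∈ U} := Equiv.ofBijective (fun k => ⟨v (g k), hmem _⟩) (by
    constructor
    · intro k l hkl
      exact ginj k l (hv.injective (Subtype.ext_iff.1 hkl))
    · rintro ⟨x, hx⟩
      rw [← Finset.mem_coe, hU] at hx
      obtain ⟨i, rfl⟩ := hx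
      obtain ⟨k, rfl⟩ := gsurj i
      exact ⟨k, rfl⟩)
  have he : ∀ k, (e k : {x // x ∈ X}) = v (g k) := fun k => rfl
  refine ⟨e.symm, fun s => ?_⟩
  have hs : ∀ k, k ∈ s.map e.symm.toEmbedding ↔ e k ∈ s := fun k => by
    rw [Finset.mem_map_equiv, Equiv.symm_symm]
  change s.map (Function.Embedding.subtype _) ∈ (planarRips X r hr).faces ↔
    (s.map e.symm.toEmbedding).Nonempty ∧ ∀ i, ¬((i, true) ∈ s.map e.symm.toEmbedding ∧
      (i, false) ∈ s.map e.symm.toEmbedding)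
  rw [mem_planarRips_faces_iff, Finset.map_nonempty, Finset.map_nonempty]
  refine and_congr_right fun _ => ⟨?_, ?_⟩
  · rintro h i ⟨h1, h2⟩
    rw [hs] at h1 h2
    have := h _ (Finset.mem_map_of_mem _ h1) _ (Finset.mem_map_of_mem _ h2) (by
      intro hh
      have := ginj _ _ (hv.injective hh)
      simp at this)
    change RipsAdj _ r (v (g (i, true))) (v (g (i, false))) at this
    rw [ganti] at this
    exact hv.not_adj _ this
  · rintro h x hx y hy hxy
    obtain ⟨x', hx', rfl⟩ := Finset.mem_map.1 hx
    obtain ⟨y', hy', rfl⟩ := Finset.mem_map.1 hy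
    obtain ⟨k, rfl⟩ := e.surjective x'
    obtain ⟨l, rfl⟩ := e.surjective y'
    change RipsAdj _ r (v (g k)) (v (g l))
    rw [hv.adj_iff]
    refine ⟨fun hh => hxy (by rw [ginj k l hh]), fun hh => ?_⟩
    obtain ⟨k1, kb⟩ := k
    obtain ⟨l1, lb⟩ := l
    obtain ⟨h1, h2⟩ := ganti' _ _ hh
    simp only at h1 h2
    subst h1 h2
    rcases lb with _ | _
    · exact h k1 ⟨(hs _).2 hx', (hs _).2 hy'⟩
    · exact h k1 ⟨(hs _).2 hy', (hs _).2 hx'⟩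

/-- The vertices of an octahedron satisfy the hypotheses on planar Rips complexes by themselves, so
that they form a hexagram. -/
theorem exists_isHexagram_of_isomorphic {X : Finset Plane} {r : ℝ} {hr : 0 < r}
    {U : Finset {x // x ∈ X}}
    (hU : ((planarRips X r hr).induced U).Isomorphic (AbstractSimplicialComplex.crossPolytope 2)) :
    ∃ v, IsHexagram (Subtype.val : {x // x ∈ X} → Plane) r v ∧
      (U : Set {x // x ∈ X}) = Set.range v := by
  obtain ⟨e, he⟩ := hU
  let j : Fin 3 × Bool → {x // x ∈ X} := fun k => e.symm k
  have hj : Function.Injective j := Subtype.val_injective.comp e.symm.injective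
  have hadj : ∀ k l, RipsAdj (Subtype.val : {x // x ∈ X} → Plane) r (j k) (j l) ↔ k.1 ≠ l.1 := by
    intro k l
    by_cases hkl : k = l
    · subst hkl
      exact iff_of_false (fun h => h.1 rfl) (fun h => h rfl)
    rw [← pair_mem_planarRips_faces (hr := hr) (fun h => hkl (hj h))]
    have hs := he {e.symm k, e.symm l}
    have h1 : ({e.symm k, e.symm l} : Finset {v // v ∈ U}).map (Function.Embedding.subtype _) =
        {j k, j l} := by
      rw [Finset.map_insert, Finset.map_singleton]
      rfl
    have h2 : ({e.symm k, e.symm l} : Finset {v // v ∈ U}).map e.toEmbedding = {k, l} := by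
      rw [Finset.map_insert, Finset.map_singleton]
      simp
    rw [h2] at hs
    change Finset.map _ _ ∈ (planarRips X r hr).faces ↔ _ at hs
    rw [h1] at hs
    rw [hs]
    change (({k, l} : Finset (Fin 3 × Bool)).Nonempty ∧ ∀ i : Fin 3,
      ¬((i, true) ∈ ({k, l} : Finset (Fin 3 × Bool)) ∧
        (i, false) ∈ ({k, l} : Finset (Fin 3 × Bool)))) ↔ k.1 ≠ l.1
    revert hkl
    clear hs h1 h2
    revert k l
    decide
  have hadj' : ∀ k l, RipsAdj (fun k => (j k : Plane)) r k l ↔ k.1 ≠ l.1 := by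
    intro k l
    rw [← hadj]
    exact and_congr_left fun _ => not_congr hj.eq_iff.symm
  have h : IsClosedRips (fun k => (j k : Plane)) r := by
    refine ⟨Subtype.val_injective.comp hj, ?_, ?_⟩
    · intro a b c d
      simp only [hadj']
      intro h1 h2 h3 h4 h5 h6
      omega
    · intro a b hab
      rw [hadj'] at hab
      obtain ⟨m, hm1, hm2⟩ : ∃ m : Fin 3, a.1 ≠ m ∧ b.1 ≠ m :=
        (by decide : ∀ x y : Fin 3, ∃ m, x ≠ m ∧ y ≠ m) a.1 b.1
      exact ⟨(m, true), (m, false), by simp, (hadj' _ _).2 hm1, (hadj' _ _).2 hm2,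
        (hadj' _ _).2 hm1, (hadj' _ _).2 hm2⟩
  obtain ⟨v, hv⟩ := h.exists_isHexagram_of_adj (a := (0, true)) (b := (1, true))
    ((hadj' _ _).2 (by decide))
  have hadj'' : ∀ {k l}, RipsAdj (fun k => (j k : Plane)) r k l ↔
      RipsAdj (Subtype.val : {x // x ∈ X} → Plane) r (j k) (j l) :=
    fun {k l} => (hadj' k l).trans (hadj k l).symm
  have hsurj : Function.Surjective v :=
    ((Fintype.bijective_iff_injective_and_card v).2 ⟨hv.injective, by simp⟩).2
  refine ⟨fun i => j (v i), ⟨hj.comp hv.injective, fun i => hadj''.1 (hv.adj_one i),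
    fun i => hadj''.1 (hv.adj_two i), fun i hh => hv.not_adj i (hadj''.2 hh), hv.crosses⟩, ?_⟩
  ext x
  constructor
  · intro hx
    obtain ⟨i, hi⟩ := hsurj (e ⟨x, hx⟩)
    exact ⟨i, by simp [j, hi]⟩
  · rintro ⟨i, rfl⟩
    exact (e.symm (v i)).2

theorem inducedOctahedra_planarRips {X : Finset Plane} {r : ℝ} {hr : 0 < r} :
    (planarRips X r hr).inducedOctahedra =
      hexagramSets (Subtype.val : {x // x ∈ X} → Plane) r := by
  ext U
  exact ⟨fun h => exists_isHexagram_of_isomorphic h,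
    fun ⟨v, hv, hU⟩ => hv.isomorphic_crossPolytope hU⟩

/-! ### Crossed hexagons -/

section Hexagons

variable {ι : Type*} {p : ι → Plane} {r : ℝ}

/-- The edges with endpoints in `U` that are not crossed by any edge. -/
def uncrossedEdges (p : ι → Plane) (r : ℝ) (U : Finset ι) : Set (Sym2 ι) :=
  {e | ∃ a ∈ U, ∃ b ∈ U, e = s(a, b) ∧ RipsAdj p r a b ∧ ¬IsCrossedEdge p r a b}

theorem IsClosedRips.uncrossedEdges_eq (h : IsClosedRips p r) {v : Fin 6 → ι}
    (hv : IsHexagram p r v) {U : Finset ι} (hU : (U : Set ι) = Set.range v) :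
    uncrossedEdges p r U = Set.range fun i => s(v i, v (i + 1)) := by
  have hmem : ∀ x, x ∈ U ↔ ∃ i, v i = x := fun x => by
    rw [← Finset.mem_coe, hU, Set.mem_range]
  ext e
  constructor
  · rintro ⟨a, ha, b, hb, rfl, hab, hn⟩
    obtain ⟨k, rfl⟩ := (hmem _).1 ha
    obtain ⟨l, rfl⟩ := (hmem _).1 hb
    obtain ⟨h1, h2⟩ := hv.adj_iff.1 hab
    have : ∀ k l : Fin 6, k ≠ l → l ≠ k + 3 → l = k + 1 ∨ l = k + 2 ∨ k = l + 1 ∨ k = l + 2 := by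
      decide
    rcases this k l h1 h2 with rfl | rfl | rfl | rfl
    exacts [⟨k, rfl⟩, absurd (hv.isCrossedEdge k) hn, ⟨l, Sym2.eq_swap⟩,
      absurd (hv.isCrossedEdge l).symm hn]
  · rintro ⟨i, rfl⟩
    refine ⟨_, (hmem _).2 ⟨i, rfl⟩, _, (hmem _).2 ⟨i + 1, rfl⟩, rfl, hv.adj_one i, ?_⟩
    rintro ⟨-, c, d, hcd, hx⟩
    exact h.not_crosses_side hv i hcd hx

theorem IsClosedRips.injOn_uncrossedEdges (h : IsClosedRips p r) :
    Set.InjOn (uncrossedEdges p r) (hexagramSets p r) := by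
  have main : ∀ {U U' : Finset ι}, U ∈ hexagramSets p r → U' ∈ hexagramSets p r →
      uncrossedEdges p r U = uncrossedEdges p r U' → U ⊆ U' := by
    rintro U U' ⟨v, hv, hU⟩ - he x hx
    rw [← Finset.mem_coe, hU] at hx
    obtain ⟨i, rfl⟩ := hx
    have hi : s(v i, v (i + 1)) ∈ uncrossedEdges p r U' := by
      rw [← he, h.uncrossedEdges_eq hv hU]
      exact ⟨i, rfl⟩
    obtain ⟨a, ha, b, hb, hab, -⟩ := hi
    rcases Sym2.eq_iff.1 hab with ⟨rfl, -⟩ | ⟨rfl, -⟩ <;> assumption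
  exact fun U hU U' hU' he => (main hU hU' he).antisymm (main hU' hU he.symm)

/-- The hexagon of a hexagram is simple. -/
theorem IsHexagram.segment_inter_subset {v : Fin 6 → ι} (hv : IsHexagram p r v)
    (h0 : 0 < orient (p (v 0)) (p (v 1)) (p (v 2))) {i j : Fin 6} (hij : i ≠ j) :
    segment ℝ (p (v i)) (p (v (i + 1))) ∩ segment ℝ (p (v j)) (p (v (j + 1))) ⊆
      {p (v i), p (v (i + 1))} ∩ {p (v j), p (v (j + 1))} := by
  rintro y ⟨⟨s', t', -, -, hst', hy'⟩, ⟨s, t, hs, ht, hst, rfl⟩⟩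
  -- the second side lies to the left of the line through the first one
  have e : s * orient (p (v i)) (p (v (i + 1))) (p (v j)) +
      t * orient (p (v i)) (p (v (i + 1))) (p (v (j + 1))) = 0 := by
    rw [← orient_smul_add_smul _ _ _ _ hst, ← hy', orient_smul_add_smul _ _ _ _ hst',
      orient_left_self, orient_right_self]
    ring
  have n1 := mul_nonneg hs (hv.orient_nonneg h0 i j)
  have n2 := mul_nonneg ht (hv.orient_nonneg h0 i (j + 1))
  have z1 : s * orient (p (v i)) (p (v (i + 1))) (p (v j)) = 0 := by linarith
  have z2 : t * orient (p (v i)) (p (v (i + 1))) (p (v (j + 1))) = 0 := by linarith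
  by_cases hj : j = i + 1
  · subst hj
    have hp := hv.orient_pos_of_ne h0 (i := i) (j := i + 1 + 1)
      ((by decide : ∀ i : Fin 6, i + 1 + 1 ≠ i) i) ((by decide : ∀ i : Fin 6, i + 1 + 1 ≠ i + 1) i)
    obtain rfl : t = 0 := (mul_eq_zero.1 z2).resolve_right hp.ne'
    obtain rfl : s = 1 := by linarith
    simp
  · have hp := hv.orient_pos_of_ne h0 hij.symm hj
    obtain rfl : s = 0 := (mul_eq_zero.1 z1).resolve_right hp.ne'
    obtain rfl : t = 1 := by linarith
    have hj' : j + 1 = i := by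
      by_contra hne
      have := hv.orient_pos_of_ne h0 hne (fun hh => hij (by simpa using hh.symm))
      linarith
    rw [hj']
    simp

/-- Six points in cyclic order, at distance at most `r` from the next two, form a hexagram as soon
as two of their diagonals cross. -/
theorem IsClosedRips.isHexagram_of_crosses (h : IsClosedRips p r) {v : Fin 6 → ι}
    (hinj : Function.Injective v) (h1 : ∀ i, RipsAdj p r (v i) (v (i + 1)))
    (h2 : ∀ i, RipsAdj p r (v i) (v (i + 2))) {i : Fin 6}
    (hx : Crosses (p (v i)) (p (v (i + 2))) (p (v (i + 1))) (p (v (i + 3)))) :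
    IsHexagram p r v := by
  have ne : ∀ k l : Fin 6, k ≠ l → v (i + k) ≠ v (i + l) :=
    fun k l hkl hh => hkl (by simpa using hinj hh)
  have a1 : ∀ k l : Fin 6, l = k + 1 → RipsAdj p r (v (i + k)) (v (i + l)) := by
    rintro k l rfl
    have := h1 (i + k)
    rwa [add_assoc] at this
  have a2 : ∀ k l : Fin 6, l = k + 2 → RipsAdj p r (v (i + k)) (v (i + l)) := by
    rintro k l rfl
    have := h2 (i + k)
    rwa [add_assoc] at this
  rw [← add_zero i] at hx
  simp only [add_assoc, zero_add] at hx
  obtain ⟨x, x', y, y', hx, hy, hh⟩ := h.exists_isHexagram_of_triangles (c := v (i + 4))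
    (f := v (i + 5)) (a2 0 2 rfl) (a2 4 0 rfl).symm (a2 2 4 rfl) (a2 1 3 rfl) (a2 5 1 rfl).symm
    (a2 3 5 rfl) (ne 0 5 (by decide)) (ne 2 5 (by decide)) (ne 4 5 (by decide))
    (ne 4 1 (by decide)) (ne 4 3 (by decide)) hx
  have hn : ¬RipsAdj p r x y' := hh.not_adj 0
  have hv : IsHexagram p r fun k => v (k + i) := by
    rcases hx with ⟨rfl, rfl⟩ | ⟨rfl, rfl⟩ <;> rcases hy with ⟨rfl, rfl⟩ | ⟨rfl, rfl⟩
    · convert hh using 1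
      funext k
      rw [add_comm]
      fin_cases k <;> rfl
    · exact absurd (a1 0 1 rfl) hn
    · exact absurd (a1 2 3 rfl) hn
    · exact absurd (a1 1 2 rfl).symm hn
  have := hv.rotate (-i)
  simpa using this

end Hexagons

theorem crossedHexagons_eq_image {X : Finset Plane} {r : ℝ} {hr : 0 < r}
    (h : IsClosedRips (Subtype.val : {x // x ∈ X} → Plane) r) :
    crossedHexagons X r hr = uncrossedEdges (Subtype.val : {x // x ∈ X} → Plane) r ''
      hexagramSets (Subtype.val : {x // x ∈ X} → Plane) r := by
  have n1 : ∀ i : Fin 6, i ≠ i + 1 := by decide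
  have n2 : ∀ i : Fin 6, i ≠ i + 2 := by decide
  ext E
  constructor
  · rintro ⟨v, hinj, rfl, h1, -, h2, i, j, hij, hx⟩
    have a1 : ∀ i, RipsAdj (Subtype.val : {x // x ∈ X} → Plane) r (v i) (v (i + 1)) := fun i =>
      (pair_mem_planarRips_faces fun hh => n1 i (hinj hh)).1 (h1 i)
    have a2 : ∀ i, RipsAdj (Subtype.val : {x // x ∈ X} → Plane) r (v i) (v (i + 2)) := fun i =>
      (pair_mem_planarRips_faces fun hh => n2 i (hinj hh)).1 (h2 i)
    have hn : ∀ i, ¬RipsAdj (Subtype.val : {x // x ∈ X} → Plane) r (v i) (v (i + 3)) := by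
      intro i hi
      have b1 := a1 (i + 1)
      have b2 := a1 (i + 2)
      have c1 := a2 (i + 1)
      rw [add_assoc] at b1 b2 c1
      exact h.not_four (a1 i) (a2 i) hi b1 c1 b2
    have hc : Crosses (v i : Plane) (v (i + 2)) (v j) (v (j + 2)) := by
      refine h.crosses (a2 i) (a2 j) (fun hh => ?_) hx
      rcases Sym2.eq_iff.1 hh with ⟨e, -⟩ | ⟨e1, e2⟩
      · exact hij (hinj e)
      · exact (by decide : ∀ i j : Fin 6, i = j + 2 → i + 2 = j → False) i j (hinj e1) (hinj e2)
    have hv : IsHexagram (Subtype.val : {x // x ∈ X} → Plane) r v := by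
      have key : ∀ i j : Fin 6, i ≠ j →
          j = i + 1 ∨ i = j + 1 ∨ j = i + 2 ∨ i = j + 2 ∨ j = i + 3 := by decide
      rcases key i j hij with rfl | rfl | rfl | rfl | rfl
      · rw [add_assoc] at hc
        exact h.isHexagram_of_crosses hinj a1 a2 hc
      · rw [add_assoc] at hc
        exact h.isHexagram_of_crosses hinj a1 a2 hc.symm
      · exact absurd rfl hc.ne.2.2.1
      · exact absurd rfl hc.ne.2.1
      · exfalso
        rcases ((a2 i).sides (a2 (i + 3)) hc).1 with hh | hh
        · exact hn _ hh
        · have e : i + 3 + 2 = i + 2 + 3 := by abel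
          rw [e] at hh
          exact hn _ hh
    obtain ⟨U, hU, hUv⟩ := hv.exists_mem_hexagramSets
    exact ⟨U, hU, h.uncrossedEdges_eq hv hUv⟩
  · rintro ⟨U, hU, rfl⟩
    obtain ⟨v, hv, hv0, hUv⟩ := exists_hexagramSets_eq_range ⟨U, hU⟩
    refine ⟨v, hv.injective, h.uncrossedEdges_eq hv hUv, fun i => ?_,
      fun i j hij => hv.segment_inter_subset hv0 hij, fun i => ?_, 0, 1, by decide,
      (hv.crosses 0).openSegment_inter_nonempty⟩
    · exact (pair_mem_planarRips_faces fun hh => n1 i (hv.injective hh)).2 (hv.adj_one i)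
    · exact (pair_mem_planarRips_faces fun hh => n2 i (hv.injective hh)).2 (hv.adj_two i)

theorem theoremC (X : Finset Plane) (r : ℝ) (hr : 0 < r)
    (hpure : (planarRips X r hr).IsPure 2)
    (hclosed : (planarRips X r hr).IsClosedOfDim 2) :
    (∃ U : Finset {x // x ∈ X},
      ((planarRips X r hr).induced U).Isomorphic (AbstractSimplicialComplex.crossPolytope 2)) ∧
    (planarRips X r hr).betti 2 ≠ 0 ∧
    ENat.card (ConnectedComponents (doublyCovered X r hr)) = ((planarRips X r hr).betti 2 : ℕ∞) ∧
    (crossedHexagons X r hr).encard = ((planarRips X r hr).betti 2 : ℕ∞) ∧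
    (planarRips X r hr).inducedOctahedra.encard = ((planarRips X r hr).betti 2 : ℕ∞) := by
  have h := isClosedRips_of_isPure hpure hclosed
  have hb : (planarRips X r hr).betti 2 =
      Nat.card (hexagramSets (Subtype.val : {x // x ∈ X} → Plane) r) :=
    (betti_two_eq_finrank hpure.1).trans (finrank_cycles_two h)
  have he : (hexagramSets (Subtype.val : {x // x ∈ X} → Plane) r).encard =
      ((planarRips X r hr).betti 2 : ℕ∞) := by
    rw [hb, Nat.card_coe_set_eq, Set.Finite.cast_ncard_eq (Set.toFinite _)]
  -- the two-dimensional simplex has an edge, hence there is a hexagram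
  obtain ⟨s, hs, hs3⟩ := hpure.1.1
  obtain ⟨a, b, c, hab, -, -, rfl⟩ := Finset.card_eq_three.1 hs3
  have hadj := (mem_planarRips_faces_iff.1 hs).2 a (by simp) b (by simp) hab
  obtain ⟨v, hv⟩ := h.exists_isHexagram_of_adj hadj
  obtain ⟨U, hU, hUv⟩ := hv.exists_mem_hexagramSets
  refine ⟨⟨U, hv.isomorphic_crossPolytope hUv⟩, ?_, ?_, ?_, ?_⟩
  · have : Nonempty (hexagramSets (Subtype.val : {x // x ∈ X} → Plane) r) := ⟨⟨U, hU⟩⟩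
    rw [hb]
    exact Nat.card_pos.ne'
  · rw [← he]
    exact h.card_connectedComponents fun y => mem_doublyCovered
  · rw [crossedHexagons_eq_image h, h.injOn_uncrossedEdges.encard_image, he]
  · rw [inducedOctahedra_planarRips, he]
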